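/- **Setting.** Let $\pi:E\to M$ be a smooth real vector bundle of finite rank over a manifold $M$ of dimension $n\ge 1$, and let $\nu$ be a volume form on $M$. Let $J^\infty E$ be the infinite jet bundle, with adapted coordinates $(x^i,u^a_J)$ ($J$ a symmetric multi-index), and let $Loc_E$ be the algebra of functions on $J^\infty E$ that are pulled back from smooth functions on some finite jet bundle. Let $\Omega^{k,0}$ be the space of horizontal $k$-forms $\alpha_I\,dx^I$ with local coefficients ($\Omega^{k,0}=0$ for $k<0$), with differential $l_1=d_H$, $d_H(\alpha_I dx^I)=D_i\alpha_I\,dx^i\wedge dx^I$, where $D_i=\partial/\partial x^i+u^a_{iJ}\,\partial/\partial u^a_J$. Let $\Omega^{n,1}_0$ be the space of forms $\sigma_a\,\theta^a\wedge d^nx$, where $\theta^a=du^a-u^a_i\,dx^i$ and the $\sigma_a$ are local functions. The Euler–Lagrange operator $\mathbf E:\Omega^{n,0}\to\Omega^{n,1}_0$ is $\mathbf E(L\,d^nx)=\sum_J(-D)_J\!\left(\partial L/\partial u^a_J\right)\theta^a\wedge d^nx$. Let $\omega:\Omega^{n,1}_0\times\Omega^{n,1}_0\to Loc_E$ be skew-symmetric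 and $Loc_E$-linear in each variable, and put $$\tilde l_2(\alpha,\beta)=\omega(\mathbf E(\alpha),\mathbf E(\beta))\,\nu,\qquad \alpha,\beta\in\Omega^{n,0}.$$ Let $\psi:E\to E$ be a diffeomorphism sending fibers to fibers (not necessarily linear on the fibers), $\psi_M$ the induced diffeomorphism of $M$, $j\psi:J^\infty E\to J^\infty E$ its prolongation, $j\psi(j^\infty\phi(x))=j^\infty(\psi\circ\phi\circ\psi_M^{-1})(\psi_M(x))$, and $\det\psi_M$ the function on $M$ with $\psi_M^*\nu=(\det\psi_M)\,\nu$. The form $\omega$ is *covariant* with respect to $\psi$ if $\omega((j\psi)^*\theta,(j\psi)^*\theta')=(\det\psi_M)\,(j\psi)^*(\omega(\theta,\theta'))$ for all $\theta,\theta'\in\Omega^{n,1}_0$. **Theorem.** (1) One has $\tilde l_2((j\psi)^*\alpha,(j\psi)^*\beta)=(j\psi)^*(\tilde l_2(\alpha,\beta))$ for all $\alpha,\beta\in\Omega^{n,0}$ if and only if $\omega$ is covariant with respect to $\psi$. (2) Suppose that $\omega$ is covariant with respect to $\psi$. Let $X^\bullet$ be the whole horizontal complex $\Omega^{\bullet,0}$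 or, more generally, any subcomplex $X^k\subseteq\Omega^{k,0}$ of vector spaces with $d_HX^k\subseteq X^{k+1}$ and $(j\psi)^*X^k\subseteq X^k$ (for instance the forms with compactly supported pull-backs along compactly supported sections, when $(j\psi)^*$ preserves them). Assume that the bracket induced by $\tilde l_2$ on $X^n/d_HX^{n-1}$ satisfies the Jacobi identity, i.e. that $$\tilde l_2\tilde l_2(\alpha,\beta,\gamma):=\tilde l_2(\tilde l_2(\alpha,\beta),\gamma)-\tilde l_2(\tilde l_2(\alpha,\gamma),\beta)+\tilde l_2(\tilde l_2(\beta,\gamma),\alpha)\in d_HX^{n-1}\quad\text{for all }\alpha,\beta,\gamma\in X^n.$$ Let $s$ be a family of linear maps $s:X^{k+1}\to X^k$ satisfying $-s\,l_1=1+l_1\,s$ on $X^{n-1}$ (where $s=0$ on $X^0$), and put $l_3(\alpha,\beta,\gamma)=s\big(\tilde l_2\tilde l_2(\alpha,\beta,\gamma)\big)\in X^{n-1}$. Then for all $\alpha,\beta,\gamma\in X^n$ there is $\delta\in X^{n-2}$ (with $X^{-1}=0$) such that $$l_3((j\psi)^*\alpha,(j\psi)^*\beta,(j\psi)^*\gamma)=(j\psi)^*l_3(\alpha,\beta,\gamma)+l_1(\delta).$$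 -/

import Mathlib

open Bundle Set Filter Topology Manifold
open scoped ContDiff

noncomputable section

set_option linter.unusedSectionVars false

namespace JetBundle

section

variable {n : ℕ} {F : Type*} [NormedAddCommGroup F] [NormedSpace ℝ F]
  {M : Type*} [TopologicalSpace M] [ChartedSpace (EuclideanSpace ℝ (Fin n)) M]
  {E : M → Type*} [TopologicalSpace (TotalSpace F E)] [∀ x, TopologicalSpace (E x)]
  [∀ x, AddCommGroup (E x)] [∀ x, Module ℝ (E x)] [FiberBundle F E]

variable (F E) in
/-- The open set over which both the preferred chart of `M` and the preferred trivialization of `E`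
at `x₀` are defined: the domain of an adapted coordinate system `(x^i, u^a)`. -/
def chartDomain (x₀ : M) : Set M :=
  (chartAt (EuclideanSpace ℝ (Fin n)) x₀).source ∩ (trivializationAt F E x₀).baseSet

variable (F) in
/-- The coordinate expression `u ∘ φ ∘ x⁻¹` of a section in the coordinates at `x₀`. -/
def localRep (x₀ : M) (φ : ∀ x, E x) (y : EuclideanSpace ℝ (Fin n)) : F :=
  (trivializationAt F E x₀ ⟨(chartAt (EuclideanSpace ℝ (Fin n)) x₀).symm y,
    φ ((chartAt (EuclideanSpace ℝ (Fin n)) x₀).symm y)⟩).2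

variable (n F E) in
/-- The space `Γ E` of smooth sections. -/
abbrev SmoothSection := ContMDiffSection (𝓡 n) F ∞ E

/-- Two sections have the same infinite jet at `x`: in every adapted coordinate system around `x`
all their derivatives of all orders agree at `x`. -/
def Contact (x : M) (φ φ' : SmoothSection n F E) : Prop :=
  ∀ x₀ : M, x ∈ chartDomain (n := n) F E x₀ → ∀ r : ℕ,
    iteratedFDeriv ℝ r (localRep (n := n) F x₀ φ) (chartAt _ x₀ x) =
      iteratedFDeriv ℝ r (localRep (n := n) F x₀ φ') (chartAt _ x₀ x)

variable (n F E) in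
/-- An automorphism `ψ : E → E` sending fibers to fibers (a diffeomorphism of the total space, not
necessarily linear on the fibers), together with the induced diffeomorphism `ψ_M` of `M`. -/
structure FiberAut where
  toDiffeo : Diffeomorph ((𝓡 n).prod 𝓘(ℝ, F)) ((𝓡 n).prod 𝓘(ℝ, F))
    (TotalSpace F E) (TotalSpace F E) ∞
  base : Diffeomorph (𝓡 n) (𝓡 n) M M ∞
  proj_apply : ∀ p, (toDiffeo p).proj = base p.proj

theorem mk_cast {B : Type*} {G : Type*} {V : B → Type*} (x : B) (p : TotalSpace G V)
    (h : p.proj = x) : (⟨x, h ▸ p.2⟩ : TotalSpace G V) = p := by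
  subst h; rfl

/-- The induced action on sections, `φ ↦ ψ ∘ φ ∘ ψ_M⁻¹`. -/
def FiberAut.pushSection (ψ : FiberAut n F E) (φ : SmoothSection n F E) : SmoothSection n F E where
  toFun y :=
    have h : (ψ.toDiffeo ⟨ψ.base.symm y, φ (ψ.base.symm y)⟩).proj = y := by
      rw [ψ.proj_apply]; simp
    h ▸ (ψ.toDiffeo ⟨ψ.base.symm y, φ (ψ.base.symm y)⟩).2
  contMDiff_toFun := by
    have h : ContMDiff (𝓡 n) ((𝓡 n).prod 𝓘(ℝ, F)) ∞
        (fun y : M => ψ.toDiffeo ⟨ψ.base.symm y, φ (ψ.base.symm y)⟩) :=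
      ψ.toDiffeo.contMDiff.comp (φ.contMDiff.comp ψ.base.symm.contMDiff)
    exact h.congr fun y => mk_cast _ _ _

theorem FiberAut.mk_pushSection (ψ : FiberAut n F E) (φ : SmoothSection n F E) (y : M) :
    (⟨y, ψ.pushSection φ y⟩ : TotalSpace F E) =
      ψ.toDiffeo ⟨ψ.base.symm y, φ (ψ.base.symm y)⟩ :=
  mk_cast _ _ _

theorem contDiffAt_localRep [IsManifold (𝓡 n) ∞ M] [VectorBundle ℝ F E]
    [ContMDiffVectorBundle ∞ F E (𝓡 n)] (φ : SmoothSection n F E) (x₀ x : M)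
    (hx : x ∈ chartDomain (n := n) F E x₀) :
    ContDiffAt ℝ ∞ (localRep (n := n) F x₀ φ) (chartAt (EuclideanSpace ℝ (Fin n)) x₀ x) := by
  rw [← contMDiffAt_iff_contDiffAt]
  have h1 : ContMDiffAt (𝓡 n) (𝓡 n) ∞ (chartAt (EuclideanSpace ℝ (Fin n)) x₀).symm
      (chartAt (EuclideanSpace ℝ (Fin n)) x₀ x) :=
    (contMDiffOn_chart_symm (I := 𝓡 n) (n := ∞) (x := x₀)).contMDiffAt
      ((chartAt _ x₀).open_target.mem_nhds ((chartAt _ x₀).map_source hx.1))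
  have h2 := (Bundle.Trivialization.contMDiffAt_section_iff (IB := 𝓡 n) (n := ∞)
    (s := fun x => φ x) (x₀ := x) (trivializationAt F E x₀) hx.2).1 (φ.contMDiff x)
  have h3 : (chartAt (EuclideanSpace ℝ (Fin n)) x₀).symm (chartAt _ x₀ x) = x :=
    (chartAt _ x₀).left_inv hx.1
  exact ContMDiffAt.comp_of_eq (g := fun y => (trivializationAt F E x₀ ⟨y, φ y⟩).2) h2 h1 h3

theorem Contact.push [IsManifold (𝓡 n) ∞ M] [VectorBundle ℝ F E]
    [ContMDiffVectorBundle ∞ F E (𝓡 n)] (ψ : FiberAut n F E) {x : M} {φ φ' : SmoothSection n F E}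
    (h : Contact x φ φ') : Contact (ψ.base x) (ψ.pushSection φ) (ψ.pushSection φ') := by
  intro x₀ hx₀ r
  have hx : x ∈ chartDomain (n := n) F E x :=
    ⟨mem_chart_source _ x, FiberBundle.mem_baseSet_trivializationAt' x⟩
  set c₀ := chartAt (EuclideanSpace ℝ (Fin n)) x₀ with hc₀
  set c := chartAt (EuclideanSpace ℝ (Fin n)) x with hc
  set e₀ := trivializationAt F E x₀ with he₀
  set e := trivializationAt F E x with he
  set y₀ := c₀ (ψ.base x) with hy₀
  have hy₀t : y₀ ∈ c₀.target := c₀.map_source hx₀.1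
  have hsy : c₀.symm y₀ = ψ.base x := c₀.left_inv hx₀.1
  let g : EuclideanSpace ℝ (Fin n) → EuclideanSpace ℝ (Fin n) :=
    fun y => c (ψ.base.symm (c₀.symm y))
  let H : EuclideanSpace ℝ (Fin n) × F → F :=
    fun p => (e₀ (ψ.toDiffeo (e.toOpenPartialHomeomorph.symm (c.symm p.1, p.2)))).2
  have hg₀ : g y₀ = c x := by simp [g, hsy]
  have hc₀s : ContMDiffAt (𝓡 n) (𝓡 n) ∞ c₀.symm y₀ :=
    (contMDiffOn_chart_symm (I := 𝓡 n) (n := ∞) (x := x₀)).contMDiffAt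
      (c₀.open_target.mem_nhds hy₀t)
  have hcs : ContMDiffAt (𝓡 n) (𝓡 n) ∞ c.symm (c x) :=
    (contMDiffOn_chart_symm (I := 𝓡 n) (n := ∞) (x := x)).contMDiffAt
      (c.open_target.mem_nhds (c.map_source hx.1))
  have hcc : ContMDiffAt (𝓡 n) (𝓡 n) ∞ c x :=
    (contMDiffOn_chart (I := 𝓡 n) (n := ∞) (x := x)).contMDiffAt
      (c.open_source.mem_nhds hx.1)
  have hpre : ψ.base.symm (c₀.symm y₀) = x := by rw [hsy]; simp
  have hbs : ContMDiffAt (𝓡 n) (𝓡 n) ∞ (fun y => ψ.base.symm (c₀.symm y)) y₀ :=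
    (ψ.base.symm.contMDiff _).comp y₀ hc₀s
  have hg : ContDiffAt ℝ ∞ g y₀ := by
    rw [← contMDiffAt_iff_contDiffAt]
    exact ContMDiffAt.comp_of_eq hcc hbs hpre
  have hcsx : c.symm (c x) = x := c.left_inv hx.1
  have hH : ∀ u : F, u = (e ⟨x, φ x⟩).2 → ContDiffAt ℝ ∞ H (c x, u) := by
    intro u _
    rw [← contMDiffAt_iff_contDiffAt]
    have ht : ((c.symm (c x), u) : M × F) ∈ e.target := by
      rw [e.mem_target, hcsx]; exact hx.2
    have k1 : ContMDiffAt 𝓘(ℝ, EuclideanSpace ℝ (Fin n) × F) ((𝓡 n).prod 𝓘(ℝ, F)) ∞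
        (fun p : EuclideanSpace ℝ (Fin n) × F => ((c.symm p.1, p.2) : M × F)) (c x, u) :=
      (ContMDiffAt.comp (g := c.symm) (c x, u) hcs contDiffAt_fst.contMDiffAt).prodMk
        contDiffAt_snd.contMDiffAt
    have k2 : ContMDiffAt ((𝓡 n).prod 𝓘(ℝ, F)) ((𝓡 n).prod 𝓘(ℝ, F)) ∞
        e.toOpenPartialHomeomorph.symm ((c.symm (c x), u) : M × F) :=
      (Bundle.Trivialization.contMDiffOn_symm (IB := 𝓡 n) (n := ∞) e).contMDiffAt
        (e.open_target.mem_nhds ht)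
    have k3 := (ψ.toDiffeo.contMDiff _).comp _ (ContMDiffAt.comp (c x, u) k2 k1)
    have hs : ψ.toDiffeo (e.toOpenPartialHomeomorph.symm ((c.symm (c x), u) : M × F))
        ∈ e₀.source := by
      rw [e₀.mem_source, ψ.proj_apply, e.proj_symm_apply ht, hcsx]; exact hx₀.2
    have k4 : ContMDiffAt ((𝓡 n).prod 𝓘(ℝ, F)) ((𝓡 n).prod 𝓘(ℝ, F)) ∞ e₀
        (ψ.toDiffeo (e.toOpenPartialHomeomorph.symm ((c.symm (c x), u) : M × F))) :=
      (Bundle.Trivialization.contMDiffOn (IB := 𝓡 n) (n := ∞) e₀).contMDiffAt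
        (e₀.open_source.mem_nhds hs)
    exact contMDiffAt_snd.comp _ (ContMDiffAt.comp (c x, u) k4 k3)
  have hrep : ∀ φ : SmoothSection n F E, localRep (n := n) F x₀ (ψ.pushSection φ) =ᶠ[𝓝 y₀]
      H ∘ ((fun w => (w, localRep (n := n) F x φ w)) ∘ g) := by
    intro φ
    have hmem : ∀ᶠ y in 𝓝 y₀, ψ.base.symm (c₀.symm y) ∈ c.source ∩ e.baseSet := by
      apply hbs.continuousAt.eventually_mem
      rw [hpre]
      exact (c.open_source.inter e.open_baseSet).mem_nhds hx
    filter_upwards [hmem] with y hy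
    have a1 : c.symm (g y) = ψ.base.symm (c₀.symm y) := c.left_inv hy.1
    simp only [localRep, Function.comp, H, ψ.mk_pushSection]
    rw [← hc₀, ← he₀, ← hc, ← he, a1]
    congr 3
    symm
    exact e.symm_apply_mk_proj (x := (⟨_, φ (ψ.base.symm (c₀.symm y))⟩ : TotalSpace F E)) (by
      rw [e.mem_source]; exact hy.2)
  have hval : ∀ φ : SmoothSection n F E, localRep (n := n) F x φ (c x) = (e ⟨x, φ x⟩).2 := by
    intro φ
    simp only [localRep]
    rw [← hc, hcsx]
  have h0 : localRep (n := n) F x φ (c x) = localRep (n := n) F x φ' (c x) := by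
    have := h x hx 0
    have := congrArg (fun m => m (fun i => i.elim0)) this
    simpa using this
  have hG : ∀ φ : SmoothSection n F E, ContDiffAt ℝ ∞
      (fun w => (w, localRep (n := n) F x φ w)) (g y₀) := by
    intro φ
    rw [hg₀]
    exact contDiffAt_id.prodMk (contDiffAt_localRep φ x x hx)
  have hT : ftaylorSeries ℝ (fun w => (w, localRep (n := n) F x φ w)) (g y₀) =
      ftaylorSeries ℝ (fun w => (w, localRep (n := n) F x φ' w)) (g y₀) := by
    funext i
    simp only [ftaylorSeries]
    rw [hg₀, iteratedFDeriv_prodMk (n := i) (f := fun w => w) contDiffAt_id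
        ((contDiffAt_localRep φ x x hx).of_le (by exact_mod_cast le_top)) le_rfl,
      iteratedFDeriv_prodMk (n := i) (f := fun w => w) contDiffAt_id
        ((contDiffAt_localRep φ' x x hx).of_le (by exact_mod_cast le_top)) le_rfl,
      h x hx i]
  have hT2 : ftaylorSeries ℝ ((fun w => (w, localRep (n := n) F x φ w)) ∘ g) y₀ =
      ftaylorSeries ℝ ((fun w => (w, localRep (n := n) F x φ' w)) ∘ g) y₀ := by
    funext i
    simp only [ftaylorSeries]
    rw [iteratedFDeriv_comp (hG φ) hg (by exact_mod_cast le_top),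
      iteratedFDeriv_comp (hG φ') hg (by exact_mod_cast le_top), hT]
  have e1 : ((fun w => (w, localRep (n := n) F x φ w)) ∘ g) y₀ = (c x, (e ⟨x, φ x⟩).2) := by
    simp only [Function.comp]; rw [hg₀, hval]
  have e2 : ((fun w => (w, localRep (n := n) F x φ' w)) ∘ g) y₀ = (c x, (e ⟨x, φ x⟩).2) := by
    simp only [Function.comp]; rw [hg₀, ← h0, hval]
  rw [((hrep φ).iteratedFDeriv ℝ r).eq_of_nhds, ((hrep φ').iteratedFDeriv ℝ r).eq_of_nhds]
  rw [iteratedFDeriv_comp (by rw [e1]; exact hH _ rfl) ((hG φ).comp y₀ hg)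
      (by exact_mod_cast le_top),
    iteratedFDeriv_comp (by rw [e2]; exact hH _ rfl) ((hG φ').comp y₀ hg)
      (by exact_mod_cast le_top), hT2, e1, e2]

variable (n F E) in
/-- The fiber of `J^∞ E` over `x`: infinite jets at `x` of smooth sections. -/
def JetFiber (x : M) : Type _ :=
  Quotient (⟨Contact (n := n) (F := F) (E := E) x, fun _ _ _ _ => rfl,
    fun h x₀ hx r => (h x₀ hx r).symm, fun h h' x₀ hx r => (h x₀ hx r).trans (h' x₀ hx r)⟩ :
    Setoid (SmoothSection n F E))

variable (n F E) in
/-- The infinite jet bundle `J^∞ E`; the projection to `M` is `j ↦ j.1`. -/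
def JetSpace : Type _ := Σ x : M, JetFiber n F E x

/-- The jet `j^∞ φ (x)`. -/
def jet (φ : SmoothSection n F E) (x : M) : JetSpace n F E := ⟨x, Quotient.mk _ φ⟩

/-- The prolongation `jψ : J^∞ E → J^∞ E`, `jψ (j^∞ φ (x)) = j^∞ (ψ ∘ φ ∘ ψ_M⁻¹) (ψ_M x)`. -/
def FiberAut.prolong [IsManifold (𝓡 n) ∞ M] [VectorBundle ℝ F E]
    [ContMDiffVectorBundle ∞ F E (𝓡 n)] (ψ : FiberAut n F E) (j : JetSpace n F E) :
    JetSpace n F E :=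
  ⟨ψ.base j.1, Quotient.map ψ.pushSection (fun _ _ h => Contact.push ψ h) j.2⟩

end

section Coordinates

/-! Calculus in the coordinates `(x^i, u_J)` of the infinite jet bundle, `J` a symmetric multi-index
(a multiset of indices) and `u_J` with values in the model fiber `F`, so that the components
`u_J^a` are the components of `u_J`. -/

variable {n : ℕ} {F W : Type*} [NormedAddCommGroup F] [NormedSpace ℝ F]
  [NormedAddCommGroup W] [NormedSpace ℝ W]

variable (n F) in
/-- Coordinate space of the infinite jet bundle. -/
abbrev JetCoord : Type _ := EuclideanSpace ℝ (Fin n) × (Multiset (Fin n) → F)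

/-- The `i`-th coordinate vector of `ℝⁿ`. -/
def coordVec (i : Fin n) : EuclideanSpace ℝ (Fin n) := EuclideanSpace.single i 1

/-- The iterated partial derivative `∂_J f`. -/
def partialD (J : Multiset (Fin n)) (f : EuclideanSpace ℝ (Fin n) → F)
    (y : EuclideanSpace ℝ (Fin n)) : F :=
  iteratedFDeriv ℝ J.toList.length f y (fun i => coordVec (J.toList.get i))

variable (n) in
/-- The finite set of multi-indices of order at most `r`. -/
def multiIndices (r : ℕ) : Finset (Multiset (Fin n)) :=
  (Finset.range (r + 1)).biUnion fun k =>
    (Finset.univ : Finset (Sym (Fin n) k)).image Sym.toMultiset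

theorem mem_multiIndices {r : ℕ} {J : Multiset (Fin n)} :
    J ∈ multiIndices n r ↔ J.card ≤ r := by
  simp only [multiIndices, Finset.mem_biUnion, Finset.mem_range, Finset.mem_image, Finset.mem_univ,
    true_and]
  constructor
  · rintro ⟨k, hk, s, rfl⟩
    have : (Sym.toMultiset s).card = k := s.2
    omega
  · intro h
    exact ⟨J.card, by omega, ⟨J, rfl⟩, rfl⟩

/-- `∂A/∂x^i`. -/
def partialX (i : Fin n) (A : JetCoord n F → W) (p : JetCoord n F) : W :=
  fderiv ℝ (fun y => A (y, p.2)) p.1 (coordVec i)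

/-- `∂A/∂u_J`, the linear map `v ↦ v^a ∂A/∂u^a_J`. -/
def partialU (J : Multiset (Fin n)) (A : JetCoord n F → W) (p : JetCoord n F) : F →L[ℝ] W :=
  fderiv ℝ (fun v => A (p.1, Function.update p.2 J v)) (p.2 J)

/-- The total derivative `D_i = ∂/∂x^i + u^a_{iJ} ∂/∂u^a_J`. -/
def totalD (i : Fin n) (A : JetCoord n F → W) (p : JetCoord n F) : W :=
  partialX i A p + ∑ᶠ J : Multiset (Fin n), partialU J A p (p.2 (i ::ₘ J))

/-- `(-D)_J`. -/
def negTotalD (J : Multiset (Fin n)) (A : JetCoord n F → W) : JetCoord n F → W :=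
  J.toList.foldr (fun i B p => -totalD i B p) A

/-- The Euler operator: `v ↦ v^a E_a(A)` with `E_a(A) = (-D)_J (∂A/∂u^a_J)`. -/
def eulerOp (A : JetCoord n F → W) (p : JetCoord n F) : F →L[ℝ] W :=
  ∑ᶠ J : Multiset (Fin n), negTotalD J (partialU J A) p

/-- `dx^i ∧ D_i A` for a horizontal form `A = A_I dx^I`. -/
def coordDH {k : ℕ} (A : JetCoord n F → (EuclideanSpace ℝ (Fin n) [⋀^Fin k]→L[ℝ] ℝ))
    (p : JetCoord n F) : EuclideanSpace ℝ (Fin n) [⋀^Fin (k + 1)]→L[ℝ] ℝ :=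
  ContinuousAlternatingMap.alternatizeUncurryFin
    (∑ i : Fin n, (EuclideanSpace.proj i : EuclideanSpace ℝ (Fin n) →L[ℝ] ℝ).smulRight
      (totalD i A p))

end Coordinates

section Forms

variable {n : ℕ} {F : Type*} [NormedAddCommGroup F] [NormedSpace ℝ F]
  {M : Type*} [TopologicalSpace M] [ChartedSpace (EuclideanSpace ℝ (Fin n)) M]
  {E : M → Type*} [TopologicalSpace (TotalSpace F E)] [∀ x, TopologicalSpace (E x)]
  [∀ x, AddCommGroup (E x)] [∀ x, Module ℝ (E x)] [FiberBundle F E]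
  {W : Type*} [NormedAddCommGroup W] [NormedSpace ℝ W]

open Classical in
/-- The coordinates `(x^i, u_J)` of a jet in the adapted coordinate system at `x₀`
(`u_J = 0` by convention for a jet outside the coordinate domain). -/
def jetCoord (x₀ : M) (j : JetSpace n F E) : JetCoord n F :=
  (chartAt (EuclideanSpace ℝ (Fin n)) x₀ j.1, fun J =>
    if h : j.1 ∈ chartDomain (n := n) F E x₀ then
      Quotient.lift (fun φ : SmoothSection n F E =>
        partialD J (localRep (n := n) F x₀ φ) (chartAt _ x₀ j.1))
        (fun φ φ' hφ => by simp only [partialD]; rw [hφ x₀ h]) j.2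
    else 0)

variable (F E) in
/-- The image of the coordinate domain in `ℝⁿ`. -/
def coordDomain (x₀ : M) : Set (EuclideanSpace ℝ (Fin n)) :=
  chartAt (EuclideanSpace ℝ (Fin n)) x₀ '' chartDomain (n := n) F E x₀

/-- `A` is a coordinate expression, at `x₀`, of the function `Q` on `J^∞ E`, and `A` is a smooth
function of the `x^i` and of the `u_J` with `|J| ≤ r`. -/
def IsCoordExpr (x₀ : M) (r : ℕ) (Q : JetSpace n F E → W) (A : JetCoord n F → W) : Prop :=
  (∃ f : EuclideanSpace ℝ (Fin n) × (multiIndices n r → F) → W,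
    ContDiffOn ℝ ∞ f (coordDomain (n := n) F E x₀ ×ˢ univ) ∧
    ∀ p : JetCoord n F, A p = f (p.1, fun J => p.2 J)) ∧
  ∀ j : JetSpace n F E, j.1 ∈ chartDomain (n := n) F E x₀ → Q j = A (jetCoord x₀ j)

open Classical in
/-- A coordinate expression at `x₀` of `Q`, if there is one (on the coordinate domain it is then
unique); `0` otherwise. -/
def coordExpr (x₀ : M) (Q : JetSpace n F E → W) : JetCoord n F → W :=
  if h : ∃ A, ∃ r, IsCoordExpr x₀ r Q A then h.choose else 0

variable (n F E) in
/-- The algebra `Loc_E` of local functions: pull-backs of smooth functions on some finite jet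
bundle `J^r E`. -/
def IsLocalFun (P : JetSpace n F E → ℝ) : Prop :=
  ∃ r, ∀ x₀ : M, ∃ A, IsCoordExpr x₀ r P A

theorem IsCoordExpr.mono {x₀ : M} {r r' : ℕ} (h : r ≤ r') {Q : JetSpace n F E → W}
    {A : JetCoord n F → W} (hA : IsCoordExpr x₀ r Q A) : IsCoordExpr x₀ r' Q A := by
  obtain ⟨⟨f, hf, hAf⟩, hQ⟩ := hA
  refine ⟨⟨fun p => f (p.1, fun J => p.2 ⟨J.1,
    mem_multiIndices.2 ((mem_multiIndices.1 J.2).trans h)⟩), ?_, fun p => hAf p⟩, hQ⟩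
  refine hf.comp (t := coordDomain (n := n) F E x₀ ×ˢ univ) ?_ fun p hp => ⟨hp.1, mem_univ _⟩
  exact (contDiff_fst.prodMk
    (contDiff_pi.2 fun J => (contDiff_apply ℝ F _).comp contDiff_snd)).contDiffOn

theorem IsCoordExpr.add {x₀ : M} {r : ℕ} {Q Q' : JetSpace n F E → W} {A A' : JetCoord n F → W}
    (hA : IsCoordExpr x₀ r Q A) (hA' : IsCoordExpr x₀ r Q' A') :
    IsCoordExpr x₀ r (Q + Q') (A + A') := by
  obtain ⟨⟨f, hf, hAf⟩, hQ⟩ := hA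
  obtain ⟨⟨f', hf', hAf'⟩, hQ'⟩ := hA'
  exact ⟨⟨f + f', hf.add hf', fun p => by simp [hAf, hAf']⟩,
    fun j hj => by simp [hQ j hj, hQ' j hj]⟩

theorem IsCoordExpr.smul {x₀ : M} {r : ℕ} (c : ℝ) {Q : JetSpace n F E → W} {A : JetCoord n F → W}
    (hA : IsCoordExpr x₀ r Q A) : IsCoordExpr x₀ r (c • Q) (c • A) := by
  obtain ⟨⟨f, hf, hAf⟩, hQ⟩ := hA
  exact ⟨⟨c • f, hf.const_smul c, fun p => by simp [hAf]⟩, fun j hj => by simp [hQ j hj]⟩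

theorem isCoordExpr_zero (x₀ : M) (r : ℕ) :
    IsCoordExpr x₀ r (0 : JetSpace n F E → W) (0 : JetCoord n F → W) :=
  ⟨⟨0, contDiffOn_const, fun _ => rfl⟩, fun _ _ => rfl⟩

variable (n F E) in
/-- Horizontal `k`-forms `α = α_I dx^I` on `J^∞ E` with arbitrary coefficients: at each jet over
`x`, an alternating `k`-form on `T_x M`. -/
abbrev HForm (k : ℕ) : Type _ :=
  ∀ j : JetSpace n F E, TangentSpace (𝓡 n) j.1 [⋀^Fin k]→L[ℝ] ℝ

variable (n F E) in
/-- The space in which contact forms `σ_a θ^a ∧ d^n x` of order zero live, with arbitrary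
coefficients: at each jet over `x`, a linear map `v ↦ σ_a v^a d^n x` from `E_x` to the alternating
`n`-forms on `T_x M`. Thus `θ^a` is identified with the vertical covector `du^a`. -/
abbrev SForm : Type _ :=
  ∀ j : JetSpace n F E, E j.1 →ₗ[ℝ] (TangentSpace (𝓡 n) j.1 [⋀^Fin n]→L[ℝ] ℝ)

variable [IsManifold (𝓡 n) ∞ M]

/-- The expression, in the chart at `x₀`, of an alternating form at `x`. -/
def formInChart {k : ℕ} (x₀ x : M) (β : TangentSpace (𝓡 n) x [⋀^Fin k]→L[ℝ] ℝ) :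
    EuclideanSpace ℝ (Fin n) [⋀^Fin k]→L[ℝ] ℝ :=
  β.compContinuousLinearMap (tangentCoordChange (𝓡 n) x₀ x x)

/-- The coefficients, in the chart at `x₀`, of a horizontal form. -/
def HForm.inChart {k : ℕ} (α : HForm n F E k) (x₀ : M) (j : JetSpace n F E) :
    EuclideanSpace ℝ (Fin n) [⋀^Fin k]→L[ℝ] ℝ :=
  formInChart x₀ j.1 (α j)

variable (n F E) in
/-- The space `Ω^{k,0}(J^∞ E)` of horizontal `k`-forms whose coefficients are local functions. -/
def horizontalForms (k : ℕ) : Submodule ℝ (HForm n F E k) where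
  carrier := {α | ∃ r, ∀ x₀ : M, ∃ A, IsCoordExpr x₀ r (HForm.inChart α x₀) A}
  zero_mem' := ⟨0, fun x₀ => ⟨0, isCoordExpr_zero x₀ 0⟩⟩
  add_mem' := by
    rintro α β ⟨r, h⟩ ⟨r', h'⟩
    refine ⟨max r r', fun x₀ => ?_⟩
    obtain ⟨A, hA⟩ := h x₀
    obtain ⟨A', hA'⟩ := h' x₀
    exact ⟨A + A', (hA.mono (le_max_left _ _)).add (hA'.mono (le_max_right _ _))⟩
  smul_mem' := by
    rintro c α ⟨r, h⟩
    refine ⟨r, fun x₀ => ?_⟩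
    obtain ⟨A, hA⟩ := h x₀
    exact ⟨c • A, hA.smul c⟩

/-- The horizontal differential: `d_H α = D_i α_I dx^i ∧ dx^I`, computed at a jet over `x` in the
coordinates at `x`. -/
def dH {k : ℕ} (α : HForm n F E k) : HForm n F E (k + 1) := fun j =>
  coordDH (coordExpr j.1 (HForm.inChart α j.1)) (jetCoord j.1 j)

section VectorBundle

variable [VectorBundle ℝ F E]

variable (n F E) in
/-- The space `Ω^{n,1}_0(J^∞ E)`: locally `σ_a θ^a ∧ d^n x` with local functions `σ_a`. -/
def IsSourceForm (θ : SForm n F E) : Prop :=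
  ∃ r, ∀ x₀ : M, ∀ v : F, ∃ A, IsCoordExpr x₀ r
    (fun j => formInChart x₀ j.1 (θ j ((trivializationAt F E x₀).symmₗ ℝ j.1 v))) A

/-- The Euler-Lagrange operator `E : Ω^{n,0} → Ω^{n,1}_0`, `E(L d^n x) = E_a(L) θ^a ∧ d^n x` with
`E_a(L) = (-D)_J (∂L/∂u^a_J)`, computed at a jet over `x` in the coordinates at `x`. -/
def eulerLagrange (α : HForm n F E n) : SForm n F E := fun j =>
  (eulerOp (coordExpr j.1 (HForm.inChart α j.1)) (jetCoord j.1 j)).toLinearMap ∘ₗ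
    (trivializationAt F E j.1).linearMapAt ℝ j.1

variable (n F E) in
/-- A map `ω : Ω^{n,1}_0 × Ω^{n,1}_0 → Loc_E`, skew-symmetric and `Loc_E`-linear in each variable,
i.e. a skew tensor with components `ω^{ab} ∈ Loc_E`. -/
structure BracketTensor where
  toFun : ∀ j : JetSpace n F E,
    (E j.1 →ₗ[ℝ] (TangentSpace (𝓡 n) j.1 [⋀^Fin n]→L[ℝ] ℝ)) →ₗ[ℝ]
      (E j.1 →ₗ[ℝ] (TangentSpace (𝓡 n) j.1 [⋀^Fin n]→L[ℝ] ℝ)) →ₗ[ℝ] ℝ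
  skew : ∀ j σ τ, toFun j σ τ = -toFun j τ σ
  isLocalFun : ∀ θ θ' : SForm n F E, IsSourceForm n F E θ → IsSourceForm n F E θ' →
    IsLocalFun n F E fun j => toFun j (θ j) (θ' j)

variable (n M) in
/-- A volume form on `M`: a smooth nowhere vanishing `n`-form. -/
structure VolumeForm where
  toFun : ∀ x : M, TangentSpace (𝓡 n) x [⋀^Fin n]→L[ℝ] ℝ
  ne_zero : ∀ x, toFun x ≠ 0
  smooth : ∀ x₀ : M, ContDiffOn ℝ ∞
    (fun y => formInChart x₀ ((chartAt (EuclideanSpace ℝ (Fin n)) x₀).symm y)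
      (toFun ((chartAt (EuclideanSpace ℝ (Fin n)) x₀).symm y)))
    (chartAt (EuclideanSpace ℝ (Fin n)) x₀).target

/-- The bracket `l̃₂(α, β) = ω(E(α), E(β)) ν` on top horizontal forms. -/
def bracket (om : BracketTensor n F E) (ν : VolumeForm n M) (α β : HForm n F E n) :
    HForm n F E n := fun j =>
  om.toFun j (eulerLagrange α j) (eulerLagrange β j) • ν.toFun j.1

/-- The sum `l̃₂ l̃₂` of `l̃₂(l̃₂(·,·),·)` over the three (2,1)-unshuffles, with signs. -/
def jacobiator (om : BracketTensor n F E) (ν : VolumeForm n M) (α β γ : HForm n F E n) :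
    HForm n F E n :=
  bracket om ν (bracket om ν α β) γ - bracket om ν (bracket om ν α γ) β +
    bracket om ν (bracket om ν β γ) α

variable [ContMDiffVectorBundle ∞ F E (𝓡 n)]

/-- The pull-back `(jψ)^* α` of a horizontal form. -/
def pullback {k : ℕ} (ψ : FiberAut n F E) (α : HForm n F E k) : HForm n F E k := fun j =>
  (α (ψ.prolong j)).compContinuousLinearMap (mfderiv (𝓡 n) (𝓡 n) ψ.base j.1)

/-- The vertical derivative of `ψ` at the point of `E` underlying the jet `j`, a linear map
`E_x → E_{ψ_M x}` with matrix `∂ψ_E^a/∂u^b`. -/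
def verticalDeriv (ψ : FiberAut n F E) (j : JetSpace n F E) : E j.1 →ₗ[ℝ] E (ψ.base j.1) :=
  (trivializationAt F E (ψ.base j.1)).symmₗ ℝ (ψ.base j.1) ∘ₗ
    (fderiv ℝ (fun w : F => (trivializationAt F E (ψ.base j.1)
      (ψ.toDiffeo ((trivializationAt F E j.1).toOpenPartialHomeomorph.symm (j.1, w)))).2)
      ((jetCoord j.1 j).2 0)).toLinearMap ∘ₗ
    (trivializationAt F E j.1).linearMapAt ℝ j.1

/-- The pull-back of a contact form of order zero:
`(jψ)^*(σ_a θ^a ∧ d^n x) = (σ_a ∘ jψ) (∂ψ_E^a/∂u^b) θ^b ∧ ψ_M^*(d^n x)`. -/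
def pullbackSource (ψ : FiberAut n F E) (θ : SForm n F E) : SForm n F E := fun j =>
  { toFun := fun v => (θ (ψ.prolong j) (verticalDeriv ψ j v)).compContinuousLinearMap
      (mfderiv (𝓡 n) (𝓡 n) ψ.base j.1)
    map_add' := fun v w => by
      rw [map_add]
      exact map_add (θ (ψ.prolong j)) (verticalDeriv ψ j v) (verticalDeriv ψ j w) ▸ rfl
    map_smul' := fun c v => by
      rw [map_smul]
      exact map_smul (θ (ψ.prolong j)) c (verticalDeriv ψ j v) ▸ rfl }

/-- The function `det ψ_M` on `M` with `ψ_M^* ν = (det ψ_M) ν`. -/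
def detBase (ν : VolumeForm n M) (ψ : FiberAut n F E) (x : M) : ℝ :=
  ν.toFun (ψ.base x) (fun i => mfderiv (𝓡 n) (𝓡 n) ψ.base x (coordVec i)) /
    ν.toFun x (fun i => coordVec i)

/-- `ω` is covariant with respect to `ψ`:
`ω((jψ)^* θ, (jψ)^* θ') = (det ψ_M) (jψ)^*(ω(θ, θ'))` for all `θ, θ' ∈ Ω^{n,1}_0`. -/
def IsCovariant (om : BracketTensor n F E) (ν : VolumeForm n M) (ψ : FiberAut n F E) : Prop :=
  ∀ θ θ' : SForm n F E, IsSourceForm n F E θ → IsSourceForm n F E θ' →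
    ∀ j : JetSpace n F E,
      om.toFun j (pullbackSource ψ θ j) (pullbackSource ψ θ' j) =
        detBase ν ψ j.1 * om.toFun (ψ.prolong j) (θ (ψ.prolong j)) (θ' (ψ.prolong j))

/-- A subcomplex of the horizontal complex, stable under `(jψ)^*`. -/
structure IsInvariantSubcomplex (ψ : FiberAut n F E)
    (X : ∀ k, Submodule ℝ (HForm n F E k)) : Prop where
  le : ∀ k, X k ≤ horizontalForms n F E k
  dH_mem : ∀ k, ∀ η ∈ X k, dH η ∈ X (k + 1)
  pullback_mem : ∀ k, ∀ η ∈ X k, pullback ψ η ∈ X k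

end VectorBundle

/-- The exact forms of degree `k` of a complex `X` of horizontal forms (`X` is zero in degree
`-1`). -/
def exactForms (X : ∀ k, Submodule ℝ (HForm n F E k)) : ∀ k, Set (HForm n F E k)
  | 0 => {0}
  | k + 1 => dH '' (X k : Set (HForm n F E k))

/-- The identity `-s ∘ l₁ = 1 + l₁ ∘ s`, with `l₁ = d_H`, on the forms of degree `k` of `X`. -/
def HomotopyIdentity (X : ∀ k, Submodule ℝ (HForm n F E k))
    (s : ∀ k, HForm n F E (k + 1) →ₗ[ℝ] HForm n F E k) : ℕ → Prop
  | 0 => ∀ η ∈ X 0, -s 0 (dH η) = η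
  | k + 1 => ∀ η ∈ X (k + 1), -s (k + 1) (dH η) = η + dH (s k η)

end Forms

section TopDegree

variable {n : ℕ} {F : Type*} [NormedAddCommGroup F] [NormedSpace ℝ F]
  {M : Type*} [TopologicalSpace M] [ChartedSpace (EuclideanSpace ℝ (Fin (n + 1))) M]
  {E : M → Type*} [TopologicalSpace (TotalSpace F E)] [∀ x, TopologicalSpace (E x)]
  [∀ x, AddCommGroup (E x)] [∀ x, Module ℝ (E x)] [FiberBundle F E]
  [IsManifold (𝓡 (n + 1)) ∞ M] [VectorBundle ℝ F E]

/-- The bracket induced by `l̃₂` on the space `X^{n+1} / d_H X^n` of local functionals satisfies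
the Jacobi identity. -/
def SatisfiesJacobi (X : ∀ k, Submodule ℝ (HForm (n + 1) F E k)) (om : BracketTensor (n + 1) F E)
    (ν : VolumeForm (n + 1) M) : Prop :=
  ∀ α ∈ X (n + 1), ∀ β ∈ X (n + 1), ∀ γ ∈ X (n + 1),
    jacobiator om ν α β γ ∈ exactForms X (n + 1)

/-- `l₃ = s l̃₂ l̃₂` in degree zero. -/
def l3 (s : ∀ k, HForm (n + 1) F E (k + 1) →ₗ[ℝ] HForm (n + 1) F E k)
    (om : BracketTensor (n + 1) F E) (ν : VolumeForm (n + 1) M)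
    (α β γ : HForm (n + 1) F E (n + 1)) : HForm (n + 1) F E n :=
  s n (jacobiator om ν α β γ)

end TopDegree

end JetBundle

end

open Bundle Set Filter Topology Manifold
open scoped ContDiff

noncomputable section

set_option linter.unusedSectionVars false

namespace JetBundle

/-! ### Iterated directional derivatives and their symmetry. -/

section DirDeriv

/-! Everything rests on naturality: the Euler–Lagrange operator and `d_H` commute with `(jψ)^*`.
Neither fact is proved by transforming coordinate formulas, which would be heavy in high jet order
and for `ψ` nonlinear on fibers; each operator is replaced by a characterization along sections.

In adapted coordinates `ψ` is a map `(y, u) ↦ (h y, H (y, u))`, a `FiberChange`. The total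
derivative satisfies `D_i A (jφ) = ∂_i (A (jφ))` (`JetSmoothOn.fderiv_jetAt`), so along a section
`d_H` is the ordinary exterior derivative and inherits its naturality under `h`
(`IsCoordPullback.coordDH_eq`). The Euler operator is characterized variationally: for compactly
supported `η`, the integral of the first variation of `A` at `φ` in the direction `η` equals the
integral of `E(A)(jφ) η` (`integral_variation_eq`). If `B` is the pull-back of `A`, one
differentiates `B (j(φ + tη)) = det(Dh) A (j(ψ·(φ + tη)))` at `t = 0`, integrates, changes variables
and applies the fundamental lemma of the calculus of variations. This gives `E(B) = det(Dh) E(A) ∘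
∂H/∂u` (`FiberChange.IsPullbackNear.eulerOp_eq`). For `ψ = id` read in two charts, the same
statements say that both operators are independent of coordinates. Coordinate expressions are
compared only at jets of global sections, so their uniqueness is not needed.

For (1), naturality of `E` turns both sides of the equivariance of the bracket into multiples of
`ν`, and covariance equates the factors. Conversely, both sides of the covariance identity at a jet
`j` depend only on the values of `θ, θ'` at `jψ(j)`, and each such value is attained by the
Euler–Lagrange form of a cut-off Lagrangian linear in `u` (`exists_eulerLagrange_eq`).

For (2), the Jacobiator is equivariant and equals `d_H η`. Since `s d_H = -1 - d_H s` in the degree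
of `η`, the operators `s` and `(jψ)^*` commute on `d_H η` up to `d_H((jψ)^* s η - s (jψ)^* η)`
(`HomotopyIdentity.exists_exactForms`). -/

theorem two_le_infty : (2 : ℕ∞ω) ≤ ∞ := by
  exact WithTop.coe_le_coe.2 (le_top : (2 : ℕ∞) ≤ ⊤)

variable {V G : Type*} [NormedAddCommGroup V] [NormedSpace ℝ V]
  [NormedAddCommGroup G] [NormedSpace ℝ G]

/-- The iterated directional derivative along a list of vectors. -/
def dirDeriv (l : List V) (f : V → G) : V → G :=
  l.foldr (fun v g y => fderiv ℝ g y v) f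

@[simp] theorem dirDeriv_nil (f : V → G) : dirDeriv [] f = f := rfl

theorem dirDeriv_cons (v : V) (l : List V) (f : V → G) :
    dirDeriv (v :: l) f = fun y => fderiv ℝ (dirDeriv l f) y v := rfl

theorem contDiffOn_fderiv_apply {U : Set V} (hU : IsOpen U) {f : V → G}
    (hf : ContDiffOn ℝ ∞ f U) (v : V) : ContDiffOn ℝ ∞ (fun y => fderiv ℝ f y v) U :=
  (hf.fderiv_of_isOpen hU (by simp)).clm_apply contDiffOn_const

theorem contDiffOn_dirDeriv {U : Set V} (hU : IsOpen U) {f : V → G}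
    (hf : ContDiffOn ℝ ∞ f U) (l : List V) : ContDiffOn ℝ ∞ (dirDeriv l f) U := by
  induction l with
  | nil => exact hf
  | cons v l ih => exact contDiffOn_fderiv_apply hU ih v

theorem differentiableAt_of_contDiffOn {U : Set V} (hU : IsOpen U) {f : V → G}
    (hf : ContDiffOn ℝ ∞ f U) {y : V} (hy : y ∈ U) : DifferentiableAt ℝ f y :=
  (hf.contDiffAt (hU.mem_nhds hy)).differentiableAt (by simp)

theorem fderiv_fderiv_comm {U : Set V} (hU : IsOpen U) {f : V → G}
    (hf : ContDiffOn ℝ ∞ f U) {y : V} (hy : y ∈ U) (v w : V) :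
    fderiv ℝ (fun z => fderiv ℝ f z w) y v = fderiv ℝ (fun z => fderiv ℝ f z v) y w := by
  have h1 : DifferentiableAt ℝ (fderiv ℝ f) y :=
    differentiableAt_of_contDiffOn hU (hf.fderiv_of_isOpen (m := ∞) hU (by simp)) hy
  have h2 := (hf.contDiffAt (hU.mem_nhds hy)).isSymmSndFDerivAt
    (by rw [minSmoothness_of_isRCLikeNormedField]; exact two_le_infty)
  rw [fderiv_clm_apply h1 (differentiableAt_const _),
    fderiv_clm_apply h1 (differentiableAt_const _)]
  simpa using h2 v w

/-- Symmetry of second derivatives handles adjacent transpositions, and these generate `List.Perm`.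
This makes the arbitrary order chosen by `Multiset.toList` harmless. -/
theorem dirDeriv_perm {U : Set V} (hU : IsOpen U) {f : V → G}
    (hf : ContDiffOn ℝ ∞ f U) {l l' : List V} (h : l.Perm l') :
    EqOn (dirDeriv l f) (dirDeriv l' f) U := by
  induction h with
  | nil => exact fun _ _ => rfl
  | cons v _ ih =>
    intro y hy
    simp only [dirDeriv_cons]
    rw [(ih.eventuallyEq_of_mem (hU.mem_nhds hy)).fderiv_eq]
  | swap v w l =>
    intro y hy
    exact fderiv_fderiv_comm hU (contDiffOn_dirDeriv hU hf l) hy w v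
  | trans _ _ ih ih' => exact ih.trans ih'

/-- The head of the list is the outermost derivative; it is moved innermost so that inductions can
be applied to the function already differentiated once. -/
theorem dirDeriv_cons_right {U : Set V} (hU : IsOpen U) {f : V → G}
    (hf : ContDiffOn ℝ ∞ f U) (v : V) (l : List V) :
    EqOn (dirDeriv (v :: l) f) (dirDeriv l (fun y => fderiv ℝ f y v)) U := by
  have h := dirDeriv_perm hU hf (List.perm_append_singleton v l).symm
  have : dirDeriv (l ++ [v]) f = dirDeriv l (fun y => fderiv ℝ f y v) := by
    simp [dirDeriv, List.foldr_append]
  rwa [this] at h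

theorem iteratedFDeriv_eq_dirDeriv {ι : Type*} {U : Set V} (hU : IsOpen U) {f : V → G}
    (hf : ContDiffOn ℝ ∞ f U) (c : ι → V) (l : List ι) {y : V} (hy : y ∈ U) :
    iteratedFDeriv ℝ l.length f y (fun i => c (l.get i)) = dirDeriv (l.map c) f y := by
  induction l generalizing y with
  | nil => simp
  | cons v l ih =>
    have hd : DifferentiableAt ℝ (iteratedFDeriv ℝ l.length f) y :=
      (hf.contDiffAt (hU.mem_nhds hy)).differentiableAt_iteratedFDeriv
        (by exact_mod_cast WithTop.coe_lt_top _)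
    simp only [List.length_cons, List.map_cons, dirDeriv_cons]
    rw [iteratedFDeriv_succ_apply_left]
    have e : (fun z => iteratedFDeriv ℝ l.length f z (fun i => c (l.get i))) =ᶠ[𝓝 y]
        dirDeriv (l.map c) f := by
      filter_upwards [hU.mem_nhds hy] with z hz using ih hz
    rw [← e.fderiv_eq]
    have := (hd.hasFDerivAt.continuousMultilinear_apply_const (fun i => c (l.get i))).fderiv
    rw [this]
    rfl

end DirDeriv

/-! ### Jets of functions, and functions of finitely many jet coordinates. -/

section JetCalculus

variable {n : ℕ} {F W : Type*} [NormedAddCommGroup F] [NormedSpace ℝ F]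
  [NormedAddCommGroup W] [NormedSpace ℝ W]

/-- The list of coordinate vectors of a multi-index. -/
def coordVecs (J : Multiset (Fin n)) : List (EuclideanSpace ℝ (Fin n)) := J.toList.map coordVec

theorem coordVecs_cons_perm (i : Fin n) (J : Multiset (Fin n)) :
    (coordVecs (i ::ₘ J)).Perm (coordVec i :: coordVecs J) := by
  have : (i ::ₘ J).toList.Perm (i :: J.toList) := by
    rw [← Multiset.coe_eq_coe, ← Multiset.cons_coe, Multiset.coe_toList, Multiset.coe_toList]
  exact this.map coordVec

theorem partialD_eq_dirDeriv {U : Set (EuclideanSpace ℝ (Fin n))} (hU : IsOpen U)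
    {f : EuclideanSpace ℝ (Fin n) → F} (hf : ContDiffOn ℝ ∞ f U) (J : Multiset (Fin n)) :
    EqOn (partialD J f) (dirDeriv (coordVecs J) f) U := fun _ hy =>
  iteratedFDeriv_eq_dirDeriv hU hf coordVec J.toList hy

theorem contDiffOn_partialD {U : Set (EuclideanSpace ℝ (Fin n))} (hU : IsOpen U)
    {f : EuclideanSpace ℝ (Fin n) → F} (hf : ContDiffOn ℝ ∞ f U) (J : Multiset (Fin n)) :
    ContDiffOn ℝ ∞ (partialD J f) U :=
  (contDiffOn_dirDeriv hU hf _).congr (partialD_eq_dirDeriv hU hf J)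

/-- Along a jet, the coordinate `u_J` has `i`-th derivative `u_{iJ}`. This is the source of the
coefficients of `D_i`. -/
theorem fderiv_partialD {U : Set (EuclideanSpace ℝ (Fin n))} (hU : IsOpen U)
    {f : EuclideanSpace ℝ (Fin n) → F} (hf : ContDiffOn ℝ ∞ f U) (i : Fin n)
    (J : Multiset (Fin n)) {y : EuclideanSpace ℝ (Fin n)} (hy : y ∈ U) :
    fderiv ℝ (partialD J f) y (coordVec i) = partialD (i ::ₘ J) f y := by
  rw [((partialD_eq_dirDeriv hU hf J).eventuallyEq_of_mem (hU.mem_nhds hy)).fderiv_eq,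
    partialD_eq_dirDeriv hU hf _ hy, dirDeriv_perm hU hf (coordVecs_cons_perm i J) hy]
  rfl

theorem partialD_congr {U : Set (EuclideanSpace ℝ (Fin n))} (hU : IsOpen U)
    {f g : EuclideanSpace ℝ (Fin n) → F} (h : EqOn f g U) (J : Multiset (Fin n)) :
    EqOn (partialD J f) (partialD J g) U := by
  intro y hy
  simp only [partialD]
  rw [((h.eventuallyEq_of_mem (hU.mem_nhds hy)).iteratedFDeriv ℝ _).eq_of_nhds]

theorem partialD_zero (f : EuclideanSpace ℝ (Fin n) → F) (y : EuclideanSpace ℝ (Fin n)) :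
    partialD 0 f y = f y := by
  -- The arity of the multilinear map depends on the list, so the list is generalized before it is
  -- replaced by `[]`.
  have : ∀ l : List (Fin n), l = [] →
      iteratedFDeriv ℝ l.length f y (fun i => coordVec (l.get i)) = f y := by
    rintro _ rfl; simp
  exact this _ Multiset.toList_zero

/-- The coordinates of the infinite jet at `y` of a function. -/
def jetAt (f : EuclideanSpace ℝ (Fin n) → F) (y : EuclideanSpace ℝ (Fin n)) : JetCoord n F :=
  (y, fun J => partialD J f y)

theorem jetAt_congr {U : Set (EuclideanSpace ℝ (Fin n))} (hU : IsOpen U)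
    {f g : EuclideanSpace ℝ (Fin n) → F} (h : EqOn f g U) : EqOn (jetAt f) (jetAt g) U :=
  fun _ hy => Prod.ext rfl (funext fun J => partialD_congr hU h J hy)

/-- The projection to the coordinates of the jets of order at most `r`. -/
def jetTrunc (r : ℕ) (p : JetCoord n F) :
    EuclideanSpace ℝ (Fin n) × (multiIndices n r → F) := (p.1, fun J => p.2 J)

/-- Over `U`, the function `A` is a smooth function of the `x^i` and the `u_J` with `|J| ≤ r`. -/
def JetSmoothOn (U : Set (EuclideanSpace ℝ (Fin n))) (r : ℕ) (A : JetCoord n F → W) : Prop :=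
  ∃ f : EuclideanSpace ℝ (Fin n) × (multiIndices n r → F) → W,
    ContDiffOn ℝ ∞ f (U ×ˢ univ) ∧ ∀ p : JetCoord n F, p.1 ∈ U → A p = f (jetTrunc r p)

theorem JetSmoothOn.mono_set {U U' : Set (EuclideanSpace ℝ (Fin n))} {r : ℕ}
    {A : JetCoord n F → W} (h : JetSmoothOn U r A) (hU : U' ⊆ U) : JetSmoothOn U' r A := by
  obtain ⟨f, hf, hA⟩ := h
  exact ⟨f, hf.mono (prod_mono hU subset_rfl), fun p hp => hA p (hU hp)⟩

theorem JetSmoothOn.mono {U : Set (EuclideanSpace ℝ (Fin n))} {r r' : ℕ}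
    {A : JetCoord n F → W} (h : JetSmoothOn U r A) (hr : r ≤ r') : JetSmoothOn U r' A := by
  obtain ⟨f, hf, hA⟩ := h
  refine ⟨fun p => f (p.1, fun J => p.2 ⟨J.1,
    mem_multiIndices.2 ((mem_multiIndices.1 J.2).trans hr)⟩), ?_, fun p hp => hA p hp⟩
  refine hf.comp (t := U ×ˢ univ) ?_ fun p hp => ⟨hp.1, mem_univ _⟩
  exact (contDiff_fst.prodMk
    (contDiff_pi.2 fun J => (contDiff_apply ℝ F _).comp contDiff_snd)).contDiffOn

theorem JetSmoothOn.congr {U : Set (EuclideanSpace ℝ (Fin n))} {r : ℕ}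
    {A A' : JetCoord n F → W} (h : JetSmoothOn U r A) (hA : ∀ p, p.1 ∈ U → A' p = A p) :
    JetSmoothOn U r A' := by
  obtain ⟨f, hf, hA'⟩ := h
  exact ⟨f, hf, fun p hp => (hA p hp).trans (hA' p hp)⟩

theorem JetSmoothOn.comp₂ {W₁ W₂ : Type*} [NormedAddCommGroup W₁] [NormedSpace ℝ W₁]
    [NormedAddCommGroup W₂] [NormedSpace ℝ W₂] {U : Set (EuclideanSpace ℝ (Fin n))} {r : ℕ}
    {A₁ : JetCoord n F → W₁} {A₂ : JetCoord n F → W₂} (h₁ : JetSmoothOn U r A₁)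
    (h₂ : JetSmoothOn U r A₂) {g : W₁ × W₂ → W} (hg : ContDiff ℝ ∞ g) :
    JetSmoothOn U r fun p => g (A₁ p, A₂ p) := by
  obtain ⟨f₁, hf₁, hA₁⟩ := h₁
  obtain ⟨f₂, hf₂, hA₂⟩ := h₂
  exact ⟨fun p => g (f₁ p, f₂ p), hg.comp_contDiffOn (hf₁.prodMk hf₂),
    fun p hp => by simp only [hA₁ p hp, hA₂ p hp]⟩

theorem JetSmoothOn.comp {W₁ : Type*} [NormedAddCommGroup W₁] [NormedSpace ℝ W₁]
    {U : Set (EuclideanSpace ℝ (Fin n))} {r : ℕ}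
    {A₁ : JetCoord n F → W₁} (h₁ : JetSmoothOn U r A₁) {g : W₁ → W} (hg : ContDiff ℝ ∞ g) :
    JetSmoothOn U r fun p => g (A₁ p) :=
  h₁.comp₂ h₁ (hg.comp contDiff_fst)

theorem JetSmoothOn.const {U : Set (EuclideanSpace ℝ (Fin n))} (r : ℕ) (c : W) :
    JetSmoothOn U r fun _ : JetCoord n F => c :=
  ⟨fun _ => c, contDiffOn_const, fun _ _ => rfl⟩

theorem JetSmoothOn.of_base {U : Set (EuclideanSpace ℝ (Fin n))} (r : ℕ)
    {g : EuclideanSpace ℝ (Fin n) → W} (hg : ContDiffOn ℝ ∞ g U) :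
    JetSmoothOn U r fun p : JetCoord n F => g p.1 :=
  ⟨fun p => g p.1, hg.comp contDiffOn_fst fun _ hp => hp.1, fun _ _ => rfl⟩

theorem JetSmoothOn.sum {ι : Type*} {U : Set (EuclideanSpace ℝ (Fin n))} {r : ℕ}
    {s : Finset ι} {A : ι → JetCoord n F → W} (h : ∀ i ∈ s, JetSmoothOn U r (A i)) :
    JetSmoothOn U r fun p => ∑ i ∈ s, A i p := by
  classical
  induction s using Finset.induction_on with
  | empty => simpa using JetSmoothOn.const r (0 : W)
  | insert i s hi ih =>
    simp only [Finset.sum_insert hi]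
    exact (h i (by simp)).comp₂ (ih fun j hj => h j (by simp [hj]))
      (g := fun p : W × W => p.1 + p.2) (contDiff_fst.add contDiff_snd)

theorem jetSmoothOn_zero_coord {U : Set (EuclideanSpace ℝ (Fin n))}
    {g : EuclideanSpace ℝ (Fin n) × F → W} (hg : ContDiffOn ℝ ∞ g (U ×ˢ univ)) :
    JetSmoothOn U 0 fun p : JetCoord n F => g (p.1, p.2 0) := by
  refine ⟨fun p => g (p.1, p.2 ⟨0, mem_multiIndices.2 (by simp)⟩), ?_, fun _ _ => rfl⟩
  refine hg.comp (t := U ×ˢ univ) ?_ fun p hp => ⟨hp.1, mem_univ _⟩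
  exact (contDiff_fst.prodMk ((contDiff_apply ℝ F _).comp contDiff_snd)).contDiffOn

/-- The vector along which a function of the truncated jet coordinates is differentiated by the
total derivative `D_i`. -/
def totalDir (r : ℕ) (i : Fin n) (p : JetCoord n F) :
    EuclideanSpace ℝ (Fin n) × (multiIndices n r → F) :=
  (coordVec i, fun J => p.2 (i ::ₘ J))

section Formulas

variable {U : Set (EuclideanSpace ℝ (Fin n))} (hU : IsOpen U) {r : ℕ} {A : JetCoord n F → W}
  {f : EuclideanSpace ℝ (Fin n) × (multiIndices n r → F) → W}
  (hf : ContDiffOn ℝ ∞ f (U ×ˢ univ)) (hA : ∀ p : JetCoord n F, p.1 ∈ U → A p = f (jetTrunc r p))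
include hU hf hA

theorem hasFDerivAt_of_trunc {p : JetCoord n F} (hp : p.1 ∈ U) :
    HasFDerivAt f (fderiv ℝ f (jetTrunc r p)) (jetTrunc r p) :=
  (differentiableAt_of_contDiffOn (hU.prod isOpen_univ) hf ⟨hp, mem_univ _⟩).hasFDerivAt

theorem partialX_eq (i : Fin n) {p : JetCoord n F} (hp : p.1 ∈ U) :
    partialX i A p = fderiv ℝ f (jetTrunc r p) (coordVec i, 0) := by
  have h1 : (fun y => A (y, p.2)) =ᶠ[𝓝 p.1] fun y => f (y, fun J => p.2 J) := by
    filter_upwards [hU.mem_nhds hp] with y hy using hA (y, p.2) hy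
  have h2 : HasFDerivAt (fun y => f (y, fun J : multiIndices n r => p.2 J))
      (fderiv ℝ f (jetTrunc r p) ∘L ((ContinuousLinearMap.id ℝ _).prod 0)) p.1 :=
    (hasFDerivAt_of_trunc hU hf hA hp).comp p.1
      ((hasFDerivAt_id p.1).prodMk (hasFDerivAt_const _ _))
  simp only [partialX]
  rw [h1.fderiv_eq, h2.fderiv]
  simp

open Classical in
theorem partialU_eq {J : Multiset (Fin n)} (hJ : J ∈ multiIndices n r) {p : JetCoord n F}
    (hp : p.1 ∈ U) :
    partialU J A p = fderiv ℝ f (jetTrunc r p) ∘L (ContinuousLinearMap.inr ℝ _ _ ∘L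
      ContinuousLinearMap.single ℝ (fun _ : multiIndices n r => F) ⟨J, hJ⟩) := by
  have h1 : (fun v => A (p.1, Function.update p.2 J v)) =
      fun v => f (p.1, Function.update (fun K : multiIndices n r => p.2 K) ⟨J, hJ⟩ v) := by
    funext v
    refine (hA (p.1, Function.update p.2 J v) hp).trans ?_
    refine congrArg f (Prod.ext rfl (funext fun K => ?_))
    by_cases hK : K = ⟨J, hJ⟩
    · subst hK; simp [jetTrunc]
    · have : (K : Multiset (Fin n)) ≠ J := fun h => hK (Subtype.ext h)
      simp [jetTrunc, Function.update_of_ne, hK, this]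
  have hu : Function.update (fun K : multiIndices n r => p.2 K) ⟨J, hJ⟩ (p.2 J) =
      fun K : multiIndices n r => p.2 K := Function.update_eq_self (⟨J, hJ⟩ : multiIndices n r) _
  have h0 : HasFDerivAt f (fderiv ℝ f (jetTrunc r p))
      (p.1, Function.update (fun K : multiIndices n r => p.2 K) ⟨J, hJ⟩ (p.2 J)) := by
    rw [hu]; exact hasFDerivAt_of_trunc hU hf hA hp
  have h2 := h0.comp (p.2 J) ((hasFDerivAt_const p.1 (p.2 J)).prodMk
    (hasFDerivAt_update (𝕜 := ℝ) (fun K : multiIndices n r => p.2 K)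
      (i := ⟨J, hJ⟩) (p.2 J)))
  simp only [partialU]
  rw [h1]
  refine h2.fderiv.trans ?_
  congr 1
  ext v K
  · simp
  · by_cases hK : K = ⟨J, hJ⟩
    · subst hK; simp
    · simp [hK]

/-- The truncation does not see `u_J` when `|J| > r`. This gives the `finsum`s in `totalD` and
`eulerOp` finite support, without which they would take the default value `0`. -/
theorem partialU_eq_zero {J : Multiset (Fin n)} (hJ : J ∉ multiIndices n r) {p : JetCoord n F}
    (hp : p.1 ∈ U) : partialU J A p = 0 := by
  have h1 : (fun v => A (p.1, Function.update p.2 J v)) = fun _ => A p := by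
    funext v
    refine (hA (p.1, Function.update p.2 J v) hp).trans ((congrArg f ?_).trans (hA p hp).symm)
    refine Prod.ext rfl (funext fun K => ?_)
    have : (K : Multiset (Fin n)) ≠ J := fun h => hJ (h ▸ K.2)
    simp [jetTrunc, this]
  simp only [partialU]
  rw [h1]
  simp

/-- Linearity of the derivative over the coordinate directions. It is used with `v J = u_{iJ}` for
the total derivative and with `v J = ∂_J η` for the first variation. -/
theorem sum_partialU_eq (v : Multiset (Fin n) → F) {p : JetCoord n F} (hp : p.1 ∈ U) :
    ∑ J ∈ multiIndices n r, partialU J A p (v J) =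
      fderiv ℝ f (jetTrunc r p) (0, fun J => v J) := by
  classical
  rw [← Finset.sum_coe_sort]
  have : ((0 : EuclideanSpace ℝ (Fin n)), fun J : multiIndices n r => v J) =
      ∑ J : multiIndices n r, (0, Pi.single J (v J)) := by
    rw [Prod.ext_iff]
    refine ⟨by simp [Prod.fst_sum], ?_⟩
    simp only [Prod.snd_sum]
    exact (Finset.univ_sum_single _).symm
  rw [this, map_sum]
  refine Finset.sum_congr rfl fun J _ => ?_
  rw [partialU_eq hU hf hA J.2 hp]
  simp

theorem totalD_eq (i : Fin n) {p : JetCoord n F} (hp : p.1 ∈ U) :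
    totalD i A p = fderiv ℝ f (jetTrunc r p) (totalDir r i p) := by
  have hs : (∑ᶠ J : Multiset (Fin n), partialU J A p (p.2 (i ::ₘ J))) =
      ∑ J ∈ multiIndices n r, partialU J A p (p.2 (i ::ₘ J)) := by
    refine finsum_eq_sum_of_support_subset _ fun J hJ => ?_
    by_contra h
    exact hJ (by simp [partialU_eq_zero hU hf hA h hp])
  rw [totalD, hs, partialX_eq hU hf hA i hp,
    sum_partialU_eq hU hf hA (fun J => p.2 (i ::ₘ J)) hp, ← map_add]
  simp [totalDir]

end Formulas

end JetCalculus

/-! ### Total derivatives and the Euler operator, evaluated along jets of functions. -/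

section JetCalculus

variable {n : ℕ} {F W : Type*} [NormedAddCommGroup F] [NormedSpace ℝ F]
  [NormedAddCommGroup W] [NormedSpace ℝ W] {U : Set (EuclideanSpace ℝ (Fin n))}

theorem JetSmoothOn.partialU (hU : IsOpen U) {r : ℕ} {A : JetCoord n F → W}
    (h : JetSmoothOn U r A) (J : Multiset (Fin n)) :
    JetSmoothOn U r (JetBundle.partialU J A) := by
  classical
  obtain ⟨f, hf, hA⟩ := h
  by_cases hJ : J ∈ multiIndices n r
  · exact ⟨_, (hf.fderiv_of_isOpen (m := ∞) (hU.prod isOpen_univ) (by simp)).clm_comp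
      contDiffOn_const, fun p hp => partialU_eq hU hf hA hJ hp⟩
  · exact (JetSmoothOn.const r 0).congr fun p hp => partialU_eq_zero hU hf hA hJ hp

/-- The direction of differentiation involves `u_{iJ}` with `|J| ≤ r`, so the order rises by one. -/
theorem JetSmoothOn.totalD (hU : IsOpen U) {r : ℕ} {A : JetCoord n F → W}
    (h : JetSmoothOn U r A) (i : Fin n) : JetSmoothOn U (r + 1) (JetBundle.totalD i A) := by
  obtain ⟨f, hf, hA⟩ := h
  have hr : ∀ J : multiIndices n r, (J : Multiset (Fin n)) ∈ multiIndices n (r + 1) := fun J =>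
    mem_multiIndices.2 ((mem_multiIndices.1 J.2).trans (Nat.le_succ r))
  have hi : ∀ J : multiIndices n r, i ::ₘ (J : Multiset (Fin n)) ∈ multiIndices n (r + 1) :=
    fun J => mem_multiIndices.2 (by simpa using mem_multiIndices.1 J.2)
  refine ⟨fun q => fderiv ℝ f (q.1, fun J => q.2 ⟨J, hr J⟩)
    (coordVec i, fun J => q.2 ⟨i ::ₘ (J : Multiset (Fin n)), hi J⟩), ?_,
    fun p hp => totalD_eq hU hf hA i hp⟩
  refine ContDiffOn.clm_apply ?_ (ContDiff.contDiffOn ?_)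
  · refine (hf.fderiv_of_isOpen (m := ∞) (hU.prod isOpen_univ) (by simp)).comp
      (t := U ×ˢ univ) (ContDiff.contDiffOn ?_) fun p hp => ⟨hp.1, mem_univ _⟩
    exact contDiff_fst.prodMk (contDiff_pi.2 fun J => (contDiff_apply ℝ F _).comp contDiff_snd)
  · exact contDiff_const.prodMk (contDiff_pi.2 fun J => (contDiff_apply ℝ F _).comp contDiff_snd)

theorem totalD_congr (hU : IsOpen U) {A A' : JetCoord n F → W}
    (h : ∀ p, p.1 ∈ U → A p = A' p) (i : Fin n) {p : JetCoord n F} (hp : p.1 ∈ U) :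
    totalD i A p = totalD i A' p := by
  have h1 : (fun y => A (y, p.2)) =ᶠ[𝓝 p.1] fun y => A' (y, p.2) := by
    filter_upwards [hU.mem_nhds hp] with y hy using h (y, p.2) hy
  have h2 : ∀ J, partialU J A p = partialU J A' p := fun J => by
    simp only [partialU]
    congr 1
    exact funext fun v => h (p.1, Function.update p.2 J v) hp
  simp only [totalD, partialX, h1.fderiv_eq, h2]

/-- `(-D)_{i_1} ⋯ (-D)_{i_k}` for a list of indices. -/
def negTotalDList (l : List (Fin n)) (A : JetCoord n F → W) : JetCoord n F → W :=
  l.foldr (fun i B p => -totalD i B p) A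

theorem negTotalDList_congr (hU : IsOpen U) {A A' : JetCoord n F → W}
    (h : ∀ p, p.1 ∈ U → A p = A' p) (l : List (Fin n)) {p : JetCoord n F} (hp : p.1 ∈ U) :
    negTotalDList l A p = negTotalDList l A' p := by
  induction l generalizing p with
  | nil => exact h p hp
  | cons i l ih =>
    simp only [negTotalDList, List.foldr_cons] at ih ⊢
    rw [totalD_congr hU (fun p hp => ih hp) i hp]

theorem negTotalDList_zero (l : List (Fin n)) :
    negTotalDList l (fun _ : JetCoord n F => (0 : W)) = fun _ => 0 := by
  induction l with
  | nil => rfl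
  | cons i l ih =>
    simp only [negTotalDList, List.foldr_cons] at ih ⊢
    rw [ih]
    funext p
    simp [totalD, partialX, partialU]

theorem JetSmoothOn.negTotalDList (hU : IsOpen U) {r : ℕ} {A : JetCoord n F → W}
    (h : JetSmoothOn U r A) (l : List (Fin n)) :
    JetSmoothOn U (r + l.length) (JetBundle.negTotalDList l A) := by
  induction l with
  | nil => exact h
  | cons i l ih => exact (ih.totalD hU i).comp contDiff_neg

theorem eulerOp_eq_sum (hU : IsOpen U) {r : ℕ} {A : JetCoord n F → W}
    (h : JetSmoothOn U r A) {p : JetCoord n F} (hp : p.1 ∈ U) :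
    eulerOp A p = ∑ J ∈ multiIndices n r, negTotalDList J.toList (partialU J A) p := by
  obtain ⟨f, hf, hA⟩ := h
  refine finsum_eq_sum_of_support_subset _ fun J hJ => ?_
  by_contra hJr
  refine hJ ?_
  change JetBundle.negTotalDList J.toList (partialU J A) p = 0
  rw [negTotalDList_congr hU (A' := fun _ => 0)
    (fun p hp => partialU_eq_zero hU hf hA hJr hp) _ hp, negTotalDList_zero]

theorem JetSmoothOn.eulerOp (hU : IsOpen U) {r : ℕ} {A : JetCoord n F → W}
    (h : JetSmoothOn U r A) : JetSmoothOn U (r + r) (JetBundle.eulerOp A) := by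
  refine JetSmoothOn.congr (JetSmoothOn.sum (s := multiIndices n r)
    (A := fun J => JetBundle.negTotalDList J.toList (JetBundle.partialU J A)) fun J hJ => ?_)
    fun p hp => eulerOp_eq_sum hU h hp
  refine ((h.partialU hU J).negTotalDList hU _).mono ?_
  have := mem_multiIndices.1 hJ
  rw [Multiset.length_toList]
  omega

theorem contDiffOn_jetTrunc_jetAt (hU : IsOpen U) {φ : EuclideanSpace ℝ (Fin n) → F}
    (hφ : ContDiffOn ℝ ∞ φ U) (r : ℕ) :
    ContDiffOn ℝ ∞ (fun y => jetTrunc r (jetAt φ y)) U :=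
  contDiffOn_id.prodMk (contDiffOn_pi.2 fun J => contDiffOn_partialD hU hφ J)

theorem JetSmoothOn.contDiffOn_jetAt (hU : IsOpen U) {r : ℕ} {A : JetCoord n F → W}
    (h : JetSmoothOn U r A) {φ : EuclideanSpace ℝ (Fin n) → F} (hφ : ContDiffOn ℝ ∞ φ U) :
    ContDiffOn ℝ ∞ (fun y => A (jetAt φ y)) U := by
  obtain ⟨f, hf, hA⟩ := h
  exact (hf.comp (contDiffOn_jetTrunc_jetAt hU hφ r) fun y hy => ⟨hy, mem_univ _⟩).congr
    fun y hy => hA (jetAt φ y) hy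

/-- Chain rule: the velocity of `y ↦ jetTrunc r (jetAt φ y)` in the direction `i` is exactly
`totalDir r i`. Through this lemma total derivatives become ordinary ones. -/
theorem JetSmoothOn.fderiv_jetAt (hU : IsOpen U) {r : ℕ} {A : JetCoord n F → W}
    (h : JetSmoothOn U r A) {φ : EuclideanSpace ℝ (Fin n) → F} (hφ : ContDiffOn ℝ ∞ φ U)
    (i : Fin n) {y : EuclideanSpace ℝ (Fin n)} (hy : y ∈ U) :
    fderiv ℝ (fun y => A (jetAt φ y)) y (coordVec i) = JetBundle.totalD i A (jetAt φ y) := by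
  obtain ⟨f, hf, hA⟩ := h
  have h1 : (fun y => A (jetAt φ y)) =ᶠ[𝓝 y] fun y => f (jetTrunc r (jetAt φ y)) := by
    filter_upwards [hU.mem_nhds hy] with z hz using hA (jetAt φ z) hz
  have h2 : HasFDerivAt (fun y => jetTrunc r (jetAt φ y)) ((ContinuousLinearMap.id ℝ _).prod
      (ContinuousLinearMap.pi fun J : multiIndices n r => fderiv ℝ (partialD J φ) y)) y :=
    (hasFDerivAt_id y).prodMk (hasFDerivAt_pi.2 fun J =>
      (differentiableAt_of_contDiffOn hU (contDiffOn_partialD hU hφ J) hy).hasFDerivAt)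
  have h3 := (hasFDerivAt_of_trunc hU hf hA (p := jetAt φ y) hy).comp y h2
  rw [h1.fderiv_eq, totalD_eq hU hf hA i (p := jetAt φ y) hy]
  refine (congrArg (fun L => L (coordVec i)) h3.fderiv).trans ?_
  simp only [ContinuousLinearMap.comp_apply, ContinuousLinearMap.prod_apply]
  congr 1
  refine Prod.ext rfl (funext fun J => ?_)
  exact fderiv_partialD hU hφ i J hy

/-! ### The first variation along a family of functions. -/

section Variation

/-- Derivatives of a slice become derivatives on the product in directions `(0, v)`. The parameter
direction `(1, 0)` is then one more direction, which may be permuted with the others. -/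
theorem dirDeriv_slice {V G : Type*} [NormedAddCommGroup V] [NormedSpace ℝ V]
    [NormedAddCommGroup G] [NormedSpace ℝ G] {I : Set ℝ} {N : Set V} (hI : IsOpen I)
    (hN : IsOpen N) {f : ℝ × V → G} (hf : ContDiffOn ℝ ∞ f (I ×ˢ N)) (l : List V) {t : ℝ}
    (ht : t ∈ I) {y : V} (hy : y ∈ N) :
    dirDeriv (l.map fun v => ((0 : ℝ), v)) f (t, y) = dirDeriv l (fun z => f (t, z)) y := by
  induction l generalizing y with
  | nil => rfl
  | cons v l ih =>
    simp only [List.map_cons, dirDeriv_cons]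
    have e : (fun z => dirDeriv (l.map fun v => ((0 : ℝ), v)) f (t, z)) =ᶠ[𝓝 y]
        dirDeriv l (fun z => f (t, z)) := by
      filter_upwards [hN.mem_nhds hy] with z hz using ih hz
    rw [← e.fderiv_eq]
    have hd := (differentiableAt_of_contDiffOn (hI.prod hN)
      (contDiffOn_dirDeriv (hI.prod hN) hf (l.map fun v => ((0 : ℝ), v)))
      (show (t, y) ∈ I ×ˢ N from ⟨ht, hy⟩)).hasFDerivAt
    have h2 := hd.comp y ((hasFDerivAt_const t y).prodMk (hasFDerivAt_id y))
    refine Eq.symm ((congrArg (fun L => L v) h2.fderiv).trans ?_)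
    simp

theorem hasDerivAt_partialD {I : Set ℝ} (hI : IsOpen I) (hU : IsOpen U)
    {f : ℝ × EuclideanSpace ℝ (Fin n) → F} (hf : ContDiffOn ℝ ∞ f (I ×ˢ U))
    (J : Multiset (Fin n)) {t : ℝ} (ht : t ∈ I) {y : EuclideanSpace ℝ (Fin n)} (hy : y ∈ U) :
    HasDerivAt (fun s => partialD J (fun z => f (s, z)) y)
      (partialD J (fun z => deriv (fun s => f (s, z)) t) y) t := by
  have hIU := hI.prod hU
  have hs : ∀ s ∈ I, ContDiffOn ℝ ∞ (fun z => f (s, z)) U := fun s hs =>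
    hf.comp (contDiffOn_const.prodMk contDiffOn_id) fun z hz => ⟨hs, hz⟩
  set l := (coordVecs J).map fun v => ((0 : ℝ), v) with hl
  have e : (fun s => dirDeriv l f (s, y)) =ᶠ[𝓝 t]
      fun s => partialD J (fun z => f (s, z)) y := by
    filter_upwards [hI.mem_nhds ht] with s hs'
    rw [partialD_eq_dirDeriv hU (hs s hs') J hy, hl, dirDeriv_slice hI hU hf _ hs' hy]
  have hd := (differentiableAt_of_contDiffOn hIU (contDiffOn_dirDeriv hIU hf l)
    (show (t, y) ∈ I ×ˢ U from ⟨ht, hy⟩)).hasFDerivAt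
  have h2 : HasDerivAt (fun s => dirDeriv l f (s, y))
      (fderiv ℝ (dirDeriv l f) (t, y) (1, 0)) t :=
    hd.comp_hasDerivAt t ((hasDerivAt_id t).prodMk (hasDerivAt_const t y))
  have h3 : EqOn (fun z => fderiv ℝ f (t, z) (1, 0)) (fun z => deriv (fun s => f (s, z)) t) U := by
    intro z hz
    have hd := (differentiableAt_of_contDiffOn hIU hf
      (show (t, z) ∈ I ×ˢ U from ⟨ht, hz⟩)).hasFDerivAt
    exact (hd.comp_hasDerivAt t ((hasDerivAt_id t).prodMk (hasDerivAt_const t z))).deriv.symm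
  have hf' : ContDiffOn ℝ ∞ (fun p => fderiv ℝ f p (1, 0)) (I ×ˢ U) :=
    contDiffOn_fderiv_apply hIU hf _
  have hf'' : ContDiffOn ℝ ∞ (fun z => fderiv ℝ f (t, z) (1, 0)) U :=
    hf'.comp (contDiffOn_const.prodMk contDiffOn_id) fun z hz => ⟨ht, hz⟩
  have h4 : fderiv ℝ (dirDeriv l f) (t, y) (1, 0) =
      partialD J (fun z => deriv (fun s => f (s, z)) t) y := by
    rw [← partialD_congr hU h3 J hy, partialD_eq_dirDeriv hU hf'' J hy]
    -- The interchange of `∂_t` and `∂_J` is symmetry of mixed derivatives on the product.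
    refine (dirDeriv_cons_right hIU hf (1, 0) l ⟨ht, hy⟩).trans ?_
    rw [hl]
    exact dirDeriv_slice hI hU hf' (coordVecs J) ht hy
  rw [← h4]
  exact h2.congr_of_eventuallyEq e.symm

theorem JetSmoothOn.hasDerivAt_variation (hU : IsOpen U) {r : ℕ} {A : JetCoord n F → W}
    (h : JetSmoothOn U r A) {I : Set ℝ} (hI : IsOpen I)
    {f : ℝ × EuclideanSpace ℝ (Fin n) → F} (hf : ContDiffOn ℝ ∞ f (I ×ˢ U)) {t : ℝ} (ht : t ∈ I)
    {y : EuclideanSpace ℝ (Fin n)} (hy : y ∈ U) :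
    HasDerivAt (fun s => A (jetAt (fun z => f (s, z)) y))
      (∑ J ∈ multiIndices n r, JetBundle.partialU J A (jetAt (fun z => f (t, z)) y)
        (partialD J (fun z => deriv (fun s => f (s, z)) t) y)) t := by
  obtain ⟨g, hg, hA⟩ := h
  have h1 : (fun s => A (jetAt (fun z => f (s, z)) y)) =
      fun s => g (jetTrunc r (jetAt (fun z => f (s, z)) y)) :=
    funext fun s => hA (jetAt (fun z => f (s, z)) y) hy
  rw [h1, sum_partialU_eq hU hg hA (fun J => partialD J (fun z => deriv (fun s => f (s, z)) t) y)
    (p := jetAt (fun z => f (t, z)) y) hy]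
  refine (hasFDerivAt_of_trunc hU hg hA
    (p := jetAt (fun z => f (t, z)) y) hy).comp_hasDerivAt t ?_
  exact (hasDerivAt_const t y).prodMk (hasDerivAt_pi.2 fun J =>
    hasDerivAt_partialD hI hU hf J ht hy)

end Variation

end JetCalculus

/-! ### Integration by parts against compactly supported variations. -/

section IntegrationByParts

open MeasureTheory

theorem contDiff_of_contDiffOn_of_tsupport {V G : Type*} [NormedAddCommGroup V] [NormedSpace ℝ V]
    [NormedAddCommGroup G] [NormedSpace ℝ G] {U : Set V} (hU : IsOpen U) {u : V → G}
    (hu : ContDiffOn ℝ ∞ u U) (hs : tsupport u ⊆ U) : ContDiff ℝ ∞ u := by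
  refine contDiff_iff_contDiffAt.2 fun y => ?_
  by_cases hy : y ∈ U
  · exact hu.contDiffAt (hU.mem_nhds hy)
  · exact contDiffAt_const.congr_of_eventuallyEq
      (notMem_tsupport_iff_eventuallyEq.1 fun h => hy (hs h))

theorem tsupport_dirDeriv_subset {V G : Type*} [NormedAddCommGroup V] [NormedSpace ℝ V]
    [NormedAddCommGroup G] [NormedSpace ℝ G] (l : List V) (η : V → G) :
    tsupport (dirDeriv l η) ⊆ tsupport η := by
  induction l with
  | nil => exact subset_rfl
  | cons v l ih => exact (tsupport_fderiv_apply_subset ℝ v).trans ih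

theorem contDiff_dirDeriv {V G : Type*} [NormedAddCommGroup V] [NormedSpace ℝ V]
    [NormedAddCommGroup G] [NormedSpace ℝ G] {η : V → G} (hη : ContDiff ℝ ∞ η) (l : List V) :
    ContDiff ℝ ∞ (dirDeriv l η) :=
  contDiffOn_univ.1 (contDiffOn_dirDeriv isOpen_univ hη.contDiffOn l)

variable {n : ℕ} {F G W : Type*} [NormedAddCommGroup F] [NormedSpace ℝ F]
  [NormedAddCommGroup G] [NormedSpace ℝ G]
  [NormedAddCommGroup W] [NormedSpace ℝ W] {U : Set (EuclideanSpace ℝ (Fin n))}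

theorem tsupport_clm_apply_subset {V : Type*} [TopologicalSpace V] (a : V → G →L[ℝ] W)
    (η : V → G) : tsupport (fun y => a y (η y)) ⊆ tsupport η :=
  closure_mono fun y hy h => hy (by simp only [h, map_zero])

theorem integrable_clm_apply (hU : IsOpen U) {a : EuclideanSpace ℝ (Fin n) → G →L[ℝ] W}
    (ha : ContDiffOn ℝ ∞ a U) {η : EuclideanSpace ℝ (Fin n) → G} (hη : ContDiff ℝ ∞ η)
    (hc : HasCompactSupport η) (hs : tsupport η ⊆ U) : Integrable fun y => a y (η y) :=
  (contDiff_of_contDiffOn_of_tsupport hU (ha.clm_apply hη.contDiffOn)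
    ((tsupport_clm_apply_subset a η).trans hs)).continuous.integrable_of_hasCompactSupport
    (hc.of_isClosed_subset (isClosed_tsupport _) (tsupport_clm_apply_subset a η))

/-- There is no boundary term because `η` has compact support. The coefficient `a` is smooth only on
`U`, which suffices since its products with `η` and its derivatives, extended by zero, are smooth.
-/
theorem integral_apply_fderiv_eq_neg (hU : IsOpen U) {a : EuclideanSpace ℝ (Fin n) → G →L[ℝ] W}
    (ha : ContDiffOn ℝ ∞ a U) {η : EuclideanSpace ℝ (Fin n) → G} (hη : ContDiff ℝ ∞ η)
    (hc : HasCompactSupport η) (hs : tsupport η ⊆ U) (v : EuclideanSpace ℝ (Fin n)) :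
    ∫ y, a y (fderiv ℝ η y v) = -∫ y, (fderiv ℝ a y v) (η y) :=
  integral_bilinear_hasLineDerivAt_right_eq_neg_left_of_integrable (v := v)
    (B := ContinuousLinearMap.id ℝ (G →L[ℝ] W))
    (integrable_clm_apply hU (contDiffOn_fderiv_apply hU ha v) hη hc hs)
    (integrable_clm_apply hU ha (contDiff_dirDeriv hη [v]) (hc.fderiv_apply ℝ v)
      ((tsupport_fderiv_apply_subset ℝ v).trans hs))
    (integrable_clm_apply hU ha hη hc hs)
    (fun y hy => (differentiableAt_of_contDiffOn hU ha (hs hy)).hasFDerivAt.hasLineDerivAt v)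
    (fun y _ => ((hη.differentiable (by simp)) y).hasFDerivAt.hasLineDerivAt v)

theorem integral_dirDeriv_eq (hU : IsOpen U) {r : ℕ} {A : JetCoord n F → G →L[ℝ] W}
    (hA : JetSmoothOn U r A) {φ : EuclideanSpace ℝ (Fin n) → F} (hφ : ContDiffOn ℝ ∞ φ U)
    (l : List (Fin n)) {η : EuclideanSpace ℝ (Fin n) → G} (hη : ContDiff ℝ ∞ η)
    (hc : HasCompactSupport η) (hs : tsupport η ⊆ U) :
    ∫ y, A (jetAt φ y) (dirDeriv (l.map coordVec) η y) =
      ∫ y, negTotalDList l A (jetAt φ y) (η y) := by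
  induction l generalizing η with
  | nil => rfl
  | cons i l ih =>
    -- The induction hypothesis is applied to `∂_i η`; the one remaining integration by parts then
    -- puts `-D_i` outermost, as in `negTotalDList`.
    have h1 : dirDeriv ((i :: l).map coordVec) η =
        dirDeriv (l.map coordVec) (fun y => fderiv ℝ η y (coordVec i)) := funext fun y =>
      dirDeriv_cons_right isOpen_univ hη.contDiffOn _ _ (mem_univ y)
    have hL := hA.negTotalDList hU l
    rw [h1, ih (η := fun y => fderiv ℝ η y (coordVec i))
      (contDiff_dirDeriv hη [coordVec i]) (hc.fderiv_apply ℝ _)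
      ((tsupport_fderiv_apply_subset ℝ _).trans hs),
      integral_apply_fderiv_eq_neg hU (hL.contDiffOn_jetAt hU hφ) hη hc hs, ← integral_neg]
    congr 1
    funext y
    by_cases hy : y ∈ U
    · rw [hL.fderiv_jetAt hU hφ i hy]
      rfl
    -- Outside `U` nothing relates the derivative of the coefficient to `D_i`, but there `η`
    -- vanishes.
    · rw [image_eq_zero_of_notMem_tsupport fun h => hy (hs h)]
      simp

/-- The integrated first variation: the Euler operator is the formal adjoint of the linearization
applied to `1`. -/
theorem integral_variation_eq (hU : IsOpen U) {r : ℕ} {A : JetCoord n F → W}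
    (hA : JetSmoothOn U r A) {φ : EuclideanSpace ℝ (Fin n) → F} (hφ : ContDiffOn ℝ ∞ φ U)
    {η : EuclideanSpace ℝ (Fin n) → F} (hη : ContDiff ℝ ∞ η)
    (hc : HasCompactSupport η) (hs : tsupport η ⊆ U) :
    ∫ y, ∑ J ∈ multiIndices n r, partialU J A (jetAt φ y) (partialD J η y) =
      ∫ y, eulerOp A (jetAt φ y) (η y) := by
  have hD : ∀ J, partialD J η = dirDeriv (coordVecs J) η := fun J => funext fun y =>
    partialD_eq_dirDeriv isOpen_univ hη.contDiffOn J (mem_univ y)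
  simp only [hD]
  rw [integral_finsetSum]
  · have h2 : ∀ y, eulerOp A (jetAt φ y) (η y) = ∑ J ∈ multiIndices n r,
        negTotalDList J.toList (partialU J A) (jetAt φ y) (η y) := fun y => by
      by_cases hy : y ∈ U
      · rw [eulerOp_eq_sum hU hA (p := jetAt φ y) hy, sum_apply]
      · rw [image_eq_zero_of_notMem_tsupport fun h => hy (hs h)]
        simp
    simp only [h2]
    rw [integral_finsetSum]
    · exact Finset.sum_congr rfl fun J _ =>
        integral_dirDeriv_eq hU (hA.partialU hU J) hφ J.toList hη hc hs
    · exact fun J _ => integrable_clm_apply hU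
        (((hA.partialU hU J).negTotalDList hU _).contDiffOn_jetAt hU hφ) hη hc hs
  · exact fun J _ => integrable_clm_apply hU ((hA.partialU hU J).contDiffOn_jetAt hU hφ)
      (contDiff_dirDeriv hη _)
      (hc.of_isClosed_subset (isClosed_tsupport _) (tsupport_dirDeriv_subset _ _))
      ((tsupport_dirDeriv_subset _ _).trans hs)

end IntegrationByParts

/-! ### Fiber-preserving changes of coordinates and their action on functions and variations. -/

section FiberChange

open MeasureTheory

/-- A top form is a multiple of the determinant of a basis, and determinants are multiplicative.
Pull-back of Lagrangians thus reduces to a scalar factor. -/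
theorem compContinuousLinearMap_eq_det_smul {n : ℕ}
    (α : EuclideanSpace ℝ (Fin n) [⋀^Fin n]→L[ℝ] ℝ)
    (L : EuclideanSpace ℝ (Fin n) →L[ℝ] EuclideanSpace ℝ (Fin n)) :
    α.compContinuousLinearMap L = L.det • α := by
  classical
  ext v
  let e := (EuclideanSpace.basisFun (Fin n) ℝ).toBasis
  have h := α.toAlternatingMap.eq_smul_basis_det e
  have h' : ∀ w, α w = α e * e.det w := fun w => by
    simpa using congrArg (fun β => β w) h
  rw [ContinuousAlternatingMap.compContinuousLinearMap_apply, h',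
    ContinuousAlternatingMap.smul_apply, h' v]
  have := e.det_comp L.toLinearMap v
  change e.det (⇑L ∘ v) = L.det * _ at this
  rw [this, smul_eq_mul]
  ring

/-- A fiber-preserving change of coordinates `(y, u) ↦ (h y, H (y, u))` between open subsets of
`ℝⁿ × F`, invertible on the base. -/
structure FiberChange (n : ℕ) (F : Type*) [NormedAddCommGroup F] [NormedSpace ℝ F] where
  source : Set (EuclideanSpace ℝ (Fin n))
  target : Set (EuclideanSpace ℝ (Fin n))
  isOpen_source : IsOpen source
  isOpen_target : IsOpen target
  map : EuclideanSpace ℝ (Fin n) → EuclideanSpace ℝ (Fin n)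
  inv : EuclideanSpace ℝ (Fin n) → EuclideanSpace ℝ (Fin n)
  contDiffOn_map : ContDiffOn ℝ ∞ map source
  contDiffOn_inv : ContDiffOn ℝ ∞ inv target
  mapsTo_map : MapsTo map source target
  mapsTo_inv : MapsTo inv target source
  left_inv : ∀ y ∈ source, inv (map y) = y
  right_inv : ∀ z ∈ target, map (inv z) = z
  fiberMap : EuclideanSpace ℝ (Fin n) × F → F
  contDiffOn_fiberMap : ContDiffOn ℝ ∞ fiberMap (source ×ˢ univ)

namespace FiberChange

variable {n : ℕ} {F : Type*} [NormedAddCommGroup F] [NormedSpace ℝ F] (T : FiberChange n F)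

/-- The induced action on functions. -/
def push (φ : EuclideanSpace ℝ (Fin n) → F) (z : EuclideanSpace ℝ (Fin n)) : F :=
  T.fiberMap (T.inv z, φ (T.inv z))

/-- The restriction of a change of coordinates to an open subset of its source. -/
def restrict (O : Set (EuclideanSpace ℝ (Fin n))) (hO : IsOpen O) (hOs : O ⊆ T.source) :
    FiberChange n F where
  source := O
  target := T.target ∩ T.inv ⁻¹' O
  isOpen_source := hO
  isOpen_target := T.contDiffOn_inv.continuousOn.isOpen_inter_preimage T.isOpen_target hO
  map := T.map
  inv := T.inv
  contDiffOn_map := T.contDiffOn_map.mono hOs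
  contDiffOn_inv := T.contDiffOn_inv.mono inter_subset_left
  mapsTo_map y hy := ⟨T.mapsTo_map (hOs hy), by
    rw [mem_preimage, T.left_inv y (hOs hy)]; exact hy⟩
  mapsTo_inv z hz := hz.2
  left_inv y hy := T.left_inv y (hOs hy)
  right_inv z hz := T.right_inv z hz.1
  fiberMap := T.fiberMap
  contDiffOn_fiberMap := T.contDiffOn_fiberMap.mono (prod_mono hOs subset_rfl)

theorem image_source : T.map '' T.source = T.target :=
  Subset.antisymm T.mapsTo_map.image_subset fun z hz => ⟨T.inv z, T.mapsTo_inv hz, T.right_inv z hz⟩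

theorem injOn_map : InjOn T.map T.source := fun y hy y' hy' h => by
  rw [← T.left_inv y hy, h, T.left_inv y' hy']

theorem hasFDerivAt_map {y : EuclideanSpace ℝ (Fin n)} (hy : y ∈ T.source) :
    HasFDerivAt T.map (fderiv ℝ T.map y) y :=
  (differentiableAt_of_contDiffOn T.isOpen_source T.contDiffOn_map hy).hasFDerivAt

theorem hasFDerivAt_inv {z : EuclideanSpace ℝ (Fin n)} (hz : z ∈ T.target) :
    HasFDerivAt T.inv (fderiv ℝ T.inv z) z :=
  (differentiableAt_of_contDiffOn T.isOpen_target T.contDiffOn_inv hz).hasFDerivAt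

/-- Differentiate `inv ∘ map = id` and take determinants. Nonvanishing makes the sign of the
Jacobian locally constant. -/
theorem det_fderiv_map_ne_zero {y : EuclideanSpace ℝ (Fin n)} (hy : y ∈ T.source) :
    (fderiv ℝ T.map y).det ≠ 0 := by
  have h1 : HasFDerivAt (T.inv ∘ T.map) (fderiv ℝ T.inv (T.map y) ∘L fderiv ℝ T.map y) y :=
    (T.hasFDerivAt_inv (T.mapsTo_map hy)).comp y (T.hasFDerivAt_map hy)
  have h2 : HasFDerivAt (T.inv ∘ T.map) (ContinuousLinearMap.id ℝ _) y :=
    (hasFDerivAt_id y).congr_of_eventuallyEq (by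
      filter_upwards [T.isOpen_source.mem_nhds hy] with z hz using T.left_inv z hz)
  have h3 := h1.unique h2
  intro h0
  have h4 := congrArg ContinuousLinearMap.det h3
  simp only [ContinuousLinearMap.det, ContinuousLinearMap.toLinearMap_comp,
    LinearMap.det_comp] at h4 h0
  rw [h0] at h4
  simp at h4

theorem contDiffOn_push {φ : EuclideanSpace ℝ (Fin n) → F} (hφ : ContDiffOn ℝ ∞ φ T.source) :
    ContDiffOn ℝ ∞ (T.push φ) T.target :=
  T.contDiffOn_fiberMap.comp (T.contDiffOn_inv.prodMk (hφ.comp T.contDiffOn_inv T.mapsTo_inv))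
    fun _ hz => ⟨T.mapsTo_inv hz, mem_univ _⟩

/-- The derivative of the fiber map along the graph of `φ`. -/
def vertical (φ : EuclideanSpace ℝ (Fin n) → F) (y : EuclideanSpace ℝ (Fin n)) : F →L[ℝ] F :=
  fderiv ℝ (fun w => T.fiberMap (y, w)) (φ y)

theorem hasFDerivAt_fiberMap {y : EuclideanSpace ℝ (Fin n)} (hy : y ∈ T.source) (w : F) :
    HasFDerivAt T.fiberMap (fderiv ℝ T.fiberMap (y, w)) (y, w) :=
  (differentiableAt_of_contDiffOn (T.isOpen_source.prod isOpen_univ) T.contDiffOn_fiberMap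
    (show (y, w) ∈ T.source ×ˢ univ from ⟨hy, mem_univ _⟩)).hasFDerivAt

theorem hasFDerivAt_vertical (φ : EuclideanSpace ℝ (Fin n) → F) {y : EuclideanSpace ℝ (Fin n)}
    (hy : y ∈ T.source) : HasFDerivAt (fun w => T.fiberMap (y, w)) (T.vertical φ y) (φ y) :=
  ((T.hasFDerivAt_fiberMap hy (φ y)).comp (φ y)
    ((hasFDerivAt_const y (φ y)).prodMk (hasFDerivAt_id (φ y)))).differentiableAt.hasFDerivAt

theorem vertical_eq (φ : EuclideanSpace ℝ (Fin n) → F) {y : EuclideanSpace ℝ (Fin n)}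
    (hy : y ∈ T.source) : T.vertical φ y =
      fderiv ℝ T.fiberMap (y, φ y) ∘L ContinuousLinearMap.inr ℝ _ _ :=
  ((T.hasFDerivAt_fiberMap hy (φ y)).comp (φ y)
    ((hasFDerivAt_const y (φ y)).prodMk (hasFDerivAt_id (φ y)))).fderiv

theorem contDiffOn_vertical {φ : EuclideanSpace ℝ (Fin n) → F} (hφ : ContDiffOn ℝ ∞ φ T.source) :
    ContDiffOn ℝ ∞ (T.vertical φ) T.source := by
  refine ContDiffOn.congr (ContDiffOn.clm_comp ?_ contDiffOn_const) fun y hy => T.vertical_eq φ hy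
  exact (T.contDiffOn_fiberMap.fderiv_of_isOpen (m := ∞) (T.isOpen_source.prod isOpen_univ)
    (by simp)).comp (contDiffOn_id.prodMk hφ) fun y hy => ⟨hy, mem_univ _⟩

/-- The variation of `T.push φ` induced by a variation `η` of `φ`, extended by zero. -/
def pushVariation (φ η : EuclideanSpace ℝ (Fin n) → F) : EuclideanSpace ℝ (Fin n) → F :=
  T.target.indicator fun z => T.vertical φ (T.inv z) (η (T.inv z))

section PushVariation

variable {φ η : EuclideanSpace ℝ (Fin n) → F} (hφ : ContDiffOn ℝ ∞ φ T.source)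
  (hη : ContDiff ℝ ∞ η) (hc : HasCompactSupport η) (hs : tsupport η ⊆ T.source)

include hc hs in
theorem isCompact_image_tsupport : IsCompact (T.map '' tsupport η) :=
  hc.isCompact.image_of_continuousOn (T.contDiffOn_map.continuousOn.mono hs)

include hc hs in
theorem tsupport_pushVariation_subset : tsupport (T.pushVariation φ η) ⊆ T.map '' tsupport η := by
  refine closure_minimal (fun z hz => ?_) (T.isCompact_image_tsupport hc hs).isClosed
  have hzt : z ∈ T.target := by
    by_contra h
    exact hz (indicator_of_notMem h _)
  refine ⟨T.inv z, ?_, T.right_inv z hzt⟩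
  by_contra h
  refine hz ?_
  rw [pushVariation, indicator_of_mem hzt, image_eq_zero_of_notMem_tsupport h, map_zero]

include hc hs in
theorem hasCompactSupport_pushVariation : HasCompactSupport (T.pushVariation φ η) :=
  (T.isCompact_image_tsupport hc hs).of_isClosed_subset (isClosed_tsupport _)
    (T.tsupport_pushVariation_subset hc hs)

include hc hs in
theorem tsupport_pushVariation_subset_target : tsupport (T.pushVariation φ η) ⊆ T.target :=
  (T.tsupport_pushVariation_subset hc hs).trans (by
    rintro _ ⟨y, hy, rfl⟩
    exact T.mapsTo_map (hs hy))

include hφ hη hc hs in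
theorem contDiff_pushVariation : ContDiff ℝ ∞ (T.pushVariation φ η) := by
  refine contDiff_of_contDiffOn_of_tsupport T.isOpen_target ?_
    (T.tsupport_pushVariation_subset_target hc hs)
  refine ContDiffOn.congr (((T.contDiffOn_vertical hφ).comp T.contDiffOn_inv
    T.mapsTo_inv).clm_apply (hη.comp_contDiffOn T.contDiffOn_inv)) fun z hz => ?_
  exact indicator_of_mem hz _

/-- The fiber map need not be linear, so `T.push (φ + t • η)` need not be affine in `t`; its
velocity at `t = 0` is still linear in `η`. -/
theorem deriv_push_add_smul {z : EuclideanSpace ℝ (Fin n)} (hz : z ∈ T.target) :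
    deriv (fun t : ℝ => T.push (φ + t • η) z) 0 = T.pushVariation φ η z := by
  rw [pushVariation, indicator_of_mem hz]
  have h0 : HasDerivAt (fun t : ℝ => φ (T.inv z) + t • η (T.inv z)) (η (T.inv z)) 0 := by
    simpa using ((hasDerivAt_id (0 : ℝ)).smul_const (η (T.inv z))).const_add (φ (T.inv z))
  have h1 : HasFDerivAt (fun w => T.fiberMap (T.inv z, w)) (T.vertical φ (T.inv z))
      (φ (T.inv z) + (0 : ℝ) • η (T.inv z)) := by
    simpa using T.hasFDerivAt_vertical φ (T.mapsTo_inv hz)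
  exact (h1.comp_hasDerivAt (0 : ℝ) h0).deriv

include hφ hη in
theorem contDiffOn_push_add_smul :
    ContDiffOn ℝ ∞ (fun p : ℝ × EuclideanSpace ℝ (Fin n) => T.push (φ + p.1 • η) p.2)
      (univ ×ˢ T.target) := by
  have hi : ContDiffOn ℝ ∞ (fun p : ℝ × EuclideanSpace ℝ (Fin n) => T.inv p.2)
      (univ ×ˢ T.target) := T.contDiffOn_inv.comp contDiffOn_snd fun p hp => hp.2
  refine T.contDiffOn_fiberMap.comp (hi.prodMk ?_) fun p hp => ⟨T.mapsTo_inv hp.2, mem_univ _⟩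
  exact (hφ.comp hi fun p hp => T.mapsTo_inv hp.2).add
    (contDiffOn_fst.smul (hη.comp_contDiffOn hi))

end PushVariation

end FiberChange

end FiberChange

/-! ### Naturality of the Euler operator in coordinates. -/

namespace FiberChange

open MeasureTheory

variable {n : ℕ} {F : Type*} [NormedAddCommGroup F] [NormedSpace ℝ F] (T : FiberChange n F)

/-- `B` is the pull-back of the top form `A` along the change of coordinates, on all the jets
obtained from `φ` by compactly supported variations. -/
def IsPullbackNear (A B : JetCoord n F → EuclideanSpace ℝ (Fin n) [⋀^Fin n]→L[ℝ] ℝ)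
    (φ : EuclideanSpace ℝ (Fin n) → F) : Prop :=
  ∀ η : EuclideanSpace ℝ (Fin n) → F, ContDiff ℝ ∞ η → HasCompactSupport η →
    tsupport η ⊆ T.source → ∀ t : ℝ, ∀ y ∈ T.source, B (jetAt (φ + t • η) y) =
      (A (jetAt (T.push (φ + t • η)) (T.map y))).compContinuousLinearMap (fderiv ℝ T.map y)

variable {T} {A B : JetCoord n F → EuclideanSpace ℝ (Fin n) [⋀^Fin n]→L[ℝ] ℝ} {r r' : ℕ}
  {φ : EuclideanSpace ℝ (Fin n) → F}

/-- Differentiate the pull-back relation in `t` at `0`. The Jacobian depends only on the base point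
and factors out. -/
theorem IsPullbackNear.variation_eq (hA : JetSmoothOn T.target r A)
    (hB : JetSmoothOn T.source r' B) (hφ : ContDiffOn ℝ ∞ φ T.source) (h : T.IsPullbackNear A B φ)
    {η : EuclideanSpace ℝ (Fin n) → F} (hη : ContDiff ℝ ∞ η) (hc : HasCompactSupport η)
    (hs : tsupport η ⊆ T.source) {y : EuclideanSpace ℝ (Fin n)} (hy : y ∈ T.source) :
    ∑ J ∈ multiIndices n r', partialU J B (jetAt φ y) (partialD J η y) =
      (fderiv ℝ T.map y).det • ∑ J ∈ multiIndices n r, partialU J A (jetAt (T.push φ) (T.map y))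
        (partialD J (T.pushVariation φ η) (T.map y)) := by
  have hB' : HasDerivAt (fun t : ℝ => B (jetAt (φ + t • η) y))
      (∑ J ∈ multiIndices n r', partialU J B (jetAt φ y) (partialD J η y)) 0 := by
    have hf : ContDiffOn ℝ ∞ (fun p : ℝ × EuclideanSpace ℝ (Fin n) => (φ + p.1 • η) p.2)
        (univ ×ˢ T.source) := (hφ.comp contDiffOn_snd fun p hp => hp.2).add
      (contDiffOn_fst.smul (hη.comp_contDiffOn contDiffOn_snd))
    have h1 := hB.hasDerivAt_variation T.isOpen_source isOpen_univ hf (mem_univ 0) hy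
    have h2 : (fun z => deriv (fun t : ℝ => (φ + t • η) z) 0) = η := funext fun z => by
      have : HasDerivAt (fun t : ℝ => φ z + t • η z) (η z) 0 := by
        simpa using ((hasDerivAt_id (0 : ℝ)).smul_const (η z)).const_add (φ z)
      exact this.deriv
    simp only [h2] at h1
    have h3 : (fun z => (φ + (0 : ℝ) • η) z) = φ := by simp
    rw [h3] at h1
    exact h1
  have hA' : HasDerivAt (fun t : ℝ => A (jetAt (T.push (φ + t • η)) (T.map y)))
      (∑ J ∈ multiIndices n r, partialU J A (jetAt (T.push φ) (T.map y))
        (partialD J (T.pushVariation φ η) (T.map y))) 0 := by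
    have h1 := hA.hasDerivAt_variation T.isOpen_target isOpen_univ
      (T.contDiffOn_push_add_smul hφ hη) (mem_univ 0) (T.mapsTo_map hy)
    have h2 : ∀ J, partialD J (fun z => deriv (fun t : ℝ => T.push (φ + t • η) z) 0) (T.map y) =
        partialD J (T.pushVariation φ η) (T.map y) := fun J =>
      partialD_congr T.isOpen_target (fun z hz => T.deriv_push_add_smul hz) J (T.mapsTo_map hy)
    simp only [h2] at h1
    have h3 : (fun z => T.push (φ + (0 : ℝ) • η) z) = T.push φ := by simp
    rw [h3] at h1
    exact h1
  have he : (fun t : ℝ => B (jetAt (φ + t • η) y)) = fun t =>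
      (fderiv ℝ T.map y).det • A (jetAt (T.push (φ + t • η)) (T.map y)) := funext fun t => by
    rw [h η hη hc hs t y hy, compContinuousLinearMap_eq_det_smul]
  rw [he] at hB'
  exact hB'.unique (hA'.const_smul (fderiv ℝ T.map y).det)

theorem setIntegral_target_eq {W : Type*} [NormedAddCommGroup W] [NormedSpace ℝ W]
    (f : EuclideanSpace ℝ (Fin n) → W) :
    ∫ z in T.target, f z = ∫ y in T.source, |(fderiv ℝ T.map y).det| • f (T.map y) := by
  rw [← T.image_source]
  exact integral_image_eq_integral_abs_det_fderiv_smul volume T.isOpen_source.measurableSet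
    (fun y hy => (T.hasFDerivAt_map hy).hasFDerivWithinAt) T.injOn_map f

/-- By the Leibniz formula the determinant is a polynomial in the matrix entries. -/
theorem contDiffOn_det_fderiv_map :
    ContDiffOn ℝ ∞ (fun y => (fderiv ℝ T.map y).det) T.source := by
  have h : ContDiff ℝ ∞ fun L : EuclideanSpace ℝ (Fin n) →L[ℝ] EuclideanSpace ℝ (Fin n) =>
      L.det := by
    have e : (fun L : EuclideanSpace ℝ (Fin n) →L[ℝ] EuclideanSpace ℝ (Fin n) => L.det) =
        fun L => ∑ σ : Equiv.Perm (Fin n), ((Equiv.Perm.sign σ : ℤ) : ℝ) *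
          ∏ i, (EuclideanSpace.proj (σ i) : EuclideanSpace ℝ (Fin n) →L[ℝ] ℝ)
            (L (coordVec i)) := by
      funext L
      let e := (EuclideanSpace.basisFun (Fin n) ℝ).toBasis
      rw [ContinuousLinearMap.det, ← LinearMap.det_toMatrix e, Matrix.det_apply']
      refine Finset.sum_congr rfl fun σ _ => ?_
      congr 1
    rw [e]
    exact ContDiff.sum fun σ _ => contDiff_const.mul (contDiff_prod fun i _ =>
      ContinuousLinearMap.contDiff _ |>.comp (contDiff_id.clm_apply contDiff_const))
  exact h.comp_contDiffOn (T.contDiffOn_map.fderiv_of_isOpen T.isOpen_source (by simp))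

/-- Top forms pull back with `det`, while integrals change variables with `|det|`. The constant `c`
accounts for the discrepancy on a region where the sign is fixed, and cancels at the end. -/
theorem IsPullbackNear.integral_eq (hA : JetSmoothOn T.target r A)
    (hB : JetSmoothOn T.source r' B) (hφ : ContDiffOn ℝ ∞ φ T.source) (h : T.IsPullbackNear A B φ)
    {c : ℝ} (hc0 : c ≠ 0) (hdet : ∀ y ∈ T.source,
      |(fderiv ℝ T.map y).det| = c * (fderiv ℝ T.map y).det)
    {η : EuclideanSpace ℝ (Fin n) → F} (hη : ContDiff ℝ ∞ η) (hc : HasCompactSupport η)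
    (hs : tsupport η ⊆ T.source) :
    ∫ y in T.source, eulerOp B (jetAt φ y) (η y) = ∫ y in T.source, (fderiv ℝ T.map y).det •
      eulerOp A (jetAt (T.push φ) (T.map y)) (T.vertical φ y (η y)) := by
  have hcc := T.hasCompactSupport_pushVariation (φ := φ) hc hs
  have hts := T.tsupport_pushVariation_subset_target (φ := φ) hc hs
  have hD : ∀ {U : Set (EuclideanSpace ℝ (Fin n))} {η : EuclideanSpace ℝ (Fin n) → F},
      ContDiff ℝ ∞ η → tsupport η ⊆ U → ∀ J, ∀ y ∉ U, partialD J η y = 0 :=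
    fun hη hs J y hy => by
      rw [partialD_eq_dirDeriv isOpen_univ hη.contDiffOn J (mem_univ y)]
      exact image_eq_zero_of_notMem_tsupport fun h => hy (hs (tsupport_dirDeriv_subset _ _ h))
  have hη' := T.contDiff_pushVariation hφ hη hc hs
  have e1 := integral_variation_eq T.isOpen_source hB hφ hη hc hs
  have e2 := integral_variation_eq T.isOpen_target hA (T.contDiffOn_push hφ) hη' hcc hts
  have z1 : ∀ y ∉ T.source,
      ∑ J ∈ multiIndices n r', partialU J B (jetAt φ y) (partialD J η y) = 0 := fun y hy =>
    Finset.sum_eq_zero fun J _ => by rw [hD hη hs J y hy, map_zero]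
  have z2 : ∀ y ∉ T.source, eulerOp B (jetAt φ y) (η y) = 0 := fun y hy => by
    rw [image_eq_zero_of_notMem_tsupport fun h => hy (hs h), map_zero]
  have z3 : ∀ y ∉ T.target, ∑ J ∈ multiIndices n r, partialU J A (jetAt (T.push φ) y)
      (partialD J (T.pushVariation φ η) y) = 0 := fun y hy =>
    Finset.sum_eq_zero fun J _ => by rw [hD hη' hts J y hy, map_zero]
  have z4 : ∀ y ∉ T.target, eulerOp A (jetAt (T.push φ) y) (T.pushVariation φ η y) = 0 :=
    fun y hy => by rw [image_eq_zero_of_notMem_tsupport fun h => hy (hts h), map_zero]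
  -- Both first-variation identities are restricted to the domains of the coordinate change, and the
  -- one on the target is transported to the source.
  rw [← setIntegral_eq_integral_of_forall_compl_eq_zero z1,
    ← setIntegral_eq_integral_of_forall_compl_eq_zero z2] at e1
  rw [← setIntegral_eq_integral_of_forall_compl_eq_zero z3,
    ← setIntegral_eq_integral_of_forall_compl_eq_zero z4,
    setIntegral_target_eq, setIntegral_target_eq] at e2
  have hm := T.isOpen_source.measurableSet
  have e3 : ∫ y in T.source, |(fderiv ℝ T.map y).det| •
      ∑ J ∈ multiIndices n r, partialU J A (jetAt (T.push φ) (T.map y))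
        (partialD J (T.pushVariation φ η) (T.map y)) =
      c • ∫ y in T.source, eulerOp B (jetAt φ y) (η y) := by
    rw [← e1, ← integral_smul]
    refine setIntegral_congr_fun hm fun y hy => ?_
    rw [h.variation_eq hA hB hφ hη hc hs hy, hdet y hy, mul_smul]
  have e4 : ∫ y in T.source, |(fderiv ℝ T.map y).det| •
      eulerOp A (jetAt (T.push φ) (T.map y)) (T.pushVariation φ η (T.map y)) =
      c • ∫ y in T.source, (fderiv ℝ T.map y).det •
        eulerOp A (jetAt (T.push φ) (T.map y)) (T.vertical φ y (η y)) := by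
    rw [← integral_smul]
    refine setIntegral_congr_fun hm fun y hy => ?_
    rw [hdet y hy, mul_smul, pushVariation, indicator_of_mem (T.mapsTo_map hy), T.left_inv y hy]
  rw [e3, e4] at e2
  exact smul_right_injective _ hc0 e2

/-- The fundamental lemma of the calculus of variations, applied with `η = g • v` for arbitrary
scalar test functions `g` and a fixed vector `v`. -/
theorem IsPullbackNear.eulerOp_eq_of_sign (hA : JetSmoothOn T.target r A)
    (hB : JetSmoothOn T.source r' B) (hφ : ContDiffOn ℝ ∞ φ T.source) (h : T.IsPullbackNear A B φ)
    {c : ℝ} (hc0 : c ≠ 0) (hdet : ∀ y ∈ T.source,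
      |(fderiv ℝ T.map y).det| = c * (fderiv ℝ T.map y).det)
    {y : EuclideanSpace ℝ (Fin n)} (hy : y ∈ T.source) (v : F) :
    eulerOp B (jetAt φ y) v = (eulerOp A (jetAt (T.push φ) (T.map y))
      (T.vertical φ y v)).compContinuousLinearMap (fderiv ℝ T.map y) := by
  have hU := T.isOpen_source
  have c1 : ContDiffOn ℝ ∞ (fun y => eulerOp B (jetAt φ y)) T.source :=
    (hB.eulerOp hU).contDiffOn_jetAt hU hφ
  have c2 : ContDiffOn ℝ ∞ (fun y => (fderiv ℝ T.map y).det •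
      (eulerOp A (jetAt (T.push φ) (T.map y)) ∘L T.vertical φ y)) T.source :=
    contDiffOn_det_fderiv_map.smul ((((hA.eulerOp T.isOpen_target).contDiffOn_jetAt
      T.isOpen_target (T.contDiffOn_push hφ)).comp T.contDiffOn_map T.mapsTo_map).clm_comp
      (T.contDiffOn_vertical hφ))
  have c3 := c1.clm_apply (contDiffOn_const (c := v))
  have c4 := c2.clm_apply (contDiffOn_const (c := v))
  have key := hU.ae_eq_zero_of_integral_contDiff_smul_eq_zero (μ := volume)
    ((c3.sub c4).continuousOn.locallyIntegrableOn hU.measurableSet) fun g hg hgc hgs => by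
      have hη : ContDiff ℝ ∞ fun y => g y • v := hg.smul contDiff_const
      have hsub : tsupport (fun y => g y • v) ⊆ tsupport g :=
        closure_mono fun y hy h0 => hy (by simp only [h0, zero_smul])
      have hηc : HasCompactSupport fun y => g y • v :=
        hgc.of_isClosed_subset (isClosed_tsupport _) hsub
      have hi := h.integral_eq hA hB hφ hc0 hdet hη hηc (hsub.trans hgs)
      have i1 := integrable_clm_apply hU c1 hη hηc (hsub.trans hgs)
      have i2 := integrable_clm_apply hU c2 hη hηc (hsub.trans hgs)
      have hz : ∀ y ∉ T.source, g y = 0 := fun y hy =>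
        image_eq_zero_of_notMem_tsupport fun h => hy (hgs h)
      rw [← setIntegral_eq_integral_of_forall_compl_eq_zero (s := T.source) fun y hy => by
        rw [hz y hy, zero_smul]]
      rw [← sub_eq_zero] at hi
      replace hi := (integral_sub i1.integrableOn i2.integrableOn).trans hi
      rw [← hi]
      congr 1
      funext y
      simp only [map_smul, smul_apply, ContinuousLinearMap.comp_apply, smul_sub]
  -- Almost everywhere equality of continuous functions on an open set is equality everywhere.
  have key2 := Measure.eqOn_open_of_ae_eq (μ := volume) (g := fun _ => 0)
    ((ae_restrict_iff' hU.measurableSet).2 key) hU (c3.sub c4).continuousOn continuousOn_const hy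
  rw [compContinuousLinearMap_eq_det_smul]
  exact sub_eq_zero.1 key2

/-- Naturality of the Euler operator under fiber-preserving changes of coordinates. -/
theorem IsPullbackNear.eulerOp_eq (hA : JetSmoothOn T.target r A)
    (hB : JetSmoothOn T.source r' B) (hφ : ContDiffOn ℝ ∞ φ T.source) (h : T.IsPullbackNear A B φ)
    {y : EuclideanSpace ℝ (Fin n)} (hy : y ∈ T.source) (v : F) :
    eulerOp B (jetAt φ y) v = (eulerOp A (jetAt (T.push φ) (T.map y))
      (T.vertical φ y v)).compContinuousLinearMap (fderiv ℝ T.map y) := by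
  set d := fun y => (fderiv ℝ T.map y).det with hd
  have hcont : ContinuousOn d T.source := contDiffOn_det_fderiv_map.continuousOn
  -- The Jacobian may change sign between components of the source. The claim is local, so `T` is
  -- restricted to the part where the sign is that of `d y`; then `c = |d y| / d y` works.
  let O := T.source ∩ (fun z => d y * d z) ⁻¹' Ioi 0
  have hO : IsOpen O := (continuousOn_const.mul hcont).isOpen_inter_preimage T.isOpen_source
    isOpen_Ioi
  have hd0 : d y ≠ 0 := T.det_fderiv_map_ne_zero hy
  have hyO : y ∈ O := ⟨hy, mul_self_pos.2 hd0⟩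
  let S := T.restrict O hO inter_subset_left
  have hS : S.IsPullbackNear A B φ := fun η hη hc hs t z hz =>
    h η hη hc (hs.trans inter_subset_left) t z hz.1
  refine IsPullbackNear.eulerOp_eq_of_sign (T := S) (hA.mono_set inter_subset_left)
    (hB.mono_set inter_subset_left) (hφ.mono inter_subset_left) hS (c := |d y| / d y)
    (div_ne_zero (abs_ne_zero.2 hd0) hd0) (fun z hz => ?_) hyO v
  have hp : 0 < d y * d z := hz.2
  change |d z| = |d y| / d y * d z
  rcases lt_or_gt_of_ne hd0 with hneg | hpos
  · have : d z < 0 := by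
      by_contra h'
      exact absurd hp (not_lt.2 (mul_nonpos_of_nonpos_of_nonneg hneg.le (not_lt.1 h')))
    rw [abs_of_neg hneg, abs_of_neg this, neg_div, div_self hd0, neg_one_mul]
  · have : 0 < d z := (mul_pos_iff_of_pos_left hpos).1 hp
    rw [abs_of_pos hpos, abs_of_pos this, div_self hd0, one_mul]

end FiberChange

/-! ### Prolongation of a change of coordinates to jets. -/

section Prolongation

variable {n : ℕ} {F W : Type*} [NormedAddCommGroup F] [NormedSpace ℝ F]
  [NormedAddCommGroup W] [NormedSpace ℝ W]

theorem sum_smul_coordVec (w : EuclideanSpace ℝ (Fin n)) : w = ∑ k, w k • coordVec k := by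
  have := (EuclideanSpace.basisFun (Fin n) ℝ).sum_repr w
  simpa [coordVec] using this.symm

namespace FiberChange

variable (T : FiberChange n F)

theorem exists_dirDeriv_push (l : List (Fin n)) : ∃ B : JetCoord n F → F,
    JetSmoothOn T.source l.length B ∧ ∀ φ, ContDiffOn ℝ ∞ φ T.source → ∀ y ∈ T.source,
      dirDeriv (l.map coordVec) (T.push φ) (T.map y) = B (jetAt φ y) := by
  induction l with
  | nil =>
    refine ⟨_, jetSmoothOn_zero_coord T.contDiffOn_fiberMap, fun φ _ y hy => ?_⟩
    simp only [List.map_nil, dirDeriv_nil, push, T.left_inv y hy, jetAt, partialD_zero]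
  | cons i l ih =>
    obtain ⟨B, hB, h⟩ := ih
    have hc : ContDiffOn ℝ ∞ (fun y => fderiv ℝ T.inv (T.map y) (coordVec i)) T.source :=
      (contDiffOn_fderiv_apply T.isOpen_target T.contDiffOn_inv _).comp T.contDiffOn_map
        T.mapsTo_map
    -- By the chain rule, `∂/∂z^i` in the new base coordinates is the combination of the `D_k` with
    -- coefficients `∂y^k/∂z^i`, the entries of the derivative of `T.inv`.
    refine ⟨fun p => ∑ k, (fderiv ℝ T.inv (T.map p.1) (coordVec i)) k • totalD k B p, ?_, ?_⟩
    · refine JetSmoothOn.sum (A := fun k (p : JetCoord n F) =>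
        (fderiv ℝ T.inv (T.map p.1) (coordVec i)) k • totalD k B p) fun k _ => ?_
      refine (JetSmoothOn.of_base _ hc).comp₂ (hB.totalD T.isOpen_source k)
        (g := fun q : EuclideanSpace ℝ (Fin n) × F => q.1 k • q.2) ?_
      exact ((EuclideanSpace.proj k : EuclideanSpace ℝ (Fin n) →L[ℝ] ℝ).contDiff.comp
        contDiff_fst).smul contDiff_snd
    · intro φ hφ y hy
      have hz := T.mapsTo_map hy
      have e : dirDeriv (l.map coordVec) (T.push φ) =ᶠ[𝓝 (T.map y)]
          (fun y => B (jetAt φ y)) ∘ T.inv := by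
        filter_upwards [T.isOpen_target.mem_nhds hz] with z hz
        rw [Function.comp_apply, ← h φ hφ _ (T.mapsTo_inv hz), T.right_inv z hz]
      have hd : HasFDerivAt (fun y => B (jetAt φ y)) (fderiv ℝ (fun y => B (jetAt φ y)) y)
          (T.inv (T.map y)) := by
        rw [T.left_inv y hy]
        exact (differentiableAt_of_contDiffOn T.isOpen_source
          (hB.contDiffOn_jetAt T.isOpen_source hφ) hy).hasFDerivAt
      simp only [List.map_cons, dirDeriv_cons]
      rw [e.fderiv_eq, (hd.comp _ (T.hasFDerivAt_inv hz)).fderiv, ContinuousLinearMap.comp_apply]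
      conv_lhs => rw [sum_smul_coordVec (fderiv ℝ T.inv (T.map y) (coordVec i))]
      rw [map_sum]
      refine Finset.sum_congr rfl fun k _ => ?_
      rw [map_smul, hB.fderiv_jetAt T.isOpen_source hφ k hy]
      rfl

theorem exists_partialD_push (J : Multiset (Fin n)) : ∃ B : JetCoord n F → F,
    JetSmoothOn T.source J.card B ∧ ∀ φ, ContDiffOn ℝ ∞ φ T.source → ∀ y ∈ T.source,
      partialD J (T.push φ) (T.map y) = B (jetAt φ y) := by
  obtain ⟨B, hB, h⟩ := T.exists_dirDeriv_push J.toList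
  rw [Multiset.length_toList] at hB
  refine ⟨B, hB, fun φ hφ y hy => ?_⟩
  rw [partialD_eq_dirDeriv T.isOpen_target (T.contDiffOn_push hφ) J (T.mapsTo_map hy)]
  exact h φ hφ y hy

/-- Functions of finitely many jet coordinates pull back under the prolongation of a change of
coordinates, without raising the order. -/
theorem exists_jetSmoothOn_push {r : ℕ} {A : JetCoord n F → W} (hA : JetSmoothOn T.target r A) :
    ∃ B : JetCoord n F → W, JetSmoothOn T.source r B ∧
      ∀ φ, ContDiffOn ℝ ∞ φ T.source → ∀ y ∈ T.source,
        B (jetAt φ y) = A (jetAt (T.push φ) (T.map y)) := by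
  obtain ⟨f, hf, hAf⟩ := hA
  choose P hP hPφ using T.exists_partialD_push
  have hP' : ∀ J : multiIndices n r, JetSmoothOn T.source r (P J) := fun J =>
    (hP J).mono (mem_multiIndices.1 J.2)
  choose g hg hgP using hP'
  refine ⟨fun p => f (T.map p.1, fun J => g J (jetTrunc r p)),
    ⟨fun q => f (T.map q.1, fun J => g J q), ?_, fun p _ => rfl⟩, fun φ hφ y hy => ?_⟩
  · refine hf.comp (ContDiffOn.prodMk ?_ (contDiffOn_pi.2 fun J => hg J))
      fun p hp => ⟨T.mapsTo_map hp.1, mem_univ _⟩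
    exact T.contDiffOn_map.comp contDiffOn_fst fun p hp => hp.1
  · rw [hAf _ (show (jetAt (T.push φ) (T.map y)).1 ∈ T.target from T.mapsTo_map hy)]
    refine congrArg f (Prod.ext rfl (funext fun J => ?_))
    change g J (jetTrunc r (jetAt φ y)) = partialD J (T.push φ) (T.map y)
    rw [hPφ J φ hφ y hy, hgP J _ hy]

end FiberChange

end Prolongation

/-! ### Smoothness of the pull-back of alternating forms. -/

section Alternating

theorem contDiff_compContinuousLinearMap {V : Type*} [NormedAddCommGroup V] [NormedSpace ℝ V]
    [FiniteDimensional ℝ V] (k : ℕ) :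
    ContDiff ℝ ∞ fun q : (V [⋀^Fin k]→L[ℝ] ℝ) × (V →L[ℝ] V) =>
      q.1.compContinuousLinearMap q.2 := by
  let I := ContinuousAlternatingMap.toContinuousMultilinearMapLI (𝕜 := ℝ) (E := V) (F := ℝ)
    (ι := Fin k)
  have hfin : FiniteDimensional ℝ (ContinuousMultilinearMap ℝ (fun _ : Fin k => V) ℝ) :=
    FiniteDimensional.of_injective (ContinuousMultilinearMap.toMultilinearMapLinear :
      ContinuousMultilinearMap ℝ (fun _ : Fin k => V) ℝ →ₗ[ℝ] _)
      ContinuousMultilinearMap.toMultilinearMap_injective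
  -- Pull-back is smooth on multilinear maps. A linear left inverse of the inclusion of alternating
  -- maps, continuous in finite dimension, carries this over to alternating ones.
  obtain ⟨L, hL⟩ := I.toLinearMap.exists_leftInverse_of_injective
    (LinearMap.ker_eq_bot.2 I.injective)
  have hL' : ∀ x, L.toContinuousLinearMap (I x) = x := fun x => congrArg (fun l => l x) hL
  have e : (fun q : (V [⋀^Fin k]→L[ℝ] ℝ) × (V →L[ℝ] V) => q.1.compContinuousLinearMap q.2) =
      fun q => L.toContinuousLinearMap
        (ContinuousMultilinearMap.compContinuousLinearMapContinuousMultilinear ℝ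
          (fun _ : Fin k => V) (fun _ : Fin k => V) ℝ (fun _ => q.2) (I q.1)) := by
    funext q
    rw [← hL' (q.1.compContinuousLinearMap q.2)]
    rfl
  rw [e]
  refine L.toContinuousLinearMap.contDiff.comp (ContDiff.clm_apply ?_
    (I.contDiff.comp contDiff_fst))
  exact (ContinuousMultilinearMap.contDiff _).comp (contDiff_pi.2 fun _ => contDiff_snd)

end Alternating

/-! ### Gluing local coordinate expressions. -/

section Gluing

variable {n : ℕ} {F W : Type*} [NormedAddCommGroup F] [NormedSpace ℝ F] [FiniteDimensional ℝ F]
  [NormedAddCommGroup W] [NormedSpace ℝ W]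

/-- A smooth partition of unity glues the local functions: an average of functions with the
prescribed values has the prescribed values. It is needed because `ψ` may carry one coordinate
domain into several, whereas `IsCoordExpr` asks for a single function. -/
theorem exists_contDiffOn_of_local {V ι : Type*} [NormedAddCommGroup V] [NormedSpace ℝ V]
    [FiniteDimensional ℝ V] {O : Set V} (hO : IsOpen O) (c : ι → V) (Q : ι → W)
    (h : ∀ x ∈ O, ∃ N ∈ 𝓝 x, ∃ f : V → W, ContDiffOn ℝ ∞ f N ∧ ∀ j, c j ∈ N → Q j = f (c j)) :
    ∃ f : V → W, ContDiffOn ℝ ∞ f O ∧ ∀ j, c j ∈ O → Q j = f (c j) := by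
  classical
  let O' : TopologicalSpace.Opens V := ⟨O, hO⟩
  -- At a point hit by some `c j` this set has at most one element, elsewhere it is all of `W`; it
  -- is convex in either case.
  let t : O' → Set W := fun x => {w | ∀ j, c j = x → Q j = w}
  have ht : ∀ x, Convex ℝ (t x) := by
    intro x w hw w' hw' a b _ _ hab j hj
    rw [← hw j hj, ← hw' j hj, ← add_smul, hab, one_smul]
  have hloc : ∀ x : O', ∃ N ∈ 𝓝 x, ∃ g : O' → W,
      ContMDiffOn 𝓘(ℝ, V) 𝓘(ℝ, W) ∞ g N ∧ ∀ y ∈ N, g y ∈ t y := by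
    intro x
    obtain ⟨N, hN, f, hf, hQ⟩ := h x x.2
    refine ⟨Subtype.val ⁻¹' N, continuous_subtype_val.continuousAt.preimage_mem_nhds hN,
      fun y => f y, ?_, fun y hy j hj => ?_⟩
    · exact hf.contMDiffOn.comp (contMDiff_subtype_val (I := 𝓘(ℝ, V))).contMDiffOn
        fun y hy => hy
    · exact (hQ j (by rw [hj]; exact hy)).trans (congrArg f hj)
  have hp : ProperSpace V := FiniteDimensional.proper_real V
  have hl : LocallyCompactSpace O' := hO.locallyCompactSpace
  have hσ : SigmaCompactSpace O' := sigmaCompactSpace_of_locallyCompact_secondCountable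
  obtain ⟨g, hg⟩ := exists_contMDiffMap_forall_mem_convex_of_local (n := ⊤) 𝓘(ℝ, V) ht hloc
  refine ⟨fun x => if hx : x ∈ O then g ⟨x, hx⟩ else 0, fun x hx => ?_, fun j hj => ?_⟩
  · refine ContDiffAt.contDiffWithinAt (contMDiffAt_iff_contDiffAt.1 ?_)
    rw [← contMDiffAt_subtype_iff (U := O') (x := ⟨x, hx⟩)]
    refine (g.contMDiff ⟨x, hx⟩).congr_of_eventuallyEq (Eventually.of_forall fun y => ?_)
    exact dif_pos y.2
  · have h := hg ⟨c j, hj⟩ j rfl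
    simpa only [dif_pos hj] using h

theorem exists_jetSmoothOn_of_local {ι : Type*} {U : Set (EuclideanSpace ℝ (Fin n))}
    (hU : IsOpen U) (r : ℕ) (c : ι → JetCoord n F) (Q : ι → W)
    (h : ∀ x ∈ U, ∃ N, IsOpen N ∧ x ∈ N ∧ ∃ A, JetSmoothOn N r A ∧
      ∀ j, (c j).1 ∈ N → Q j = A (c j)) :
    ∃ A : JetCoord n F → W, JetSmoothOn U r A ∧ ∀ j, (c j).1 ∈ U → Q j = A (c j) := by
  obtain ⟨f, hf, hQ⟩ := exists_contDiffOn_of_local (hU.prod isOpen_univ)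
    (fun j => jetTrunc r (c j)) Q fun x hx => by
      obtain ⟨N, hN, hxN, A, ⟨f, hf, hA⟩, hQ⟩ := h x.1 hx.1
      exact ⟨N ×ˢ univ, (hN.prod isOpen_univ).mem_nhds ⟨hxN, mem_univ _⟩, f, hf, fun j hj =>
        (hQ j hj.1).trans (hA _ hj.1)⟩
  exact ⟨fun p => f (jetTrunc r p), ⟨f, hf, fun _ _ => rfl⟩, fun j hj => hQ j ⟨hj, mem_univ _⟩⟩

end Gluing

/-! ### Adapted coordinates on the bundle, and the coordinate form of `ψ`. -/

section Geometry

variable {n : ℕ} {F : Type*} [NormedAddCommGroup F] [NormedSpace ℝ F]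
  {M : Type*} [TopologicalSpace M] [ChartedSpace (EuclideanSpace ℝ (Fin n)) M]
  {E : M → Type*} [TopologicalSpace (TotalSpace F E)] [∀ x, TopologicalSpace (E x)]
  [∀ x, AddCommGroup (E x)] [∀ x, Module ℝ (E x)] [FiberBundle F E]
  {W : Type*} [NormedAddCommGroup W] [NormedSpace ℝ W]

theorem isOpen_chartDomain (x₀ : M) : IsOpen (chartDomain (n := n) F E x₀) :=
  (chartAt _ x₀).open_source.inter (trivializationAt F E x₀).open_baseSet

theorem mem_chartDomain_self (x : M) : x ∈ chartDomain (n := n) F E x :=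
  ⟨mem_chart_source _ x, FiberBundle.mem_baseSet_trivializationAt' x⟩

theorem isOpen_chart_image (x₀ : M) {s : Set M} (hs : IsOpen s)
    (hss : s ⊆ chartDomain (n := n) F E x₀) :
    IsOpen (chartAt (EuclideanSpace ℝ (Fin n)) x₀ '' s) :=
  (chartAt _ x₀).isOpen_image_of_subset_source hs (hss.trans inter_subset_left)

theorem isOpen_coordDomain (x₀ : M) : IsOpen (coordDomain (n := n) F E x₀) :=
  isOpen_chart_image x₀ (isOpen_chartDomain x₀) subset_rfl

theorem chart_mem_coordDomain {x₀ x : M} (hx : x ∈ chartDomain (n := n) F E x₀) :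
    chartAt (EuclideanSpace ℝ (Fin n)) x₀ x ∈ coordDomain (n := n) F E x₀ :=
  mem_image_of_mem _ hx

theorem chart_symm_chart {x₀ x : M} (hx : x ∈ chartDomain (n := n) F E x₀) :
    (chartAt (EuclideanSpace ℝ (Fin n)) x₀).symm (chartAt _ x₀ x) = x :=
  (chartAt _ x₀).left_inv hx.1

theorem chart_symm_mem {x₀ : M} {y : EuclideanSpace ℝ (Fin n)}
    (hy : y ∈ coordDomain (n := n) F E x₀) :
    (chartAt (EuclideanSpace ℝ (Fin n)) x₀).symm y ∈ chartDomain (n := n) F E x₀ := by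
  obtain ⟨x, hx, rfl⟩ := hy
  rwa [chart_symm_chart hx]

theorem chart_chart_symm {x₀ : M} {y : EuclideanSpace ℝ (Fin n)}
    (hy : y ∈ coordDomain (n := n) F E x₀) :
    chartAt (EuclideanSpace ℝ (Fin n)) x₀ ((chartAt _ x₀).symm y) = y := by
  obtain ⟨x, hx, rfl⟩ := hy
  rw [chart_symm_chart hx]

theorem exists_jet_eq (j : JetSpace n F E) : ∃ φ : SmoothSection n F E, j = jet φ j.1 := by
  obtain ⟨x, q⟩ := j
  obtain ⟨φ, rfl⟩ := Quotient.exists_rep q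
  exact ⟨φ, rfl⟩

theorem jetCoord_jet {x₀ x : M} (hx : x ∈ chartDomain (n := n) F E x₀)
    (φ : SmoothSection n F E) :
    jetCoord x₀ (jet φ x) = jetAt (localRep (n := n) F x₀ φ) (chartAt _ x₀ x) :=
  Prod.ext rfl (funext fun _ => dif_pos hx)

theorem IsCoordExpr.jetSmoothOn {x₀ : M} {r : ℕ} {Q : JetSpace n F E → W}
    {A : JetCoord n F → W} (h : IsCoordExpr x₀ r Q A) :
    JetSmoothOn (coordDomain (n := n) F E x₀) r A := by
  obtain ⟨⟨f, hf, hA⟩, _⟩ := h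
  exact ⟨f, hf, fun p _ => hA p⟩

/-- A function which is smooth in finitely many coordinates over the coordinate domain and
represents `Q` can be normalized to a coordinate expression. -/
theorem JetSmoothOn.exists_isCoordExpr {x₀ : M} {r : ℕ} {Q : JetSpace n F E → W}
    {A : JetCoord n F → W} (hA : JetSmoothOn (coordDomain (n := n) F E x₀) r A)
    (hQ : ∀ (φ : SmoothSection n F E), ∀ x ∈ chartDomain (n := n) F E x₀,
      Q (jet φ x) = A (jetAt (localRep (n := n) F x₀ φ) (chartAt _ x₀ x))) :
    ∃ A', IsCoordExpr x₀ r Q A' := by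
  obtain ⟨f, hf, hA⟩ := hA
  refine ⟨fun p => f (jetTrunc r p), ⟨f, hf, fun _ => rfl⟩, fun j hj => ?_⟩
  obtain ⟨φ, hφ⟩ := exists_jet_eq j
  rw [hφ, hQ φ _ hj, jetCoord_jet hj, hA _ (chart_mem_coordDomain hj)]

theorem coordExpr_spec {x₀ : M} {Q : JetSpace n F E → W}
    (h : ∃ A, ∃ r, IsCoordExpr x₀ r Q A) : ∃ r, IsCoordExpr x₀ r Q (coordExpr x₀ Q) := by
  rw [coordExpr, dif_pos h]
  exact h.choose_spec

/-- Coordinate expressions may be constructed locally. -/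
theorem exists_isCoordExpr_of_local [FiniteDimensional ℝ F] (x₀ : M) (r : ℕ)
    (Q : JetSpace n F E → W)
    (h : ∀ x ∈ chartDomain (n := n) F E x₀, ∃ N, IsOpen N ∧ chartAt _ x₀ x ∈ N ∧ ∃ A,
      JetSmoothOn N r A ∧ ∀ (φ : SmoothSection n F E), ∀ x' ∈ chartDomain (n := n) F E x₀,
        chartAt _ x₀ x' ∈ N → Q (jet φ x') =
          A (jetAt (localRep (n := n) F x₀ φ) (chartAt _ x₀ x'))) :
    ∃ A, IsCoordExpr x₀ r Q A := by
  let ι := {j : JetSpace n F E // j.1 ∈ chartDomain (n := n) F E x₀}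
  obtain ⟨A, hA, hQ⟩ := exists_jetSmoothOn_of_local (isOpen_coordDomain x₀) r
    (fun j : ι => jetCoord x₀ j.1) (fun j : ι => Q j.1) (by
      rintro _ ⟨x, hx, rfl⟩
      obtain ⟨N, hN, hxN, A, hA, hQ⟩ := h x hx
      refine ⟨N, hN, hxN, A, hA, fun j hj => ?_⟩
      obtain ⟨φ, hφ⟩ := exists_jet_eq j.1
      have := hQ φ _ j.2 hj
      rw [← jetCoord_jet j.2, ← hφ] at this
      exact this)
  refine hA.exists_isCoordExpr fun φ x hx => ?_
  rw [← jetCoord_jet hx]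
  exact hQ ⟨jet φ x, hx⟩ (chart_mem_coordDomain hx)

variable [IsManifold (𝓡 n) ∞ M] [VectorBundle ℝ F E] [ContMDiffVectorBundle ∞ F E (𝓡 n)]

theorem contDiffOn_localRep (φ : SmoothSection n F E) (x₀ : M) :
    ContDiffOn ℝ ∞ (localRep (n := n) F x₀ φ) (coordDomain (n := n) F E x₀) := by
  rintro _ ⟨x, hx, rfl⟩
  exact (contDiffAt_localRep φ x₀ x hx).contDiffWithinAt

theorem contMDiffAt_chart_symm {x₀ : M} {y : EuclideanSpace ℝ (Fin n)}
    (hy : y ∈ coordDomain (n := n) F E x₀) :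
    ContMDiffAt (𝓡 n) (𝓡 n) ∞ (chartAt (EuclideanSpace ℝ (Fin n)) x₀).symm y := by
  obtain ⟨x, hx, rfl⟩ := hy
  exact (contMDiffOn_chart_symm (I := 𝓡 n) (n := ∞) (x := x₀)).contMDiffAt
    ((chartAt _ x₀).open_target.mem_nhds ((chartAt _ x₀).map_source hx.1))

theorem contMDiffAt_chart {x₀ x : M} (hx : x ∈ chartDomain (n := n) F E x₀) :
    ContMDiffAt (𝓡 n) (𝓡 n) ∞ (chartAt (EuclideanSpace ℝ (Fin n)) x₀) x :=
  (contMDiffOn_chart (I := 𝓡 n) (n := ∞) (x := x₀)).contMDiffAt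
    ((chartAt _ x₀).open_source.mem_nhds hx.1)

/-- The expression of a fiber-preserving diffeomorphism in adapted coordinates. -/
def FiberAut.inCharts (ψ : FiberAut n F E) (x₀ x₁ : M) : FiberChange n F where
  source := chartAt (EuclideanSpace ℝ (Fin n)) x₀ ''
    (chartDomain (n := n) F E x₀ ∩ ψ.base ⁻¹' chartDomain (n := n) F E x₁)
  target := chartAt (EuclideanSpace ℝ (Fin n)) x₁ ''
    (chartDomain (n := n) F E x₁ ∩ ψ.base.symm ⁻¹' chartDomain (n := n) F E x₀)
  isOpen_source := isOpen_chart_image x₀ ((isOpen_chartDomain x₀).inter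
    ((isOpen_chartDomain x₁).preimage ψ.base.continuous)) inter_subset_left
  isOpen_target := isOpen_chart_image x₁ ((isOpen_chartDomain x₁).inter
    ((isOpen_chartDomain x₀).preimage ψ.base.symm.continuous)) inter_subset_left
  map y := chartAt (EuclideanSpace ℝ (Fin n)) x₁
    (ψ.base ((chartAt (EuclideanSpace ℝ (Fin n)) x₀).symm y))
  inv z := chartAt (EuclideanSpace ℝ (Fin n)) x₀
    (ψ.base.symm ((chartAt (EuclideanSpace ℝ (Fin n)) x₁).symm z))
  contDiffOn_map := by
    rintro _ ⟨x, hx, rfl⟩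
    refine ContDiffAt.contDiffWithinAt (contMDiffAt_iff_contDiffAt.1 ?_)
    have h1 := (ψ.base.contMDiff _).comp _ (contMDiffAt_chart_symm (chart_mem_coordDomain hx.1))
    exact ContMDiffAt.comp_of_eq (contMDiffAt_chart hx.2) h1
      (by rw [chart_symm_chart hx.1])
  contDiffOn_inv := by
    rintro _ ⟨x, hx, rfl⟩
    refine ContDiffAt.contDiffWithinAt (contMDiffAt_iff_contDiffAt.1 ?_)
    have h1 := (ψ.base.symm.contMDiff _).comp _
      (contMDiffAt_chart_symm (chart_mem_coordDomain hx.1))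
    exact ContMDiffAt.comp_of_eq (contMDiffAt_chart hx.2) h1
      (by rw [chart_symm_chart hx.1])
  mapsTo_map := by
    rintro _ ⟨x, hx, rfl⟩
    simp only [chart_symm_chart hx.1]
    exact ⟨ψ.base x, ⟨hx.2, by simpa using hx.1⟩, rfl⟩
  mapsTo_inv := by
    rintro _ ⟨x, hx, rfl⟩
    simp only [chart_symm_chart hx.1]
    exact ⟨ψ.base.symm x, ⟨hx.2, by simpa using hx.1⟩, rfl⟩
  left_inv := by
    rintro _ ⟨x, hx, rfl⟩
    rw [chart_symm_chart hx.1, chart_symm_chart hx.2]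
    simp
  right_inv := by
    rintro _ ⟨x, hx, rfl⟩
    rw [chart_symm_chart hx.1, chart_symm_chart hx.2]
    simp
  fiberMap p := (trivializationAt F E x₁
    (ψ.toDiffeo ((trivializationAt F E x₀).toOpenPartialHomeomorph.symm
      ((chartAt (EuclideanSpace ℝ (Fin n)) x₀).symm p.1, p.2)))).2
  contDiffOn_fiberMap := by
    rintro ⟨_, u⟩ ⟨⟨x, hx, rfl⟩, _⟩
    refine ContDiffAt.contDiffWithinAt (contMDiffAt_iff_contDiffAt.1 ?_)
    set c := chartAt (EuclideanSpace ℝ (Fin n)) x₀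
    set e := trivializationAt F E x₀
    have hcsx : c.symm (c x) = x := c.left_inv hx.1.1
    have ht : ((c.symm (c x), u) : M × F) ∈ e.target := by
      rw [e.mem_target, hcsx]; exact hx.1.2
    have k1 : ContMDiffAt 𝓘(ℝ, EuclideanSpace ℝ (Fin n) × F) ((𝓡 n).prod 𝓘(ℝ, F)) ∞
        (fun p : EuclideanSpace ℝ (Fin n) × F => ((c.symm p.1, p.2) : M × F)) (c x, u) :=
      (ContMDiffAt.comp (g := c.symm) (c x, u)
        (contMDiffAt_chart_symm (chart_mem_coordDomain hx.1)) contDiffAt_fst.contMDiffAt).prodMk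
        contDiffAt_snd.contMDiffAt
    have k2 : ContMDiffAt ((𝓡 n).prod 𝓘(ℝ, F)) ((𝓡 n).prod 𝓘(ℝ, F)) ∞
        e.toOpenPartialHomeomorph.symm ((c.symm (c x), u) : M × F) :=
      (Bundle.Trivialization.contMDiffOn_symm (IB := 𝓡 n) (n := ∞) e).contMDiffAt
        (e.open_target.mem_nhds ht)
    have k3 := (ψ.toDiffeo.contMDiff _).comp _ (ContMDiffAt.comp (c x, u) k2 k1)
    have hs : ψ.toDiffeo (e.toOpenPartialHomeomorph.symm ((c.symm (c x), u) : M × F))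
        ∈ (trivializationAt F E x₁).source := by
      rw [Bundle.Trivialization.mem_source, ψ.proj_apply, e.proj_symm_apply ht, hcsx]
      exact hx.2.2
    have k4 : ContMDiffAt ((𝓡 n).prod 𝓘(ℝ, F)) ((𝓡 n).prod 𝓘(ℝ, F)) ∞ (trivializationAt F E x₁)
        (ψ.toDiffeo (e.toOpenPartialHomeomorph.symm ((c.symm (c x), u) : M × F))) :=
      (Bundle.Trivialization.contMDiffOn (IB := 𝓡 n) (n := ∞)
        (trivializationAt F E x₁)).contMDiffAt
        ((trivializationAt F E x₁).open_source.mem_nhds hs)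
    exact contMDiffAt_snd.comp _ (ContMDiffAt.comp (c x, u) k4 k3)

variable (ψ : FiberAut n F E) (x₀ x₁ : M)

theorem inCharts_source_subset : (ψ.inCharts x₀ x₁).source ⊆ coordDomain (n := n) F E x₀ :=
  image_mono inter_subset_left

theorem inCharts_target_subset : (ψ.inCharts x₀ x₁).target ⊆ coordDomain (n := n) F E x₁ :=
  image_mono inter_subset_left

theorem inCharts_map_chart {x₀ x : M} (hx : x ∈ chartDomain (n := n) F E x₀) :
    (ψ.inCharts x₀ x₁).map (chartAt _ x₀ x) = chartAt _ x₁ (ψ.base x) :=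
  congrArg (fun x => chartAt _ x₁ (ψ.base x)) (chart_symm_chart hx)

theorem chart_mem_inCharts_source {x₀ x₁ x : M} (hx : x ∈ chartDomain (n := n) F E x₀)
    (hx₁ : ψ.base x ∈ chartDomain (n := n) F E x₁) :
    chartAt _ x₀ x ∈ (ψ.inCharts x₀ x₁).source := mem_image_of_mem _ ⟨hx, hx₁⟩

theorem inCharts_push_localRep (φ : SmoothSection n F E) :
    EqOn ((ψ.inCharts x₀ x₁).push (localRep (n := n) F x₀ φ))
      (localRep (n := n) F x₁ (ψ.pushSection φ)) (ψ.inCharts x₀ x₁).target := by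
  rintro _ ⟨x, hx, rfl⟩
  simp only [FiberChange.push, FiberAut.inCharts, localRep, ψ.mk_pushSection]
  rw [chart_symm_chart hx.1, chart_symm_chart hx.2]
  congr 3
  exact (trivializationAt F E x₀).symm_apply_mk_proj
    (x := (⟨_, φ (ψ.base.symm x)⟩ : TotalSpace F E))
    (by rw [Bundle.Trivialization.mem_source]; exact hx.2.2)

/-- The link between the prolongation defined on equivalence classes of sections and the coordinate
calculus of `FiberChange`. -/
theorem jetAt_push_localRep (φ : SmoothSection n F E) {x₀ x₁ x : M}
    (hx : x ∈ chartDomain (n := n) F E x₀) (hx₁ : ψ.base x ∈ chartDomain (n := n) F E x₁) :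
    jetAt ((ψ.inCharts x₀ x₁).push (localRep (n := n) F x₀ φ))
      ((ψ.inCharts x₀ x₁).map (chartAt _ x₀ x)) =
      jetCoord x₁ (ψ.prolong (jet φ x)) := by
  have hm := (ψ.inCharts x₀ x₁).mapsTo_map (chart_mem_inCharts_source ψ hx hx₁)
  rw [jetAt_congr (ψ.inCharts x₀ x₁).isOpen_target (inCharts_push_localRep ψ x₀ x₁ φ) hm,
    inCharts_map_chart ψ x₁ hx]
  exact (jetCoord_jet hx₁ _).symm

theorem hasFDerivAt_tangentCoordChange {x₀ x : M}
    (hx : x ∈ (chartAt (EuclideanSpace ℝ (Fin n)) x₀).source) :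
    HasFDerivAt (chartAt (EuclideanSpace ℝ (Fin n)) x ∘ (chartAt _ x₀).symm)
      (tangentCoordChange (𝓡 n) x₀ x x) (chartAt _ x₀ x) := by
  have h := hasFDerivWithinAt_tangentCoordChange (I := 𝓡 n) (x := x₀) (y := x) (z := x)
    ⟨by simpa using hx, by simp⟩
  rw [ModelWithCorners.range_eq_univ, hasFDerivWithinAt_univ] at h
  exact h

/-- The derivative of the induced diffeomorphism of the base, in the preferred charts. -/
def FiberAut.baseDeriv (ψ : FiberAut n F E) (x : M) :
    EuclideanSpace ℝ (Fin n) →L[ℝ] EuclideanSpace ℝ (Fin n) := mfderiv (𝓡 n) (𝓡 n) ψ.base x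

theorem FiberAut.hasFDerivAt_baseDeriv (ψ : FiberAut n F E) (x : M) :
    HasFDerivAt (chartAt (EuclideanSpace ℝ (Fin n)) (ψ.base x) ∘ ψ.base ∘
      (chartAt (EuclideanSpace ℝ (Fin n)) x).symm) (ψ.baseDeriv x)
      (chartAt (EuclideanSpace ℝ (Fin n)) x x) := by
  have h := (((ψ.base.contMDiff x).mdifferentiableAt (by simp)).hasMFDerivAt).2
  rw [ModelWithCorners.range_eq_univ] at h
  have h' : HasFDerivWithinAt (chartAt (EuclideanSpace ℝ (Fin n)) (ψ.base x) ∘ ψ.base ∘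
      (chartAt (EuclideanSpace ℝ (Fin n)) x).symm) (ψ.baseDeriv x) univ
      (chartAt (EuclideanSpace ℝ (Fin n)) x x) := h
  exact hasFDerivWithinAt_univ.1 h'

/-- Both sides differentiate `ψ_M` read from the chart at `x₀` to the chart at `ψ_M x`: one factors
through the chart at `x`, the other through the chart at `x₁`. -/
theorem baseDeriv_comp_tangentCoordChange {x₀ x₁ x : M}
    (hx : x ∈ chartDomain (n := n) F E x₀) (hx₁ : ψ.base x ∈ chartDomain (n := n) F E x₁) :
    ψ.baseDeriv x ∘L tangentCoordChange (𝓡 n) x₀ x x =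
      tangentCoordChange (𝓡 n) x₁ (ψ.base x) (ψ.base x) ∘L
        fderiv ℝ (ψ.inCharts x₀ x₁).map (chartAt _ x₀ x) := by
  have h1 := hasFDerivAt_tangentCoordChange hx.1
  have h2 := ψ.hasFDerivAt_baseDeriv x
  have h3 := hasFDerivAt_tangentCoordChange hx₁.1
  have hs := chart_mem_inCharts_source ψ hx hx₁
  have h4 := (ψ.inCharts x₀ x₁).hasFDerivAt_map hs
  have h2' : HasFDerivAt (chartAt (EuclideanSpace ℝ (Fin n)) (ψ.base x) ∘ ψ.base ∘
      (chartAt (EuclideanSpace ℝ (Fin n)) x).symm)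
      (ψ.baseDeriv x) ((chartAt (EuclideanSpace ℝ (Fin n)) x ∘
        (chartAt (EuclideanSpace ℝ (Fin n)) x₀).symm) (chartAt _ x₀ x)) := by
    rw [Function.comp_apply, chart_symm_chart hx]
    exact h2
  have h3' : HasFDerivAt (chartAt (EuclideanSpace ℝ (Fin n)) (ψ.base x) ∘ (chartAt _ x₁).symm)
      (tangentCoordChange (𝓡 n) x₁ (ψ.base x) (ψ.base x))
      ((ψ.inCharts x₀ x₁).map (chartAt _ x₀ x)) := by
    rw [inCharts_map_chart ψ x₁ hx]
    exact h3
  have e1 := h2'.comp _ h1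
  have e2 := h3'.comp _ h4
  refine e1.unique (e2.congr_of_eventuallyEq ?_)
  have hcont : ContinuousAt (chartAt (EuclideanSpace ℝ (Fin n)) x₀).symm (chartAt _ x₀ x) :=
    (contMDiffAt_chart_symm (chart_mem_coordDomain hx)).continuousAt
  have hev := hcont.eventually_mem (s := (chartAt (EuclideanSpace ℝ (Fin n)) x).source) (by
    rw [chart_symm_chart hx]
    exact (chartAt _ x).open_source.mem_nhds (mem_chart_source _ x))
  filter_upwards [hev, (ψ.inCharts x₀ x₁).isOpen_source.mem_nhds hs] with y hy hys
  obtain ⟨x', hx', rfl⟩ := hys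
  rw [chart_symm_chart hx'.1] at hy
  simp only [Function.comp_apply]
  rw [inCharts_map_chart ψ x₁ hx'.1, chart_symm_chart hx'.1, chart_symm_chart hx'.2,
    (chartAt (EuclideanSpace ℝ (Fin n)) x).left_inv hy]

theorem formInChart_self {k : ℕ} (x : M) (β : TangentSpace (𝓡 n) x [⋀^Fin k]→L[ℝ] ℝ) :
    formInChart x x β = β := by
  ext v
  have h : ∀ w, tangentCoordChange (𝓡 n) x x x w = w := fun w =>
    tangentCoordChange_self (I := 𝓡 n) (by simp)
  change β (fun i => tangentCoordChange (𝓡 n) x x x (v i)) = β v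
  simp only [h]

theorem inChart_pullback {k : ℕ} (α : HForm n F E k) (φ : SmoothSection n F E) {x₀ x₁ x : M}
    (hx : x ∈ chartDomain (n := n) F E x₀) (hx₁ : ψ.base x ∈ chartDomain (n := n) F E x₁) :
    HForm.inChart (pullback ψ α) x₀ (jet φ x) =
      (HForm.inChart α x₁ (ψ.prolong (jet φ x))).compContinuousLinearMap
        (fderiv ℝ (ψ.inCharts x₀ x₁).map (chartAt _ x₀ x)) := by
  ext v
  have h := baseDeriv_comp_tangentCoordChange ψ hx hx₁
  change α (ψ.prolong (jet φ x)) (fun i =>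
    (ψ.baseDeriv x ∘L tangentCoordChange (𝓡 n) x₀ x x) (v i)) = _
  rw [h]
  rfl

end Geometry

/-! ### Naturality of the Euler operator and of `d_H` at jets of global sections. -/

section Naturality

variable {n : ℕ} {F : Type*} [NormedAddCommGroup F] [NormedSpace ℝ F]
  {M : Type*} [TopologicalSpace M] [ChartedSpace (EuclideanSpace ℝ (Fin n)) M]
  {E : M → Type*} [TopologicalSpace (TotalSpace F E)] [∀ x, TopologicalSpace (E x)]
  [∀ x, AddCommGroup (E x)] [∀ x, Module ℝ (E x)] [FiberBundle F E]
  {W : Type*} [NormedAddCommGroup W] [NormedSpace ℝ W]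

variable [IsManifold (𝓡 n) ∞ M] [VectorBundle ℝ F E] [ContMDiffVectorBundle ∞ F E (𝓡 n)]

theorem trivialization_linearMapAt {x₀ x : M} (hx : x ∈ (trivializationAt F E x₀).baseSet)
    (v : E x) : (trivializationAt F E x₀).linearMapAt ℝ x v =
      (trivializationAt F E x₀ ⟨x, v⟩).2 :=
  congrFun ((trivializationAt F E x₀).coe_linearMapAt_of_mem (R := ℝ) hx) v

theorem trivialization_symmₗ_snd {x₀ x : M} (hx : x ∈ (trivializationAt F E x₀).baseSet)
    (v : F) : (trivializationAt F E x₀ ⟨x, (trivializationAt F E x₀).symmₗ ℝ x v⟩).2 = v := by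
  rw [← trivialization_linearMapAt hx, Bundle.Trivialization.linearMapAt_symmₗ _ hx]

open Classical in
/-- The smooth section with given coordinate expression, compactly supported in the coordinate
domain at `x₀`. -/
def extendSection [T2Space M] (x₀ : M) {η : EuclideanSpace ℝ (Fin n) → F} (hη : ContDiff ℝ ∞ η)
    (hc : HasCompactSupport η) (hs : tsupport η ⊆ coordDomain (n := n) F E x₀) :
    SmoothSection n F E where
  toFun x := if x ∈ chartDomain (n := n) F E x₀ then
    (trivializationAt F E x₀).symmₗ ℝ x (η (chartAt _ x₀ x)) else 0
  contMDiff_toFun := by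
    -- The complement of `K`, where the section is zero, and the coordinate domain form an open
    -- cover: `K` is compact, hence closed in the Hausdorff space `M`.
    set K := (chartAt (EuclideanSpace ℝ (Fin n)) x₀).symm '' tsupport η with hK
    have hKc : IsClosed K := by
      refine (hc.isCompact.image_of_continuousOn fun y hy => ?_).isClosed
      exact (contMDiffAt_chart_symm (hs hy)).continuousAt.continuousWithinAt
    intro x
    by_cases hx : x ∈ chartDomain (n := n) F E x₀
    · rw [Bundle.Trivialization.contMDiffAt_section_iff (IB := 𝓡 n) (n := ∞)
        (trivializationAt F E x₀) hx.2]
      have h1 : ContMDiffAt (𝓡 n) 𝓘(ℝ, F) ∞ (fun x => η (chartAt _ x₀ x)) x :=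
        ContMDiffAt.comp x hη.contDiffAt.contMDiffAt (contMDiffAt_chart hx)
      refine h1.congr_of_eventuallyEq ?_
      filter_upwards [(isOpen_chartDomain (n := n) (F := F) (E := E) x₀).mem_nhds hx] with x hx
      rw [if_pos hx]
      exact trivialization_symmₗ_snd hx.2 _
    · have hxK : x ∈ Kᶜ := by
        rintro ⟨y, hy, rfl⟩
        exact hx (chart_symm_mem (hs hy))
      refine ((0 : SmoothSection n F E).contMDiff x).congr_of_eventuallyEq ?_
      filter_upwards [hKc.isOpen_compl.mem_nhds hxK] with x hx
      refine congrArg (TotalSpace.mk' F x) ?_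
      split_ifs with h
      · rw [image_eq_zero_of_notMem_tsupport (f := η), map_zero]
        · rfl
        · intro h0
          exact hx ⟨_, h0, chart_symm_chart h⟩
      · rfl

theorem localRep_add_smul_extendSection [T2Space M] {x₀ : M} {η : EuclideanSpace ℝ (Fin n) → F}
    (hη : ContDiff ℝ ∞ η) (hc : HasCompactSupport η)
    (hs : tsupport η ⊆ coordDomain (n := n) F E x₀) (φ : SmoothSection n F E) (t : ℝ) :
    EqOn (localRep (n := n) F x₀ (φ + t • extendSection x₀ hη hc hs : SmoothSection n F E))
      (localRep (n := n) F x₀ φ + t • η) (coordDomain (n := n) F E x₀) := by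
  intro y hy
  have hx := chart_symm_mem hy
  have hy' := chart_chart_symm hy
  set x := (chartAt (EuclideanSpace ℝ (Fin n)) x₀).symm y with hxd
  have hv : extendSection x₀ hη hc hs x = (trivializationAt F E x₀).symmₗ ℝ x (η y) := by
    refine (if_pos hx).trans ?_
    rw [hy']
  change (trivializationAt F E x₀ ⟨x, φ x + t • extendSection x₀ hη hc hs x⟩).2 =
    (trivializationAt F E x₀ ⟨x, φ x⟩).2 + t • η y
  rw [hv]
  rw [← trivialization_linearMapAt hx.2, ← trivialization_linearMapAt hx.2, map_add, map_smul,
    Bundle.Trivialization.linearMapAt_symmₗ _ hx.2]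

/-- `B` is the coordinate expression at `x₀` of the pull-back along `ψ` of the horizontal form with
coordinate expression `A` at `x₁`. -/
def IsCoordPullback (ψ : FiberAut n F E) (x₀ x₁ : M) {k : ℕ}
    (A B : JetCoord n F → EuclideanSpace ℝ (Fin n) [⋀^Fin k]→L[ℝ] ℝ) : Prop :=
  ∀ (φ : SmoothSection n F E) (x : M), x ∈ chartDomain (n := n) F E x₀ →
    ψ.base x ∈ chartDomain (n := n) F E x₁ → B (jetCoord x₀ (jet φ x)) =
      (A (jetCoord x₁ (ψ.prolong (jet φ x)))).compContinuousLinearMap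
        (fderiv ℝ (ψ.inCharts x₀ x₁).map (chartAt _ x₀ x))

theorem IsCoordPullback.apply_jetAt {ψ : FiberAut n F E} {x₀ x₁ : M} {k : ℕ}
    {A B : JetCoord n F → EuclideanSpace ℝ (Fin n) [⋀^Fin k]→L[ℝ] ℝ}
    (h : IsCoordPullback ψ x₀ x₁ A B) (φ : SmoothSection n F E) {y : EuclideanSpace ℝ (Fin n)}
    (hy : y ∈ (ψ.inCharts x₀ x₁).source) :
    B (jetAt (localRep (n := n) F x₀ φ) y) =
      (A (jetAt ((ψ.inCharts x₀ x₁).push (localRep (n := n) F x₀ φ))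
        ((ψ.inCharts x₀ x₁).map y))).compContinuousLinearMap
        (fderiv ℝ (ψ.inCharts x₀ x₁).map y) := by
  obtain ⟨x, hx, rfl⟩ := hy
  rw [← jetCoord_jet hx.1, h φ x hx.1 hx.2, jetAt_push_localRep ψ φ hx.1 hx.2]

/-- The pull-back relation is known only at jets of global sections. Compactly supported variations
extend by zero to global sections, which provides the hypothesis `IsPullbackNear`. -/
theorem IsCoordPullback.eulerOp_eq [T2Space M] {ψ : FiberAut n F E} {x₀ x₁ : M} {r r' : ℕ}
    {A B : JetCoord n F → EuclideanSpace ℝ (Fin n) [⋀^Fin n]→L[ℝ] ℝ}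
    (hA : JetSmoothOn (coordDomain (n := n) F E x₁) r A)
    (hB : JetSmoothOn (coordDomain (n := n) F E x₀) r' B)
    (h : IsCoordPullback ψ x₀ x₁ A B) (φ : SmoothSection n F E) {x : M}
    (hx : x ∈ chartDomain (n := n) F E x₀) (hx₁ : ψ.base x ∈ chartDomain (n := n) F E x₁) (v : F) :
    eulerOp B (jetCoord x₀ (jet φ x)) v =
      (eulerOp A (jetCoord x₁ (ψ.prolong (jet φ x)))
        ((ψ.inCharts x₀ x₁).vertical (localRep (n := n) F x₀ φ) (chartAt _ x₀ x)
          v)).compContinuousLinearMap (fderiv ℝ (ψ.inCharts x₀ x₁).map (chartAt _ x₀ x)) := by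
  set T := ψ.inCharts x₀ x₁ with hT
  have hsrc : T.source ⊆ coordDomain (n := n) F E x₀ := inCharts_source_subset ψ x₀ x₁
  have hnear : T.IsPullbackNear A B (localRep (n := n) F x₀ φ) := by
    intro η hη hc hs t y hy
    have e := (localRep_add_smul_extendSection hη hc (hs.trans hsrc) φ t).mono hsrc
    have e' : EqOn (T.push (localRep (n := n) F x₀
        (φ + t • extendSection x₀ hη hc (hs.trans hsrc) : SmoothSection n F E)))
        (T.push (localRep (n := n) F x₀ φ + t • η)) T.target := fun z hz =>
      congrArg (fun u => T.fiberMap (T.inv z, u)) (e (T.mapsTo_inv hz))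
    rw [← jetAt_congr T.isOpen_source e hy, h.apply_jetAt _ hy,
      jetAt_congr T.isOpen_target e' (T.mapsTo_map hy)]
  rw [jetCoord_jet hx, ← jetAt_push_localRep ψ φ hx hx₁]
  exact hnear.eulerOp_eq (hA.mono_set (inCharts_target_subset ψ x₀ x₁)) (hB.mono_set hsrc)
    ((contDiffOn_localRep φ x₀).mono hsrc) (chart_mem_inCharts_source ψ hx hx₁) v

theorem coordDH_jetAt {U : Set (EuclideanSpace ℝ (Fin n))} (hU : IsOpen U) {k r : ℕ}
    {A : JetCoord n F → EuclideanSpace ℝ (Fin n) [⋀^Fin k]→L[ℝ] ℝ} (hA : JetSmoothOn U r A)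
    {φ : EuclideanSpace ℝ (Fin n) → F} (hφ : ContDiffOn ℝ ∞ φ U) {y : EuclideanSpace ℝ (Fin n)}
    (hy : y ∈ U) : coordDH A (jetAt φ y) = extDeriv (fun y => A (jetAt φ y)) y := by
  rw [coordDH, extDeriv]
  congr 1
  ext1 w
  conv_rhs => rw [sum_smul_coordVec w, map_sum]
  rw [sum_apply]
  refine Finset.sum_congr rfl fun i _ => ?_
  rw [map_smul, hA.fderiv_jetAt hU hφ i hy]
  rfl

/-- Evaluated along a section, both sides are exterior derivatives of forms on `ℝⁿ`, and `extDeriv`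
commutes with pull-back. -/
theorem IsCoordPullback.coordDH_eq {ψ : FiberAut n F E} {x₀ x₁ : M} {k r r' : ℕ}
    {A B : JetCoord n F → EuclideanSpace ℝ (Fin n) [⋀^Fin k]→L[ℝ] ℝ}
    (hA : JetSmoothOn (coordDomain (n := n) F E x₁) r A)
    (hB : JetSmoothOn (coordDomain (n := n) F E x₀) r' B)
    (h : IsCoordPullback ψ x₀ x₁ A B) : IsCoordPullback ψ x₀ x₁ (coordDH A) (coordDH B) := by
  intro φ x hx hx₁
  set T := ψ.inCharts x₀ x₁ with hT
  have hsrc : T.source ⊆ coordDomain (n := n) F E x₀ := inCharts_source_subset ψ x₀ x₁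
  have hA' := hA.mono_set (inCharts_target_subset ψ x₀ x₁)
  have hy := chart_mem_inCharts_source ψ hx hx₁
  have hφ := (contDiffOn_localRep φ x₀).mono hsrc
  have hp := T.contDiffOn_push hφ
  rw [jetCoord_jet hx, ← jetAt_push_localRep ψ φ hx hx₁,
    coordDH_jetAt T.isOpen_source (hB.mono_set hsrc) hφ hy,
    coordDH_jetAt T.isOpen_target hA' hp (T.mapsTo_map hy)]
  have e : (fun y => B (jetAt (localRep (n := n) F x₀ φ) y)) =ᶠ[𝓝 (chartAt _ x₀ x)] fun y =>
      ((fun z => A (jetAt (T.push (localRep (n := n) F x₀ φ)) z))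
        (T.map y)).compContinuousLinearMap (fderiv ℝ T.map y) := by
    filter_upwards [T.isOpen_source.mem_nhds hy] with y hy using h.apply_jetAt φ hy
  rw [e.extDeriv_eq]
  exact extDeriv_pullback
    (differentiableAt_of_contDiffOn T.isOpen_target (hA'.contDiffOn_jetAt T.isOpen_target hp)
      (T.mapsTo_map hy))
    (T.contDiffOn_map.contDiffAt (T.isOpen_source.mem_nhds hy))
    (by rw [minSmoothness_of_isRCLikeNormedField]; exact two_le_infty)

end Naturality

/-! ### The horizontal complex: independence of charts and pull-backs. -/

section HorizontalComplex

variable {n : ℕ} {F : Type*} [NormedAddCommGroup F] [NormedSpace ℝ F]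
  {M : Type*} [TopologicalSpace M] [ChartedSpace (EuclideanSpace ℝ (Fin n)) M]
  {E : M → Type*} [TopologicalSpace (TotalSpace F E)] [∀ x, TopologicalSpace (E x)]
  [∀ x, AddCommGroup (E x)] [∀ x, Module ℝ (E x)] [FiberBundle F E]
  {W : Type*} [NormedAddCommGroup W] [NormedSpace ℝ W]

variable [IsManifold (𝓡 n) ∞ M] [VectorBundle ℝ F E] [ContMDiffVectorBundle ∞ F E (𝓡 n)]

variable (n F E) in
/-- The identity automorphism. -/
def FiberAut.refl : FiberAut n F E where
  toDiffeo := Diffeomorph.refl _ _ _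
  base := Diffeomorph.refl _ _ _
  proj_apply _ := rfl

theorem prolong_refl_jet (φ : SmoothSection n F E) (x : M) :
    (FiberAut.refl n F E).prolong (jet φ x) = jet φ x := rfl

theorem baseDeriv_refl (x : M) :
    (FiberAut.refl n F E).baseDeriv x = ContinuousLinearMap.id ℝ _ :=
  mfderiv_id

theorem tangentCoordChange_self_eq_id (x : M) :
    tangentCoordChange (𝓡 n) x x x = ContinuousLinearMap.id ℝ (EuclideanSpace ℝ (Fin n)) :=
  ContinuousLinearMap.ext fun _ => tangentCoordChange_self (I := 𝓡 n) (by simp)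

theorem fderiv_inCharts_self (ψ : FiberAut n F E) (x : M) :
    fderiv ℝ (ψ.inCharts x (ψ.base x)).map (chartAt _ x x) = ψ.baseDeriv x := by
  have h := baseDeriv_comp_tangentCoordChange ψ (mem_chartDomain_self x)
    (mem_chartDomain_self (ψ.base x))
  rw [tangentCoordChange_self_eq_id, tangentCoordChange_self_eq_id] at h
  simpa using h.symm

theorem fderiv_inCharts_refl {x₀ x : M} (hx : x ∈ chartDomain (n := n) F E x₀) :
    fderiv ℝ ((FiberAut.refl n F E).inCharts x₀ x).map (chartAt _ x₀ x) =
      tangentCoordChange (𝓡 n) x₀ x x := by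
  have h := baseDeriv_comp_tangentCoordChange (FiberAut.refl n F E) hx (mem_chartDomain_self x)
  rw [baseDeriv_refl, ContinuousLinearMap.id_comp] at h
  have h' : tangentCoordChange (𝓡 n) x ((FiberAut.refl n F E).base x)
      ((FiberAut.refl n F E).base x) = ContinuousLinearMap.id ℝ (EuclideanSpace ℝ (Fin n)) :=
    tangentCoordChange_self_eq_id x
  rw [h', ContinuousLinearMap.id_comp] at h
  exact h.symm

theorem formInChart_eq_comp {k : ℕ} {x₀ x₁ x : M} (hx : x ∈ chartDomain (n := n) F E x₀)
    (hx₁ : x ∈ chartDomain (n := n) F E x₁) (β : TangentSpace (𝓡 n) x [⋀^Fin k]→L[ℝ] ℝ) :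
    formInChart x₀ x β = (formInChart x₁ x β).compContinuousLinearMap
      (fderiv ℝ ((FiberAut.refl n F E).inCharts x₀ x₁).map (chartAt _ x₀ x)) := by
  have h := baseDeriv_comp_tangentCoordChange (FiberAut.refl n F E) hx hx₁
  rw [baseDeriv_refl, ContinuousLinearMap.id_comp] at h
  ext v
  change β (fun i => tangentCoordChange (𝓡 n) x₀ x x (v i)) = _
  rw [h]
  rfl

theorem isCoordPullback_pullback (ψ : FiberAut n F E) {x₀ x₁ : M} {k r r' : ℕ}
    {α : HForm n F E k} {A B : JetCoord n F → EuclideanSpace ℝ (Fin n) [⋀^Fin k]→L[ℝ] ℝ}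
    (hA : IsCoordExpr x₁ r (HForm.inChart α x₁) A)
    (hB : IsCoordExpr x₀ r' (HForm.inChart (pullback ψ α) x₀) B) :
    IsCoordPullback ψ x₀ x₁ A B := fun φ x hx hx₁ => by
  rw [← hB.2 (jet φ x) hx, ← hA.2 (ψ.prolong (jet φ x)) hx₁, inChart_pullback ψ α φ hx hx₁]

/-- A change of adapted coordinates is the identity automorphism read in two charts, so independence
of coordinates becomes a case of naturality. -/
theorem isCoordPullback_refl {x₀ x₁ : M} {k r r' : ℕ}
    {α : HForm n F E k} {A B : JetCoord n F → EuclideanSpace ℝ (Fin n) [⋀^Fin k]→L[ℝ] ℝ}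
    (hA : IsCoordExpr x₁ r (HForm.inChart α x₁) A)
    (hB : IsCoordExpr x₀ r' (HForm.inChart α x₀) B) :
    IsCoordPullback (FiberAut.refl n F E) x₀ x₁ A B := fun φ x hx hx₁ => by
  rw [prolong_refl_jet, ← hB.2 (jet φ x) hx, ← hA.2 (jet φ x) hx₁]
  exact formInChart_eq_comp hx hx₁ _

theorem exists_isCoordExpr_coordExpr {k : ℕ} {α : HForm n F E k}
    (hα : α ∈ horizontalForms n F E k) (x₀ : M) :
    ∃ r, IsCoordExpr x₀ r (HForm.inChart α x₀) (coordExpr x₀ (HForm.inChart α x₀)) := by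
  obtain ⟨r, h⟩ := hα
  obtain ⟨A, hA⟩ := h x₀
  exact coordExpr_spec ⟨A, r, hA⟩

theorem pullback_mem_horizontalForms [FiniteDimensional ℝ F] (ψ : FiberAut n F E) {k : ℕ}
    {α : HForm n F E k} (hα : α ∈ horizontalForms n F E k) :
    pullback ψ α ∈ horizontalForms n F E k := by
  obtain ⟨r, h⟩ := hα
  refine ⟨r, fun x₀ => exists_isCoordExpr_of_local x₀ r _ fun x hx => ?_⟩
  obtain ⟨A, hA⟩ := h (ψ.base x)
  set T := ψ.inCharts x₀ (ψ.base x) with hT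
  -- Near `x` the chart at `ψ_M x` is used in the target. The prolongation preserves the order, so
  -- one bound `r` serves all points.
  obtain ⟨B, hB, hBA⟩ := T.exists_jetSmoothOn_push
    (hA.jetSmoothOn.mono_set (inCharts_target_subset ψ x₀ (ψ.base x)))
  refine ⟨T.source, T.isOpen_source, chart_mem_inCharts_source ψ hx (mem_chartDomain_self _),
    fun p => (B p).compContinuousLinearMap (fderiv ℝ T.map p.1), ?_, fun φ x' hx' hxs => ?_⟩
  · exact hB.comp₂ (JetSmoothOn.of_base r
      (T.contDiffOn_map.fderiv_of_isOpen (m := ∞) T.isOpen_source (by simp)))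
      (contDiff_compContinuousLinearMap k)
  · have hx₁ : ψ.base x' ∈ chartDomain (n := n) F E (ψ.base x) := by
      obtain ⟨x'', hx'', he⟩ := hxs
      exact (chartAt _ x₀).injOn hx''.1.1 hx'.1 he ▸ hx''.2
    change _ = (B (jetAt (localRep (n := n) F x₀ φ) (chartAt _ x₀ x'))).compContinuousLinearMap
      (fderiv ℝ T.map (chartAt _ x₀ x'))
    rw [inChart_pullback ψ α φ hx' hx₁, hA.2 _ hx₁,
      hBA _ ((contDiffOn_localRep φ x₀).mono (inCharts_source_subset ψ x₀ (ψ.base x))) _ hxs,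
      jetAt_push_localRep ψ φ hx' hx₁]

/-- `dH` is defined at each jet in the chart centered at its own base point; smooth dependence on
the jet becomes visible only in a fixed chart `x₀`. -/
theorem inChart_dH {k : ℕ} {α : HForm n F E k} (hα : α ∈ horizontalForms n F E k) {x₀ x : M}
    (hx : x ∈ chartDomain (n := n) F E x₀) {r : ℕ}
    {A : JetCoord n F → EuclideanSpace ℝ (Fin n) [⋀^Fin k]→L[ℝ] ℝ}
    (hA : IsCoordExpr x₀ r (HForm.inChart α x₀) A) (φ : SmoothSection n F E) :
    HForm.inChart (dH α) x₀ (jet φ x) = coordDH A (jetCoord x₀ (jet φ x)) := by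
  obtain ⟨r', hC⟩ := exists_isCoordExpr_coordExpr hα x
  have h := (isCoordPullback_refl hC hA).coordDH_eq hC.jetSmoothOn hA.jetSmoothOn φ x hx
    (mem_chartDomain_self x)
  rw [h, fderiv_inCharts_refl hx]
  rfl

theorem JetSmoothOn.coordDH {U : Set (EuclideanSpace ℝ (Fin n))} (hU : IsOpen U) {k r : ℕ}
    {A : JetCoord n F → EuclideanSpace ℝ (Fin n) [⋀^Fin k]→L[ℝ] ℝ} (hA : JetSmoothOn U r A) :
    JetSmoothOn U (r + 1) (JetBundle.coordDH A) := by
  have h : JetSmoothOn U (r + 1) fun p => ∑ i : Fin n,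
      (EuclideanSpace.proj i : EuclideanSpace ℝ (Fin n) →L[ℝ] ℝ).smulRight
        (JetBundle.totalD i A p) := by
    refine JetSmoothOn.sum (A := fun i p =>
      (EuclideanSpace.proj i : EuclideanSpace ℝ (Fin n) →L[ℝ] ℝ).smulRight
        (JetBundle.totalD i A p)) fun i _ => (hA.totalD hU i).comp ?_
    exact ContinuousLinearMap.contDiff (𝕜 := ℝ) (F := EuclideanSpace ℝ (Fin n) →L[ℝ]
        EuclideanSpace ℝ (Fin n) [⋀^Fin k]→L[ℝ] ℝ)
      (ContinuousLinearMap.smulRightL ℝ (EuclideanSpace ℝ (Fin n))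
        (EuclideanSpace ℝ (Fin n) [⋀^Fin k]→L[ℝ] ℝ)
        (EuclideanSpace.proj i : EuclideanSpace ℝ (Fin n) →L[ℝ] ℝ))
  exact h.comp (ContinuousLinearMap.contDiff (𝕜 := ℝ) (E := EuclideanSpace ℝ (Fin n) →L[ℝ]
      EuclideanSpace ℝ (Fin n) [⋀^Fin k]→L[ℝ] ℝ)
    (F := EuclideanSpace ℝ (Fin n) [⋀^Fin (k + 1)]→L[ℝ] ℝ)
    (ContinuousAlternatingMap.alternatizeUncurryFinCLM ℝ (EuclideanSpace ℝ (Fin n)) ℝ))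

theorem dH_mem_horizontalForms {k : ℕ} {α : HForm n F E k} (hα : α ∈ horizontalForms n F E k) :
    dH α ∈ horizontalForms n F E (k + 1) := by
  obtain ⟨r, h⟩ := id hα
  refine ⟨r + 1, fun x₀ => ?_⟩
  obtain ⟨A, hA⟩ := h x₀
  refine (hA.jetSmoothOn.coordDH (isOpen_coordDomain x₀)).exists_isCoordExpr fun φ x hx => ?_
  rw [inChart_dH hα hx hA, jetCoord_jet hx]

/-- Removes the chosen `coordExpr`, which is not visibly additive in `α`. The differentiability is
what additivity of `extDeriv` requires. -/
theorem dH_jet {k : ℕ} {α : HForm n F E k} (hα : α ∈ horizontalForms n F E k)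
    (φ : SmoothSection n F E) (x : M) :
    dH α (jet φ x) = extDeriv (fun y => HForm.inChart α x (jet φ ((chartAt _ x).symm y)))
      (chartAt (EuclideanSpace ℝ (Fin n)) x x) ∧
    DifferentiableAt ℝ (fun y => HForm.inChart α x (jet φ ((chartAt _ x).symm y)))
      (chartAt (EuclideanSpace ℝ (Fin n)) x x) := by
  obtain ⟨r, hC⟩ := exists_isCoordExpr_coordExpr hα x
  have hx := mem_chartDomain_self (n := n) (F := F) (E := E) x
  have hU := isOpen_coordDomain (n := n) (F := F) (E := E) x
  have e : (fun y => coordExpr x (HForm.inChart α x) (jetAt (localRep (n := n) F x φ) y))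
      =ᶠ[𝓝 (chartAt (EuclideanSpace ℝ (Fin n)) x x)]
      (fun y => HForm.inChart α x (jet φ ((chartAt _ x).symm y))) := by
    filter_upwards [hU.mem_nhds (chart_mem_coordDomain hx)] with y hy
    rw [hC.2 _ (chart_symm_mem hy), jetCoord_jet (chart_symm_mem hy), chart_chart_symm hy]
  constructor
  · rw [← e.extDeriv_eq, ← coordDH_jetAt hU hC.jetSmoothOn (contDiffOn_localRep φ x)
      (chart_mem_coordDomain hx), ← jetCoord_jet hx]
    rfl
  · exact (differentiableAt_of_contDiffOn hU (hC.jetSmoothOn.contDiffOn_jetAt hU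
      (contDiffOn_localRep φ x)) (chart_mem_coordDomain hx)).congr_of_eventuallyEq e.symm

theorem dH_add {k : ℕ} {α β : HForm n F E k} (hα : α ∈ horizontalForms n F E k)
    (hβ : β ∈ horizontalForms n F E k) : dH (α + β) = dH α + dH β := by
  funext j
  obtain ⟨φ, hφ⟩ := exists_jet_eq j
  rw [hφ]
  change dH (α + β) (jet φ j.1) = dH α (jet φ j.1) + dH β (jet φ j.1)
  rw [(dH_jet (add_mem hα hβ) φ j.1).1, (dH_jet hα φ j.1).1, (dH_jet hβ φ j.1).1]
  exact extDeriv_fun_add (dH_jet hα φ j.1).2 (dH_jet hβ φ j.1).2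

theorem dH_pullback [FiniteDimensional ℝ F] (ψ : FiberAut n F E) {k : ℕ} {α : HForm n F E k}
    (hα : α ∈ horizontalForms n F E k) : dH (pullback ψ α) = pullback ψ (dH α) := by
  funext j
  obtain ⟨φ, hφ⟩ := exists_jet_eq j
  set x := j.1
  rw [hφ]
  obtain ⟨r, hB⟩ := exists_isCoordExpr_coordExpr (pullback_mem_horizontalForms ψ hα) x
  obtain ⟨r', hA⟩ := exists_isCoordExpr_coordExpr hα (ψ.base x)
  have h := (isCoordPullback_pullback ψ hA hB).coordDH_eq hA.jetSmoothOn hB.jetSmoothOn φ x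
    (mem_chartDomain_self x) (mem_chartDomain_self (ψ.base x))
  rw [fderiv_inCharts_self] at h
  exact h

end HorizontalComplex

/-! ### The Euler–Lagrange operator on the bundle. -/

section EulerLagrange

variable {n : ℕ} {F : Type*} [NormedAddCommGroup F] [NormedSpace ℝ F]
  {M : Type*} [TopologicalSpace M] [ChartedSpace (EuclideanSpace ℝ (Fin n)) M]
  {E : M → Type*} [TopologicalSpace (TotalSpace F E)] [∀ x, TopologicalSpace (E x)]
  [∀ x, AddCommGroup (E x)] [∀ x, Module ℝ (E x)] [FiberBundle F E]
  {W : Type*} [NormedAddCommGroup W] [NormedSpace ℝ W]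


variable [IsManifold (𝓡 n) ∞ M] [VectorBundle ℝ F E] [ContMDiffVectorBundle ∞ F E (𝓡 n)]

/-- Transition functions of a vector bundle are linear on fibers, hence equal to their own vertical
derivatives. -/
theorem vertical_inCharts_refl {x₀ x : M} (hx : x ∈ chartDomain (n := n) F E x₀)
    (φ : EuclideanSpace ℝ (Fin n) → F) (v : F) :
    ((FiberAut.refl n F E).inCharts x₀ x).vertical φ (chartAt _ x₀ x) v =
      (trivializationAt F E x).linearMapAt ℝ x ((trivializationAt F E x₀).symmₗ ℝ x v) := by
  have hb : x ∈ (trivializationAt F E x₀).baseSet ∩ (trivializationAt F E x).baseSet :=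
    ⟨hx.2, FiberBundle.mem_baseSet_trivializationAt' x⟩
  have e : (fun w => ((FiberAut.refl n F E).inCharts x₀ x).fiberMap (chartAt _ x₀ x, w)) =
      ((trivializationAt F E x₀).coordChangeL ℝ (trivializationAt F E x) x : F →L[ℝ] F) := by
    funext w
    refine Eq.trans ?_ (Bundle.Trivialization.coordChangeL_apply' _ _ hb w).symm
    simp only [FiberAut.inCharts, chart_symm_chart hx]
    rfl
  rw [FiberChange.vertical, e, ContinuousLinearMap.fderiv]
  refine (Bundle.Trivialization.coordChangeL_apply _ _ hb v).trans ?_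
  rw [trivialization_linearMapAt hb.2, Bundle.Trivialization.coe_symmₗ _ hb.1]

/-- The Euler-Lagrange operator is given by the Euler operator in any adapted coordinates. -/
theorem formInChart_eulerLagrange [T2Space M] {α : HForm n F E n}
    (hα : α ∈ horizontalForms n F E n) {x₀ x : M} (hx : x ∈ chartDomain (n := n) F E x₀) {r : ℕ}
    {A : JetCoord n F → EuclideanSpace ℝ (Fin n) [⋀^Fin n]→L[ℝ] ℝ}
    (hA : IsCoordExpr x₀ r (HForm.inChart α x₀) A) (φ : SmoothSection n F E) (v : F) :
    formInChart x₀ x (eulerLagrange α (jet φ x) ((trivializationAt F E x₀).symmₗ ℝ x v)) =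
      eulerOp A (jetCoord x₀ (jet φ x)) v := by
  obtain ⟨r', hC⟩ := exists_isCoordExpr_coordExpr hα x
  rw [(isCoordPullback_refl hC hA).eulerOp_eq hC.jetSmoothOn hA.jetSmoothOn φ hx
    (mem_chartDomain_self x) v, fderiv_inCharts_refl hx, vertical_inCharts_refl hx]
  rfl

theorem isSourceForm_eulerLagrange [T2Space M] {α : HForm n F E n}
    (hα : α ∈ horizontalForms n F E n) : IsSourceForm n F E (eulerLagrange α) := by
  obtain ⟨r, h⟩ := id hα
  refine ⟨r + r, fun x₀ v => ?_⟩
  obtain ⟨A, hA⟩ := h x₀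
  have hE := (hA.jetSmoothOn.eulerOp (isOpen_coordDomain x₀)).comp (g := fun L => L v)
    (contDiff_id.clm_apply contDiff_const)
  refine hE.exists_isCoordExpr fun φ x hx => ?_
  rw [← jetCoord_jet hx]
  exact formInChart_eulerLagrange hα hx hA φ v

theorem vertical_inCharts_self (ψ : FiberAut n F E) (φ : SmoothSection n F E) (x : M) :
    (ψ.inCharts x (ψ.base x)).vertical (localRep (n := n) F x φ) (chartAt _ x x) =
      fderiv ℝ (fun w : F => (trivializationAt F E (ψ.base x)
        (ψ.toDiffeo ((trivializationAt F E x).toOpenPartialHomeomorph.symm (x, w)))).2)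
        ((jetCoord x (jet φ x)).2 0) := by
  have hx := mem_chartDomain_self (n := n) (F := F) (E := E) x
  rw [jetCoord_jet hx, FiberChange.vertical]
  simp only [FiberAut.inCharts, chart_symm_chart hx, jetAt, partialD_zero]

/-- Naturality of the Euler-Lagrange operator. -/
theorem eulerLagrange_pullback [T2Space M] [FiniteDimensional ℝ F] (ψ : FiberAut n F E)
    {α : HForm n F E n} (hα : α ∈ horizontalForms n F E n) :
    eulerLagrange (pullback ψ α) = pullbackSource ψ (eulerLagrange α) := by
  funext j
  obtain ⟨φ, hφ⟩ := exists_jet_eq j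
  set x := j.1
  rw [hφ]
  obtain ⟨r, hB⟩ := exists_isCoordExpr_coordExpr (pullback_mem_horizontalForms ψ hα) x
  obtain ⟨r', hA⟩ := exists_isCoordExpr_coordExpr hα (ψ.base x)
  refine LinearMap.ext fun v => ?_
  have h := (isCoordPullback_pullback ψ hA hB).eulerOp_eq hA.jetSmoothOn hB.jetSmoothOn φ
    (mem_chartDomain_self x) (mem_chartDomain_self (ψ.base x))
    ((trivializationAt F E x).linearMapAt ℝ x v)
  rw [fderiv_inCharts_self, vertical_inCharts_self] at h
  refine h.trans ?_
  have hb := FiberBundle.mem_baseSet_trivializationAt' (F := F) (E := E) (ψ.base x)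
  have hv : (trivializationAt F E (ψ.base x)).linearMapAt ℝ (ψ.base x)
      (verticalDeriv ψ (jet φ x) v) = fderiv ℝ (fun w : F => (trivializationAt F E (ψ.base x)
        (ψ.toDiffeo ((trivializationAt F E x).toOpenPartialHomeomorph.symm (x, w)))).2)
        ((jetCoord x (jet φ x)).2 0) ((trivializationAt F E x).linearMapAt ℝ x v) :=
    Bundle.Trivialization.linearMapAt_symmₗ _ hb _
  rw [← hv]
  rfl

end EulerLagrange

/-! ### Equivariance of the bracket and covariance of `ω`. -/

section Bracket

variable {n : ℕ} {F : Type*} [NormedAddCommGroup F] [NormedSpace ℝ F]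
  {M : Type*} [TopologicalSpace M] [ChartedSpace (EuclideanSpace ℝ (Fin n)) M]
  {E : M → Type*} [TopologicalSpace (TotalSpace F E)] [∀ x, TopologicalSpace (E x)]
  [∀ x, AddCommGroup (E x)] [∀ x, Module ℝ (E x)] [FiberBundle F E]
  {W : Type*} [NormedAddCommGroup W] [NormedSpace ℝ W]


variable [IsManifold (𝓡 n) ∞ M] [VectorBundle ℝ F E] [ContMDiffVectorBundle ∞ F E (𝓡 n)]

/-- Needed in order to iterate the bracket: naturality of `E` applies only to forms with local
coefficients. -/
theorem bracket_mem_horizontalForms [T2Space M] (om : BracketTensor n F E) (ν : VolumeForm n M)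
    {α β : HForm n F E n} (hα : α ∈ horizontalForms n F E n) (hβ : β ∈ horizontalForms n F E n) :
    bracket om ν α β ∈ horizontalForms n F E n := by
  obtain ⟨r, h⟩ := om.isLocalFun _ _ (isSourceForm_eulerLagrange hα) (isSourceForm_eulerLagrange hβ)
  refine ⟨r, fun x₀ => ?_⟩
  obtain ⟨A, hA⟩ := h x₀
  have hsub : coordDomain (n := n) F E x₀ ⊆ (chartAt (EuclideanSpace ℝ (Fin n)) x₀).target := by
    rintro _ ⟨x, hx, rfl⟩
    exact (chartAt _ x₀).map_source hx.1
  have hs := hA.jetSmoothOn.comp₂ (JetSmoothOn.of_base r ((ν.smooth x₀).mono hsub))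
    (g := fun q : ℝ × (EuclideanSpace ℝ (Fin n) [⋀^Fin n]→L[ℝ] ℝ) => q.1 • q.2) contDiff_smul
  refine hs.exists_isCoordExpr fun φ x hx => ?_
  have h1 := hA.2 (jet φ x) hx
  rw [jetCoord_jet hx] at h1
  simp only [jetAt] at h1 ⊢
  rw [← h1, chart_symm_chart hx]
  rfl

theorem topForm_eq_smul (β μ : EuclideanSpace ℝ (Fin n) [⋀^Fin n]→L[ℝ] ℝ) (hμ : μ ≠ 0) :
    β = (β (fun i => coordVec i) / μ (fun i => coordVec i)) • μ := by
  let b := (EuclideanSpace.basisFun (Fin n) ℝ).toBasis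
  have hb : (fun i => coordVec i) = ⇑b := by
    funext i
    simp [b, coordVec]
  have h : ∀ ζ : EuclideanSpace ℝ (Fin n) [⋀^Fin n]→L[ℝ] ℝ, ∀ v,
      ζ v = ζ (fun i => coordVec i) * b.det v := fun ζ v => by
    rw [hb]
    exact congrArg (fun l => l v) (AlternatingMap.eq_smul_basis_det b ζ.toAlternatingMap)
  have h0 : μ (fun i => coordVec i) ≠ 0 := fun h0 => hμ (by
    ext v
    rw [h μ, h0, zero_mul]
    rfl)
  ext v
  rw [ContinuousAlternatingMap.smul_apply, h β, h μ v, smul_eq_mul]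
  field_simp

theorem volumeForm_pullback (ν : VolumeForm n M) (ψ : FiberAut n F E) (x : M) :
    (ν.toFun (ψ.base x)).compContinuousLinearMap (mfderiv (𝓡 n) (𝓡 n) ψ.base x) =
      detBase ν ψ x • ν.toFun x :=
  topForm_eq_smul _ _ (ν.ne_zero x)

theorem pullback_bracket_apply (om : BracketTensor n F E) (ν : VolumeForm n M)
    (ψ : FiberAut n F E) (α β : HForm n F E n) (j : JetSpace n F E) :
    pullback ψ (bracket om ν α β) j =
      (detBase ν ψ j.1 * om.toFun (ψ.prolong j) (eulerLagrange α (ψ.prolong j))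
        (eulerLagrange β (ψ.prolong j))) • ν.toFun j.1 := by
  rw [mul_comm, mul_smul, ← volumeForm_pullback]
  rfl

theorem IsCovariant.bracket_pullback [T2Space M] [FiniteDimensional ℝ F] {om : BracketTensor n F E}
    {ν : VolumeForm n M} {ψ : FiberAut n F E} (h : IsCovariant om ν ψ) {α β : HForm n F E n}
    (hα : α ∈ horizontalForms n F E n) (hβ : β ∈ horizontalForms n F E n) :
    bracket om ν (pullback ψ α) (pullback ψ β) = pullback ψ (bracket om ν α β) := by
  funext j
  rw [pullback_bracket_apply, bracket, eulerLagrange_pullback ψ hα, eulerLagrange_pullback ψ hβ,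
    h _ _ (isSourceForm_eulerLagrange hα) (isSourceForm_eulerLagrange hβ)]

open Classical in
/-- A horizontal form in adapted coordinates, supported over a compact subset of the coordinate
domain, extends by zero. -/
theorem exists_horizontalForm_of_support [T2Space M] [FiniteDimensional ℝ F] {x₁ : M} {r k : ℕ}
    {A : JetCoord n F → EuclideanSpace ℝ (Fin n) [⋀^Fin k]→L[ℝ] ℝ}
    (hA : JetSmoothOn (coordDomain (n := n) F E x₁) r A) {K : Set (EuclideanSpace ℝ (Fin n))}
    (hK : IsCompact K) (hKs : K ⊆ coordDomain (n := n) F E x₁) (h0 : ∀ p, p.1 ∉ K → A p = 0) :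
    ∃ α ∈ horizontalForms n F E k, ∀ j : JetSpace n F E, j.1 ∈ chartDomain (n := n) F E x₁ →
      HForm.inChart α x₁ j = A (jetCoord x₁ j) := by
  let α : HForm n F E k := fun j => if j.1 ∈ chartDomain (n := n) F E x₁ then
    (A (jetCoord x₁ j)).compContinuousLinearMap (tangentCoordChange (𝓡 n) j.1 x₁ j.1) else 0
  have hα : ∀ j : JetSpace n F E, j.1 ∈ chartDomain (n := n) F E x₁ →
      HForm.inChart α x₁ j = A (jetCoord x₁ j) := by
    intro j hj
    have hv : ∀ v, tangentCoordChange (𝓡 n) j.1 x₁ j.1 (tangentCoordChange (𝓡 n) x₁ j.1 j.1 v) =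
        v := fun v => by
      rw [tangentCoordChange_comp, tangentCoordChange_self] <;> simp [hj.1]
    simp only [HForm.inChart, α, if_pos hj]
    ext v
    change A (jetCoord x₁ j) (fun i => tangentCoordChange (𝓡 n) j.1 x₁ j.1
      (tangentCoordChange (𝓡 n) x₁ j.1 j.1 (v i))) = _
    simp only [hv]
  refine ⟨α, ⟨r, fun x₀ => exists_isCoordExpr_of_local x₀ r _ fun x hx => ?_⟩, hα⟩
  set ψ := FiberAut.refl n F E with hψ
  -- Inside the coordinate domain at `x₁` the expression `A` is transported to the chart at `x₀`. A
  -- point outside it has a neighborhood disjoint from the closed image of `K`, where the form is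
  -- zero.
  by_cases hx₁ : x ∈ chartDomain (n := n) F E x₁
  · set T := ψ.inCharts x₀ x₁ with hT
    obtain ⟨B, hB, hBA⟩ := T.exists_jetSmoothOn_push
      (hA.mono_set (inCharts_target_subset ψ x₀ x₁))
    refine ⟨T.source, T.isOpen_source, chart_mem_inCharts_source ψ hx hx₁,
      fun p => (B p).compContinuousLinearMap (fderiv ℝ T.map p.1), ?_, fun φ x' hx' hxs => ?_⟩
    · exact hB.comp₂ (JetSmoothOn.of_base r
        (T.contDiffOn_map.fderiv_of_isOpen (m := ∞) T.isOpen_source (by simp)))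
        (contDiff_compContinuousLinearMap k)
    · have hx₁' : x' ∈ chartDomain (n := n) F E x₁ := by
        obtain ⟨x'', hx'', he⟩ := hxs
        exact (chartAt _ x₀).injOn hx''.1.1 hx'.1 he ▸ hx''.2
      change _ = (B (jetAt (localRep (n := n) F x₀ φ) (chartAt _ x₀ x'))).compContinuousLinearMap
        (fderiv ℝ T.map (chartAt _ x₀ x'))
      rw [hBA _ ((contDiffOn_localRep φ x₀).mono (inCharts_source_subset ψ x₀ x₁)) _ hxs,
        jetAt_push_localRep ψ φ hx' hx₁', hψ, prolong_refl_jet, ← hα _ hx₁']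
      exact formInChart_eq_comp hx' hx₁' _
  · have hKc : IsClosed ((chartAt (EuclideanSpace ℝ (Fin n)) x₁).symm '' K) :=
      (hK.image_of_continuousOn fun y hy =>
        (contMDiffAt_chart_symm (hKs hy)).continuousAt.continuousWithinAt).isClosed
    set S := chartDomain (n := n) F E x₀ ∩ ((chartAt (EuclideanSpace ℝ (Fin n)) x₁).symm '' K)ᶜ
    refine ⟨chartAt _ x₀ '' S, isOpen_chart_image x₀
      ((isOpen_chartDomain x₀).inter hKc.isOpen_compl) inter_subset_left,
      mem_image_of_mem _ ⟨hx, ?_⟩, fun _ => 0, JetSmoothOn.const r 0, fun φ x' hx' hxs => ?_⟩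
    · rintro ⟨y, hy, rfl⟩
      exact hx₁ (chart_symm_mem (hKs hy))
    · have hxK : x' ∈ ((chartAt (EuclideanSpace ℝ (Fin n)) x₁).symm '' K)ᶜ := by
        obtain ⟨x'', hx'', he⟩ := hxs
        exact (chartAt _ x₀).injOn hx''.1.1 hx'.1 he ▸ hx''.2
      have hz : α (jet φ x') = 0 := by
        by_cases h : x' ∈ chartDomain (n := n) F E x₁
        · refine (if_pos h).trans ?_
          rw [h0]
          · rfl
          · exact fun hk => hxK ⟨_, hk, chart_symm_chart h⟩
        · exact if_neg h
      rw [HForm.inChart, hz]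
      rfl

/-- For a Lagrangian of order zero only the term `J = 0` survives, and linearity in `u` makes its
derivative constant along the fiber. -/
theorem eulerOp_smul_zero_coord {W : Type*} [NormedAddCommGroup W] [NormedSpace ℝ W]
    {χ : EuclideanSpace ℝ (Fin n) → ℝ} (hχ : ContDiff ℝ ∞ χ) (L : F →L[ℝ] W) (p : JetCoord n F) :
    eulerOp (fun p : JetCoord n F => χ p.1 • L (p.2 0)) p = χ p.1 • L := by
  have hA : JetSmoothOn univ 0 fun p : JetCoord n F => χ p.1 • L (p.2 0) :=
    jetSmoothOn_zero_coord (g := fun q : EuclideanSpace ℝ (Fin n) × F => χ q.1 • L q.2)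
      ((hχ.comp contDiff_fst).smul (L.contDiff.comp contDiff_snd)).contDiffOn
  have h0 : multiIndices n 0 = {0} := by
    ext J
    simp [mem_multiIndices]
  rw [eulerOp_eq_sum isOpen_univ hA (mem_univ _), h0, Finset.sum_singleton, Multiset.toList_zero]
  change partialU 0 (fun p : JetCoord n F => χ p.1 • L (p.2 0)) p = _
  simp only [partialU, Function.update_self]
  exact ((L.hasFDerivAt (x := p.2 0)).const_smul (χ p.1)).fderiv

/-- Every value of a source form at a jet is the value of an Euler-Lagrange form. -/
theorem exists_eulerLagrange_eq [T2Space M] [FiniteDimensional ℝ F] (j : JetSpace n F E)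
    (σ : E j.1 →ₗ[ℝ] (TangentSpace (𝓡 n) j.1 [⋀^Fin n]→L[ℝ] ℝ)) :
    ∃ α ∈ horizontalForms n F E n, eulerLagrange α j = σ := by
  obtain ⟨x, q⟩ := j
  obtain ⟨φ, rfl⟩ := Quotient.exists_rep q
  have hx := mem_chartDomain_self (n := n) (F := F) (E := E) x
  let L : F →ₗ[ℝ] (EuclideanSpace ℝ (Fin n) [⋀^Fin n]→L[ℝ] ℝ) :=
    σ ∘ₗ (trivializationAt F E x).symmₗ ℝ x
  obtain ⟨χ, hχs, hχc, hχ, -, hχ1⟩ := exists_contDiff_tsupport_subset (n := ⊤)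
    ((isOpen_coordDomain (n := n) (F := F) (E := E) x).mem_nhds (chart_mem_coordDomain hx))
  -- The Lagrangian `χ(x) σ(u)`, with `σ` read in the trivialization at `x` and a cut-off `χ` equal
  -- to `1` at the base point; its Euler form there is `σ`.
  let A : JetCoord n F → EuclideanSpace ℝ (Fin n) [⋀^Fin n]→L[ℝ] ℝ := fun p =>
    χ p.1 • L.toContinuousLinearMap (p.2 0)
  have hg : ContDiff ℝ ∞ fun q : EuclideanSpace ℝ (Fin n) × F =>
      χ q.1 • L.toContinuousLinearMap q.2 :=
    (hχ.comp contDiff_fst).smul (L.toContinuousLinearMap.contDiff.comp contDiff_snd)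
  obtain ⟨α, hα, hαA⟩ := exists_horizontalForm_of_support (F := F) (E := E) (x₁ := x) (A := A)
    (jetSmoothOn_zero_coord hg.contDiffOn) hχc hχs fun p hp => by
      simp only [A, image_eq_zero_of_notMem_tsupport hp, zero_smul]
  have hA : IsCoordExpr x 0 (HForm.inChart α x) A := by
    refine ⟨⟨fun p => χ p.1 • L.toContinuousLinearMap
      (p.2 ⟨0, mem_multiIndices.2 (by simp)⟩), ?_, fun _ => rfl⟩, hαA⟩
    exact (hg.comp (contDiff_fst.prodMk
      ((contDiff_apply ℝ F _).comp contDiff_snd))).contDiffOn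
  refine ⟨α, hα, ?_⟩
  refine LinearMap.ext fun v => ?_
  have h := (formInChart_self x _).symm.trans
    (formInChart_eulerLagrange hα hx hA φ ((trivializationAt F E x).linearMapAt ℝ x v))
  rw [Bundle.Trivialization.symmₗ_linearMapAt _ hx.2, eulerOp_smul_zero_coord hχ] at h
  refine h.trans ?_
  change χ (chartAt _ x x) • σ ((trivializationAt F E x).symmₗ ℝ x
    ((trivializationAt F E x).linearMapAt ℝ x v)) = σ v
  rw [hχ1, one_smul, Bundle.Trivialization.symmₗ_linearMapAt _ hx.2]

theorem bracket_pullback_iff_isCovariant [T2Space M] [FiniteDimensional ℝ F]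
    (om : BracketTensor n F E) (ν : VolumeForm n M) (ψ : FiberAut n F E) :
    (∀ α ∈ horizontalForms n F E n, ∀ β ∈ horizontalForms n F E n,
      bracket om ν (pullback ψ α) (pullback ψ β) = pullback ψ (bracket om ν α β)) ↔
      IsCovariant om ν ψ := by
  refine ⟨fun h θ θ' _ _ j => ?_, fun h α hα β hβ => h.bracket_pullback hα hβ⟩
  obtain ⟨α, hα, hθ⟩ := exists_eulerLagrange_eq (ψ.prolong j) (θ (ψ.prolong j))
  obtain ⟨β, hβ, hθ'⟩ := exists_eulerLagrange_eq (ψ.prolong j) (θ' (ψ.prolong j))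
  -- The pulled-back source form at `j` depends only on the value at `jψ(j)`, so agreement at that
  -- single jet suffices.
  have key : ∀ {α : HForm n F E n} {θ : SForm n F E}, α ∈ horizontalForms n F E n →
      eulerLagrange α (ψ.prolong j) = θ (ψ.prolong j) →
      eulerLagrange (pullback ψ α) j = pullbackSource ψ θ j := fun hα e => by
    rw [eulerLagrange_pullback ψ hα]
    refine LinearMap.ext fun v => ?_
    simp only [pullbackSource, LinearMap.coe_mk, AddHom.coe_mk, e]
  have hj := congrFun (h α hα β hβ) j
  rw [pullback_bracket_apply, bracket, key hα hθ, key hβ hθ', hθ, hθ'] at hj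
  -- Both sides are multiples of `ν` at the base point, and `ν` does not vanish.
  exact smul_left_injective ℝ (ν.ne_zero j.1) hj

end Bracket

/-! ### The homotopy operator and pull-backs. -/

section Homotopy

variable {n : ℕ} {F : Type*} [NormedAddCommGroup F] [NormedSpace ℝ F]
  {M : Type*} [TopologicalSpace M] [ChartedSpace (EuclideanSpace ℝ (Fin n)) M]
  {E : M → Type*} [TopologicalSpace (TotalSpace F E)] [∀ x, TopologicalSpace (E x)]
  [∀ x, AddCommGroup (E x)] [∀ x, Module ℝ (E x)] [FiberBundle F E]
  {W : Type*} [NormedAddCommGroup W] [NormedSpace ℝ W]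


variable [IsManifold (𝓡 n) ∞ M] [VectorBundle ℝ F E] [ContMDiffVectorBundle ∞ F E (𝓡 n)]

theorem pullback_add (ψ : FiberAut n F E) {k : ℕ} (α β : HForm n F E k) :
    pullback ψ (α + β) = pullback ψ α + pullback ψ β := rfl

theorem pullback_sub (ψ : FiberAut n F E) {k : ℕ} (α β : HForm n F E k) :
    pullback ψ (α - β) = pullback ψ α - pullback ψ β := rfl

theorem dH_sub {k : ℕ} {α β : HForm n F E k} (hα : α ∈ horizontalForms n F E k)
    (hβ : β ∈ horizontalForms n F E k) : dH (α - β) = dH α - dH β := by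
  rw [eq_sub_iff_add_eq, ← dH_add (sub_mem hα hβ) hβ, sub_add_cancel]

theorem isInvariantSubcomplex_horizontalForms [FiniteDimensional ℝ F] (ψ : FiberAut n F E) :
    IsInvariantSubcomplex ψ (horizontalForms n F E) where
  le _ := le_rfl
  dH_mem _ _ h := dH_mem_horizontalForms h
  pullback_mem _ _ h := pullback_mem_horizontalForms ψ h

theorem IsCovariant.jacobiator_pullback [T2Space M] [FiniteDimensional ℝ F]
    {om : BracketTensor n F E} {ν : VolumeForm n M} {ψ : FiberAut n F E}
    (h : IsCovariant om ν ψ) {α β γ : HForm n F E n} (hα : α ∈ horizontalForms n F E n)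
    (hβ : β ∈ horizontalForms n F E n) (hγ : γ ∈ horizontalForms n F E n) :
    jacobiator om ν (pullback ψ α) (pullback ψ β) (pullback ψ γ) =
      pullback ψ (jacobiator om ν α β γ) := by
  simp only [jacobiator, pullback_add, pullback_sub, h.bracket_pullback hα hβ,
    h.bracket_pullback hα hγ, h.bracket_pullback hβ hγ,
    h.bracket_pullback (bracket_mem_horizontalForms om ν hα hβ) hγ,
    h.bracket_pullback (bracket_mem_horizontalForms om ν hα hγ) hβ,
    h.bracket_pullback (bracket_mem_horizontalForms om ν hβ hγ) hα]

/-- A homotopy operator commutes with pull-backs on exact forms, up to exact forms. -/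
theorem HomotopyIdentity.exists_exactForms [FiniteDimensional ℝ F] {ψ : FiberAut n F E}
    {X : ∀ k, Submodule ℝ (HForm n F E k)} (hX : IsInvariantSubcomplex ψ X)
    {s : ∀ k, HForm n F E (k + 1) →ₗ[ℝ] HForm n F E k} (hs : ∀ k, ∀ η ∈ X (k + 1), s k η ∈ X k)
    {k : ℕ} (h : HomotopyIdentity X s k) {η : HForm n F E k} (hη : η ∈ X k) :
    ∃ δ ∈ exactForms X k, s k (pullback ψ (dH η)) = pullback ψ (s k (dH η)) + δ := by
  have hψη := hX.pullback_mem k η hη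
  rw [← dH_pullback ψ (hX.le k hη)]
  -- In degree zero there is no form `s η`: the identity reads `s (d_H η) = -η` and the correction
  -- vanishes.
  cases k with
  | zero =>
    refine ⟨0, rfl, ?_⟩
    have h1 := h η hη
    have h2 := h _ hψη
    rw [neg_eq_iff_eq_neg] at h1 h2
    rw [h1, h2, add_zero]
    rfl
  | succ k =>
    have m1 := hs k η hη
    have m2 := hX.pullback_mem k _ m1
    have m3 := hs k _ hψη
    -- The terms `-(jψ)^* η` in the homotopy identities for `η` and `(jψ)^* η` cancel; the
    -- correction is `d_H` of the commutator of `(jψ)^*` and `s` on `η`.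
    refine ⟨dH (pullback ψ (s k η) - s k (pullback ψ η)), ⟨_, sub_mem m2 m3, rfl⟩, ?_⟩
    have h1 := h η hη
    have h2 := h _ hψη
    rw [neg_eq_iff_eq_neg] at h1 h2
    have e : pullback ψ (-(η + dH (s k η))) = -(pullback ψ η + pullback ψ (dH (s k η))) := rfl
    rw [h1, h2, e, dH_sub (hX.le k m2) (hX.le k m3), dH_pullback ψ (hX.le k m1)]
    abel

end Homotopy

end JetBundle

end

/-! ### The theorem, for a base of dimension `n + 1`. -/

theorem mainTheorem2 {n : ℕ} {F : Type*} [NormedAddCommGroup F] [NormedSpace ℝ F]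
    [FiniteDimensional ℝ F] {M : Type*} [TopologicalSpace M] [T2Space M]
    [SecondCountableTopology M] [ChartedSpace (EuclideanSpace ℝ (Fin (n + 1))) M]
    [IsManifold (𝓡 (n + 1)) ∞ M] {E : M → Type*} [TopologicalSpace (TotalSpace F E)]
    [∀ x, TopologicalSpace (E x)] [∀ x, AddCommGroup (E x)] [∀ x, Module ℝ (E x)]
    [FiberBundle F E] [VectorBundle ℝ F E] [ContMDiffVectorBundle ∞ F E (𝓡 (n + 1))]
    (ν : JetBundle.VolumeForm (n + 1) M) (om : JetBundle.BracketTensor (n + 1) F E)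
    (ψ : JetBundle.FiberAut (n + 1) F E) :
    ((∀ α ∈ JetBundle.horizontalForms (n + 1) F E (n + 1),
        ∀ β ∈ JetBundle.horizontalForms (n + 1) F E (n + 1),
          JetBundle.bracket om ν (JetBundle.pullback ψ α) (JetBundle.pullback ψ β) =
            JetBundle.pullback ψ (JetBundle.bracket om ν α β)) ↔
      JetBundle.IsCovariant om ν ψ) ∧
    (JetBundle.IsCovariant om ν ψ →
      ∀ X : ∀ k, Submodule ℝ (JetBundle.HForm (n + 1) F E k),
        (X = JetBundle.horizontalForms (n + 1) F E ∨ JetBundle.IsInvariantSubcomplex ψ X) →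
        ∀ s : ∀ k, JetBundle.HForm (n + 1) F E (k + 1) →ₗ[ℝ] JetBundle.HForm (n + 1) F E k,
          (∀ k, ∀ η ∈ X (k + 1), s k η ∈ X k) →
          JetBundle.HomotopyIdentity X s n →
          JetBundle.SatisfiesJacobi X om ν →
          ∀ α ∈ X (n + 1), ∀ β ∈ X (n + 1), ∀ γ ∈ X (n + 1),
            ∃ δ ∈ JetBundle.exactForms X n,
              JetBundle.l3 s om ν (JetBundle.pullback ψ α) (JetBundle.pullback ψ β)
                  (JetBundle.pullback ψ γ) =
                JetBundle.pullback ψ (JetBundle.l3 s om ν α β γ) + δ) := by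
  refine ⟨JetBundle.bracket_pullback_iff_isCovariant om ν ψ, ?_⟩
  intro hcov X hX s hs hid hJ α hα β hβ γ hγ
  have hX' : JetBundle.IsInvariantSubcomplex ψ X := by
    rcases hX with rfl | hX
    · exact JetBundle.isInvariantSubcomplex_horizontalForms ψ
    · exact hX
  -- The Jacobi identity enters only here: it provides a primitive `η` in `X` of the Jacobiator, one
  -- degree below the top, where the homotopy identity is assumed.
  obtain ⟨η, hη, he⟩ := hJ α hα β hβ γ hγ
  obtain ⟨δ, hδ, h⟩ := hid.exists_exactForms hX' hs hη
  refine ⟨δ, hδ, ?_⟩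
  rw [JetBundle.l3, JetBundle.l3, hcov.jacobiator_pullback (hX'.le _ hα) (hX'.le _ hβ)
    (hX'.le _ hγ), ← he, h]
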